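/- **Setting.** Let $d\in\{1,2,3\}$, $\varepsilon>0$, and let either (Neumann case) $\Omega\subset\mathbb R^d$ be a bounded domain with $C^2$ boundary, or (periodic case) $\Omega=(0,L)^d$ with $L>0$. Write $\|\cdot\|,(\cdot,\cdot)$ for the norm and inner product of $L^2(\Omega)$, and $\dot H^1$ for $H^1(\Omega)$ (Neumann) or for the space of $L$-periodic $H^1$ functions (periodic). Let $A=-\Delta$ be the self-adjoint operator on $L^2(\Omega)$ with the respective boundary condition: $v\in\mathcal D(A)$ and $Av=z$ mean $v\in\dot H^1$, $z\in L^2(\Omega)$, $(\nabla v,\nabla\varphi)=(z,\varphi)$ for all $\varphi\in\dot H^1$. Put $|v|_1=\|A^{1/2}v\|=\|\nabla v\|$, $m(v)=|\Omega|^{-1}\int_\Omega v$, $\bar v=v-m(v)$, and $|v|_{-1}=\sup_{\chi\in\dot H^1,\,|\chi|_1\neq0}|(v,\chi)|/|\chi|_1$ for $v\in L^2(\Omega)$ with $m(v)=0$. For $\alpha\ge0$ let $\mathcal H_\alpha=\{v\in L^2(\Omega):|m(v)|\le\alpha\}$ and $\mathcal H^1_\alpha=\{v\in\dot H^1:|m(v)|\le\alpha\}$.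 Let $f:\mathbb R\to\mathbb R$ be differentiable, $F(v)=\int_0^vf$, let $2\le p<\infty$ with $p=2$ if $d=3$, and assume that there are constants $c_0>0$, $c>0$, $c_1,c_3\in\mathbb R$ and $c_2(\eta)\in\mathbb R$ ($\eta>0$) such that for all $v\in\mathbb R$ $$f(v)v\ge pc_0|v|^{2p}-c_1,\qquad |f(v)|\le\eta c_0|v|^{2p}+c_2(\eta)\quad\text{for every }\eta>0,$$ $$\tfrac12c_0|v|^{2p}-c_3\le F(v)\le\tfrac32c_0|v|^{2p}+c_3,\qquad F''(v)\ge-c.$$ A *time grid* $\mathcal J$ is a sequence $0=t^0<t^1<\cdots$ with $t^n\to\infty$; put $k_n=t^{n+1}-t^n$ and $k=\sup_nk_n$. A solution of the implicit Euler scheme for the Cahn–Hilliard equation on $\mathcal J$ is a sequence $u^n$ in $L^2(\Omega)$, $n\ge0$, with $$\frac{u^{n+1}-u^n}{k_n}+Aw^{n+1}=0,\qquad w^{n+1}=\varepsilon Au^{n+1}+f(u^{n+1}),\qquad u^{n+1},w^{n+1}\in\mathcal D(A),\ n\ge0.$$ For $B\subset L^2(\Omega)$ let $S^n_{\mathcal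 J}B$ be the set of all values $u^n$ after $n$ such steps starting from some $u^0\in B$ (for large steps a step need not be uniquely solvable; all solutions are taken into account). Let $\alpha\ge0$ and $$C_1(\alpha)=\bigl(c_1+c_2\alpha+2c_3\bigr)|\Omega|,\qquad c_2=c_2\bigl((p-\tfrac32)/\alpha\bigr)\quad(c_2\alpha:=0\text{ if }\alpha=0),$$ and assume $C_1(\alpha)>0$. **Theorem (time uniform bound in $\mathcal H^1_\alpha$).** There is $\gamma_1>0$ such that $|\bar v|_{-1}\le\gamma_1|v|_1$ for all $v\in\dot H^1$. For every such $\gamma_1$, and for $r>0$, put $$\hat\rho_0=\sqrt{2C_1(\alpha)}\Bigl(\frac{\gamma_1^2}{\varepsilon}+\frac{8\varepsilon}{c^2}\Bigr)^{1/2},\qquad \hat\rho_0'=2\hat\rho_0,\qquad \hat\rho_1=\hat\rho_1(r)=\Bigl(\frac{2}{\varepsilon}C_1(\alpha)+\frac{(\hat\rho_0')^2}{r\varepsilon}\Bigr)^{1/2}.$$ Then for every time grid $\mathcal J$ with $k\le 8\varepsilon/c^2$: 1. For all $R$ and all $r>0$ there is a positive integer $n_1$ such that every solution of the scheme on $\mathcal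 J$ with $|\overline{u^0}|_{-1}\le R$ and $|m(u^0)|\le\alpha$ satisfies $u^n\in\dot H^1$ and $|u^n|_1\le\hat\rho_1$ for all $n\ge n_1$. 2. For every $r>0$ the set $\{v\in\mathcal H^1_\alpha:|v|_1\le\hat\rho_1\}$ is absorbing: for every $B\subset\mathcal H_\alpha$ with $\sup_{u\in B}|\bar u|_{-1}<\infty$ it contains $S^n_{\mathcal J}B$ for all sufficiently large $n$. 3. The scheme on $\mathcal J$ has a unique global attractor $\mathcal A_{\mathcal J}\subset\mathcal H^1_\alpha$, that is, a non-empty set, compact in $H^1$, which attracts in the $H^1$ norm every $B$ as in 2 (for each $\delta>0$, $S^n_{\mathcal J}B$ lies in the $\delta$-neighbourhood of $\mathcal A_{\mathcal J}$ in $H^1$ for all large $n$), which is contained in every $H^1$-closed set with this attraction property, and which, if all $k_n$ are equal, is invariant: the set of all results of one step of the scheme from points of $\mathcal A_{\mathcal J}$ is $\mathcal A_{\mathcal J}$. Moreover, if $\mathcal A$ is the union of the attractors $\mathcal A_{\mathcal J}$ over all time grids with $k\le8\varepsilon/c^2$, then $\sup_{u\in\mathcal A}|u|_1\le\hat\rho_1(r)$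 for every $r>0$. -/

import Mathlib

open MeasureTheory Filter Topology
open scoped ENNReal ContDiff RealInnerProductSpace

noncomputable section

namespace CahnHilliard

/-- `ℝᵈ` with its Euclidean structure. -/
abbrev Space (d : ℕ) := EuclideanSpace ℝ (Fin d)

/-- The two types of boundary conditions: Neumann (no flux), and periodic with period `L` in every
coordinate direction. -/
inductive BoundaryCondition where
  | neumann
  | periodic (L : ℝ)

/-- The boundary of the open set `Ω` is of class `C²`: near each boundary point, `Ω` is the set
where a `C²` function with non-vanishing differential is negative. -/
def HasC2Boundary {d : ℕ} (Ω : Set (Space d)) : Prop :=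
  ∀ x ∈ frontier Ω, ∃ ρ : Space d → ℝ,
    ContDiffAt ℝ 2 ρ x ∧ fderiv ℝ ρ x ≠ 0 ∧ ∀ᶠ y in 𝓝 x, (y ∈ Ω ↔ ρ y < 0)

/-- For the Neumann condition: a bounded domain (non-empty, open, connected) with `C²` boundary.
For the periodic condition: the open cube `(0, L)ᵈ`. -/
def IsAdmissible {d : ℕ} (bc : BoundaryCondition) (Ω : Set (Space d)) : Prop :=
  match bc with
  | .neumann => IsOpen Ω ∧ IsConnected Ω ∧ Bornology.IsBounded Ω ∧ HasC2Boundary Ω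
  | .periodic L => 0 < L ∧ Ω = {x | ∀ i, x i ∈ Set.Ioo 0 L}

/-- A spatial domain together with the boundary condition imposed on it. -/
structure SpatialDomain (d : ℕ) where
  /-- the boundary condition -/
  bc : BoundaryCondition
  /-- the underlying set -/
  Ω : Set (Space d)
  admissible : IsAdmissible bc Ω

variable {d : ℕ}

theorem SpatialDomain.isBounded (D : SpatialDomain d) : Bornology.IsBounded D.Ω := by
  obtain ⟨bc, Ω, h⟩ := D
  cases bc with
  | neumann => exact h.2.2.1
  | periodic L =>
    obtain ⟨-, h⟩ := h
    simp only [h]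
    have hb : Bornology.IsBounded (Set.univ.pi fun _ : Fin d => Set.Ioo (0 : ℝ) L) :=
      Bornology.IsBounded.pi fun _ => Metric.isBounded_Ioo 0 L
    refine ((PiLp.antilipschitzWith_ofLp 2 (fun _ : Fin d => ℝ)).isBounded_preimage hb).subset ?_
    intro x hx i _
    exact hx i

/-- Lebesgue measure on `Ω`. -/
abbrev SpatialDomain.vol (D : SpatialDomain d) : Measure (Space d) := volume.restrict D.Ω

instance (D : SpatialDomain d) : IsFiniteMeasure D.vol :=
  ⟨by simpa using D.isBounded.measure_lt_top⟩

/-- The Hilbert space `H = L²(Ω)`. -/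
abbrev SpatialDomain.H (D : SpatialDomain d) := Lp ℝ 2 D.vol

/-- Test functions: `C_c^∞(Ω)` for the Neumann condition, and smooth functions on `ℝᵈ` that are
`L`-periodic in every coordinate direction for the periodic condition. -/
def SpatialDomain.IsTest (D : SpatialDomain d) (φ : Space d → ℝ) : Prop :=
  ContDiff ℝ ∞ φ ∧
    match D.bc with
    | .neumann => HasCompactSupport φ ∧ tsupport φ ⊆ D.Ω
    | .periodic L => ∀ (i : Fin d) (x : Space d), φ (x + EuclideanSpace.single i L) = φ x

theorem SpatialDomain.memLp_of_continuous (D : SpatialDomain d) {g : Space d → ℝ}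
    (hg : Continuous g) : MemLp g 2 D.vol := by
  obtain ⟨C, hC⟩ := (D.isBounded.isCompact_closure).exists_bound_of_continuousOn hg.continuousOn
  refine MemLp.of_bound hg.aestronglyMeasurable C ?_
  have h : ∀ᵐ x ∂volume.restrict (closure D.Ω), ‖g x‖ ≤ C :=
    ae_restrict_of_forall_mem isClosed_closure.measurableSet hC
  exact ae_restrict_of_ae_restrict_of_subset subset_closure h

/-- `g` is the weak gradient of `u`. With periodic test functions, this includes the periodicity
of `u` (in the sense of traces). -/
def SpatialDomain.IsWeakGrad (D : SpatialDomain d) (u : D.H) (g : Lp (Space d) 2 D.vol) : Prop :=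
  ∀ φ : Space d → ℝ, D.IsTest φ → ∀ e : Space d,
    ∫ x in D.Ω, u x * fderiv ℝ φ x e = -∫ x in D.Ω, ⟪g x, e⟫ * φ x

theorem SpatialDomain.IsTest.integrable_left {D : SpatialDomain d} {φ : Space d → ℝ}
    (hφ : D.IsTest φ) (u : D.H) (e : Space d) :
    Integrable (fun x => u x * fderiv ℝ φ x e) D.vol :=
  (Lp.memLp u).integrable_mul (D.memLp_of_continuous
    ((hφ.1.continuous_fderiv (by simp)).clm_apply continuous_const))

theorem SpatialDomain.IsTest.integrable_right {D : SpatialDomain d} {φ : Space d → ℝ}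
    (hφ : D.IsTest φ) (g : Lp (Space d) 2 D.vol) (e : Space d) :
    Integrable (fun x => ⟪g x, e⟫ * φ x) D.vol :=
  ((Lp.memLp g).inner_const e).integrable_mul (D.memLp_of_continuous hφ.1.continuous)

/-- The Sobolev space `H¹(Ω)` (Neumann) or `H¹_per(Ω)` (periodic), that is, the space `Ḣ¹`, the form
domain of `A = -Δ`. An element is a function in `L²(Ω)` stored together with its (unique) weak
gradient in `L²(Ω; ℝᵈ)`; the norm is `(‖u‖² + ‖∇u‖²)^{1/2}`. -/
def SpatialDomain.H1 (D : SpatialDomain d) :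
    Submodule ℝ (WithLp 2 (D.H × Lp (Space d) 2 D.vol)) where
  carrier := {x | D.IsWeakGrad x.fst x.snd}
  zero_mem' := by
    intro φ _ e
    have h1 : ∫ x in D.Ω, (0 : D.H) x * fderiv ℝ φ x e = 0 := by
      refine integral_eq_zero_of_ae ?_
      filter_upwards [Lp.coeFn_zero ℝ 2 D.vol] with x hx
      simp only [hx, Pi.zero_apply, zero_mul]
    have h2 : ∫ x in D.Ω, ⟪(0 : Lp (Space d) 2 D.vol) x, e⟫ * φ x = 0 := by
      refine integral_eq_zero_of_ae ?_
      filter_upwards [Lp.coeFn_zero (Space d) 2 D.vol] with x hx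
      simp only [hx, Pi.zero_apply, inner_zero_left, zero_mul]
    change ∫ x in D.Ω, (0 : D.H) x * fderiv ℝ φ x e =
      -∫ x in D.Ω, ⟪(0 : Lp (Space d) 2 D.vol) x, e⟫ * φ x
    rw [h1, h2, neg_zero]
  add_mem' := by
    intro a b ha hb φ hφ e
    have h1 : ∫ x in D.Ω, (a.fst + b.fst : D.H) x * fderiv ℝ φ x e =
        (∫ x in D.Ω, a.fst x * fderiv ℝ φ x e) + ∫ x in D.Ω, b.fst x * fderiv ℝ φ x e := by
      rw [← integral_add (hφ.integrable_left a.fst e) (hφ.integrable_left b.fst e)]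
      refine integral_congr_ae ?_
      filter_upwards [Lp.coeFn_add a.fst b.fst] with x hx
      simp only [hx, Pi.add_apply, add_mul]
    have h2 : ∫ x in D.Ω, ⟪(a.snd + b.snd : Lp (Space d) 2 D.vol) x, e⟫ * φ x =
        (∫ x in D.Ω, ⟪a.snd x, e⟫ * φ x) + ∫ x in D.Ω, ⟪b.snd x, e⟫ * φ x := by
      rw [← integral_add (hφ.integrable_right a.snd e) (hφ.integrable_right b.snd e)]
      refine integral_congr_ae ?_
      filter_upwards [Lp.coeFn_add a.snd b.snd] with x hx
      simp only [hx, Pi.add_apply, inner_add_left, add_mul]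
    have ha' := ha φ hφ e
    have hb' := hb φ hφ e
    change ∫ x in D.Ω, (a.fst + b.fst : D.H) x * fderiv ℝ φ x e =
      -∫ x in D.Ω, ⟪(a.snd + b.snd : Lp (Space d) 2 D.vol) x, e⟫ * φ x
    rw [h1, h2, ha', hb']
    ring
  smul_mem' := by
    intro c a ha φ hφ e
    have h1 : ∫ x in D.Ω, (c • a.fst : D.H) x * fderiv ℝ φ x e =
        c * ∫ x in D.Ω, a.fst x * fderiv ℝ φ x e := by
      rw [← integral_const_mul]
      refine integral_congr_ae ?_
      filter_upwards [Lp.coeFn_smul c a.fst] with x hx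
      simp only [hx, Pi.smul_apply, smul_eq_mul, mul_assoc]
    have h2 : ∫ x in D.Ω, ⟪(c • a.snd : Lp (Space d) 2 D.vol) x, e⟫ * φ x =
        c * ∫ x in D.Ω, ⟪a.snd x, e⟫ * φ x := by
      rw [← integral_const_mul]
      refine integral_congr_ae ?_
      filter_upwards [Lp.coeFn_smul c a.snd] with x hx
      simp only [hx, Pi.smul_apply, real_inner_smul_left, mul_assoc]
    have ha' := ha φ hφ e
    change ∫ x in D.Ω, (c • a.fst : D.H) x * fderiv ℝ φ x e =
      -∫ x in D.Ω, ⟪(c • a.snd : Lp (Space d) 2 D.vol) x, e⟫ * φ x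
    rw [h1, h2, ha']
    ring

variable {D : SpatialDomain d}

/-- The underlying `L²` function of an element of `H¹`. -/
def toL2 (u : D.H1) : D.H := (u : WithLp 2 (D.H × Lp (Space d) 2 D.vol)).fst

/-- The weak gradient of an element of `H¹`. -/
def grad (u : D.H1) : Lp (Space d) 2 D.vol :=
  (u : WithLp 2 (D.H × Lp (Space d) 2 D.vol)).snd

/-- The seminorm `|u|₁ = ‖A^{1/2} u‖ = ‖∇u‖`. -/
def semi1 (u : D.H1) : ℝ := ‖grad u‖

/-- The mean value `m(u) = |Ω|⁻¹ ∫_Ω u`. -/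
def mean (u : D.H) : ℝ := (volume.real D.Ω)⁻¹ * ∫ x in D.Ω, u x

/-- `ū = u - m(u)`. -/
def center (u : D.H) : D.H := u - Lp.const 2 D.vol (mean u)

/-- The dual norm `|v|₋₁ = sup_{χ ∈ H¹} |⟨v, χ⟩| / |χ|₁` (for `v` of mean value zero; the quotient
is read as `0` for constant `χ`). -/
def dualNorm (v : D.H) : ℝ≥0∞ := ⨆ χ : D.H1, ENNReal.ofReal (|⟪v, toL2 χ⟫| / semi1 χ)

/-- `γ` is an admissible constant in `|v̄|₋₁ ≤ γ |v|₁` for all `v ∈ H¹`. -/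
def IsDualPoincareConst (D : SpatialDomain d) (γ : ℝ) : Prop :=
  ∀ v : D.H1, dualNorm (center (toL2 v)) ≤ ENNReal.ofReal (γ * semi1 v)

/-- `v ∈ 𝒟(A)` and `A v = z`, where `A` is the self-adjoint realization in `L²(Ω)` of `-Δ` with the
boundary condition of `D`: `∫ ∇v · ∇φ = ∫ z φ` for all `φ ∈ H¹`. -/
def IsA (v : D.H1) (z : D.H) : Prop := ∀ φ : D.H1, ⟪grad v, grad φ⟫ = ⟪z, toL2 φ⟫

/-- One step of size `κ` of the implicit Euler scheme from `u` to `v`: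
`(v - u)/κ + A w = 0` and `w = ε A v + f(v)` with `v, w ∈ 𝒟(A)`. -/
def EulerStep (ε : ℝ) (f : ℝ → ℝ) (κ : ℝ) (u v : D.H) : Prop :=
  ∃ (V W : D.H1) (z : D.H), toL2 V = v ∧ IsA V z ∧
    (∀ᵐ x ∂D.vol, toL2 W x = ε * z x + f (v x)) ∧
    IsA W (-(κ⁻¹ • (v - u)))

/-- The assumptions on the nonlinearity `f` with primitive `F`, in space dimension `d`. -/
structure IsNonlinearity (d : ℕ) (f F : ℝ → ℝ) (p c₀ c₁ : ℝ) (c₂ : ℝ → ℝ) (c₃ c : ℝ) : Prop where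
  two_le_p : 2 ≤ p
  p_eq_two : d = 3 → p = 2
  c₀_pos : 0 < c₀
  c_pos : 0 < c
  /-- `f(v) v ≥ p c₀ v^{2p} - c₁` -/
  lower : ∀ v, p * c₀ * |v| ^ (2 * p) - c₁ ≤ f v * v
  /-- `|f(v)| ≤ η c₀ v^{2p} + c₂(η)` -/
  growth : ∀ η > 0, ∀ v, |f v| ≤ η * c₀ * |v| ^ (2 * p) + c₂ η
  /-- `F` is the primitive of `f` that vanishes at `0` -/
  F_zero : F 0 = 0
  hasDerivAt_F : ∀ v, HasDerivAt F (f v) v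
  F_lower : ∀ v, 1 / 2 * c₀ * |v| ^ (2 * p) - c₃ ≤ F v
  F_upper : ∀ v, F v ≤ 3 / 2 * c₀ * |v| ^ (2 * p) + c₃
  /-- `F'' = f' ≥ -c` -/
  differentiable_f : Differentiable ℝ f
  deriv_f : ∀ v, -c ≤ deriv f v

/-- A partition `0 = t⁰ < t¹ < ⋯` of `[0, ∞)`. -/
structure TimeGrid where
  /-- the nodes -/
  t : ℕ → ℝ
  zero : t 0 = 0
  strictMono : StrictMono t
  tendsto : Tendsto t atTop atTop

/-- The step sizes `kₙ = tⁿ⁺¹ - tⁿ`. -/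
def TimeGrid.step (J : TimeGrid) (n : ℕ) : ℝ := J.t (n + 1) - J.t n

/-- `(uⁿ)` is a solution of the scheme on the grid `J`. -/
def IsSolution (ε : ℝ) (f : ℝ → ℝ) (J : TimeGrid) (u : ℕ → D.H) : Prop :=
  ∀ n, EulerStep ε f (J.step n) (u n) (u (n + 1))

/-- The image of `B` under the first `n` steps of the scheme. (All solutions are taken into
account, as an Euler step need not be uniquely solvable for large step sizes.) -/
def evolve (ε : ℝ) (f : ℝ → ℝ) (J : TimeGrid) (n : ℕ) (B : Set D.H) : Set D.H :=
  {v | ∃ u : ℕ → D.H, u 0 ∈ B ∧ (∀ j < n, EulerStep ε f (J.step j) (u j) (u (j + 1))) ∧ u n = v}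

/-- `B` is a subset of `ℋ_α = {u ∈ L²(Ω) : |m(u)| ≤ α}` that is bounded for `|·|₋₁`. -/
def IsBddIn (α : ℝ) (B : Set D.H) : Prop :=
  (∀ u ∈ B, |mean u| ≤ α) ∧ ∃ R : ℝ, ∀ u ∈ B, dualNorm (center u) ≤ ENNReal.ofReal R

/-- The space `ℋ¹_α = {u ∈ H¹ : |m(u)| ≤ α}`. -/
def calH1 (D : SpatialDomain d) (α : ℝ) : Set D.H1 := {x | |mean (toL2 x)| ≤ α}

/-- The set `K ⊆ H¹` absorbs all bounded subsets of `ℋ_α`. -/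
def IsAbsorbing (ε : ℝ) (f : ℝ → ℝ) (α : ℝ) (J : TimeGrid) (K : Set D.H1) : Prop :=
  ∀ B : Set D.H, IsBddIn α B → ∃ N : ℕ, ∀ n ≥ N, evolve ε f J n B ⊆ toL2 '' K

/-- The set `K ⊆ H¹` attracts, in the norm of `H¹`, all bounded subsets of `ℋ_α`. -/
def IsAttracting (ε : ℝ) (f : ℝ → ℝ) (α : ℝ) (J : TimeGrid) (K : Set D.H1) : Prop :=
  ∀ B : Set D.H, IsBddIn α B → ∀ δ > 0, ∃ N : ℕ, ∀ n ≥ N,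
    evolve ε f J n B ⊆ toL2 '' Metric.thickening δ K

/-- `𝒜` is the global attractor in `ℋ¹_α` of the scheme on the grid `J`: the smallest closed set
that attracts all bounded sets; it has to be non-empty, compact in `H¹`, and, if the grid is uniform
(so that the scheme is an autonomous dynamical system), invariant. -/
structure IsGlobalAttractor (ε : ℝ) (f : ℝ → ℝ) (α : ℝ) (J : TimeGrid) (𝒜 : Set D.H1) : Prop where
  nonempty : 𝒜.Nonempty
  subset : 𝒜 ⊆ calH1 D α
  isCompact : IsCompact 𝒜
  isAttracting : IsAttracting ε f α J 𝒜
  minimal : ∀ K : Set D.H1, IsClosed K → IsAttracting ε f α J K → 𝒜 ⊆ K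
  invariant : ∀ κ : ℝ, (∀ n, J.step n = κ) →
    {y : D.H1 | ∃ x ∈ 𝒜, EulerStep ε f κ (toL2 x) (toL2 y)} = 𝒜

/-- `C₁(α) = (c₁ + c₂ α + 2 c₃) |Ω|` with `c₂ = c₂(η)`, `η = (p - 3/2)/α`. -/
def C1 (D : SpatialDomain d) (p c₁ : ℝ) (c₂ : ℝ → ℝ) (c₃ α : ℝ) : ℝ :=
  (c₁ + c₂ ((p - 3 / 2) / α) * α + 2 * c₃) * volume.real D.Ω

/-- `ρ̂₀ = (2 C₁(α))^{1/2} (γ₁²/ε + 8ε/c²)^{1/2}`, with `C` in the role of `C₁(α)`. -/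
def rho0 (C γ ε c : ℝ) : ℝ := √(2 * C) * √(γ ^ 2 / ε + 8 * ε / c ^ 2)

/-- `ρ̂₁ = (2 C₁(α)/ε + (ρ̂₀')²/(r ε))^{1/2}` with `ρ̂₀' = 2 ρ̂₀`, and `C` in the role of `C₁(α)`. -/
def rho1 (C γ ε c r : ℝ) : ℝ := √(2 / ε * C + (2 * rho0 C γ ε c) ^ 2 / (r * ε))

end CahnHilliard

end

/-! Two quantities are tracked along the scheme: the dual norm of the centred iterate, and the
energy `ε/2 |v|₁² + ∫ (F(v) + c₃)`, whose nonlinear part is non-negative. Testing a step of size `κ`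
with `A⁻¹ v̄` shows that the squared dual norm grows by at most `2κ` times the difference of `C₁(α)`
and the new energy (`IsPotential.dual_estimate`). Testing with the increment and using `F'' ≥ -c`
shows that the energy does not increase as long as `κ ≤ 8ε/c²` (`IsPotential.energy_le`); the
threshold is the discriminant condition of a quadratic form. Summed against time, the two facts
bound the energy at time `t` by `C₁(α) + R²/(2t)` (`IsLift.energy_le`). Only the elapsed time
enters, not the number or the size of the steps. Since `C₁(α) > 0`, the square of `ρ̂₁` exceeds `2
C₁(α)/ε` by a positive amount for every `r`, so the bound by `ρ̂₁` holds after a finite time.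

The attractor needs an absorbing set that is compact in `H¹`. A smoothing estimate weighted by
elapsed time bounds `|w|₁` for the chemical potential `w` (`IsLift.norm_grad_potential_sq_le`).
Functions with bounded `|v|₁`, `|w|₁` and mean form the set `regularSet`. There `f(v)` is bounded in
`L²`, because `A v` pairs non-negatively with monotone functions of `v`; Rellich's theorem and the
equation for `w` then turn weak limits into limits in `H¹` (`exists_subseq_potential`). The same
argument closes the graph of the step relation (`eulerStep_of_tendsto`), which replaces the
continuity of a semigroup, as steps may be multivalued. The attractor is the closure of the union of
all `ω`-limit sets. It is contained in every closed attracting set, in particular in the ball of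
radius `ρ̂₁`; this gives both uniqueness and the uniform bound.

Rellich's theorem, Poincaré's inequality and the chain rule in `H¹` all rest on one estimate: a
translation by `h` changes `u` by at most `|h| ‖∇u‖` in `L²`. Periodic conditions are brought into
this frame by periodic extension. -/

noncomputable section

namespace CahnHilliard

section

/-! ### Weak convergence in Hilbert spaces. -/

section Hilbert

variable {X : Type*} [NormedAddCommGroup X] [InnerProductSpace ℝ X]

/-- Bounded sequences in a separable Hilbert space have weakly convergent subsequences. -/
theorem exists_subseq_weakly_tendsto [CompleteSpace X] [SecondCountableTopology X] {x : ℕ → X}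
    {C : ℝ} (hx : ∀ n, ‖x n‖ ≤ C) :
    ∃ (a : X) (φ : ℕ → ℕ), StrictMono φ ∧
      ∀ y, Tendsto (fun n => ⟪x (φ n), y⟫) atTop (𝓝 ⟪a, y⟫) := by
  have hc := WeakDual.isSeqCompact_closedBall ℝ X (0 : StrongDual ℝ X) C
  obtain ⟨l, -, φ, hφ, hl⟩ := hc
    (x := fun n => StrongDual.toWeakDual (InnerProductSpace.toDual ℝ X (x n)))
    (fun n => by simpa using hx n)
  refine ⟨(InnerProductSpace.toDual ℝ X).symm (WeakDual.toStrongDual l), φ, hφ, fun y => ?_⟩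
  rw [InnerProductSpace.toDual_symm_apply]
  have h := ((WeakDual.eval_continuous (𝕜 := ℝ) y).tendsto l).comp hl
  exact h

/-- A bounded family that converges weakly against a dense set converges weakly. -/
theorem tendsto_inner_of_dense {ι : Type*} {l : Filter ι} {x : ι → X} {a : X} {C : ℝ}
    (hx : ∀ᶠ i in l, ‖x i‖ ≤ C) {S : Set X} (hS : Dense S)
    (h : ∀ y ∈ S, Tendsto (fun i => ⟪x i, y⟫) l (𝓝 ⟪a, y⟫)) (y : X) :
    Tendsto (fun i => ⟪x i, y⟫) l (𝓝 ⟪a, y⟫) := by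
  rw [Metric.tendsto_nhds]
  intro δ hδ
  have hpos : 0 < |C| + ‖a‖ + 1 := by positivity
  obtain ⟨z, hzS, hz⟩ := hS.exists_dist_lt y (ε := δ / 2 / (|C| + ‖a‖ + 1)) (by positivity)
  have h1 := (Metric.tendsto_nhds.1 (h z hzS)) (δ / 2) (by positivity)
  filter_upwards [h1, hx] with i hi hxi
  rw [Real.dist_eq] at hi ⊢
  have e1 : ⟪x i, y⟫ - ⟪a, y⟫ = (⟪x i, z⟫ - ⟪a, z⟫) + ⟪x i - a, y - z⟫ := by
    simp only [inner_sub_left, inner_sub_right]; ring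
  have e2 : |⟪x i - a, y - z⟫| ≤ (|C| + ‖a‖ + 1) * ‖y - z‖ := by
    refine (abs_real_inner_le_norm _ _).trans (mul_le_mul_of_nonneg_right ?_ (norm_nonneg _))
    have := norm_sub_le (x i) a
    have := le_abs_self C
    linarith
  rw [dist_eq_norm, lt_div_iff₀ hpos] at hz
  rw [e1]
  have := abs_add_le (⟪x i, z⟫ - ⟪a, z⟫) ⟪x i - a, y - z⟫
  nlinarith

/-- The norm of a vector is bounded if its inner products with a dense set are. -/
theorem norm_le_of_dense {S : Set X} (hS : Dense S) {x : X} {C : ℝ} (hC : 0 ≤ C)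
    (h : ∀ y ∈ S, |⟪x, y⟫| ≤ C * ‖y‖) : ‖x‖ ≤ C := by
  have hall : ∀ y, |⟪x, y⟫| ≤ C * ‖y‖ := by
    intro y
    have hcl : IsClosed {y : X | |⟪x, y⟫| ≤ C * ‖y‖} :=
      isClosed_le (by fun_prop) (by fun_prop)
    exact (hcl.closure_subset_iff.2 h) (hS y)
  have h1 := hall x
  rw [real_inner_self_eq_norm_sq, abs_of_nonneg (by positivity)] at h1
  by_contra hlt
  push Not at hlt
  nlinarith

end Hilbert

/-! ### `H¹` as a separable Hilbert space; topology of the domain. -/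

variable {d : ℕ} {D : SpatialDomain d}

/-- The inclusion `H¹ → L²`. -/
def toL2L (D : SpatialDomain d) : D.H1 →L[ℝ] D.H :=
  (WithLp.fstL 2 ℝ D.H (Lp (Space d) 2 D.vol)).comp D.H1.subtypeL

/-- The gradient as a map on `H¹`. -/
def gradL (D : SpatialDomain d) : D.H1 →L[ℝ] Lp (Space d) 2 D.vol :=
  (WithLp.sndL 2 ℝ D.H (Lp (Space d) 2 D.vol)).comp D.H1.subtypeL

@[simp] theorem toL2_sub (u v : D.H1) : toL2 (u - v) = toL2 u - toL2 v := rfl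
@[simp] theorem toL2_zero : toL2 (0 : D.H1) = 0 := rfl
@[simp] theorem toL2_smul (c : ℝ) (u : D.H1) : toL2 (c • u) = c • toL2 u := rfl
@[simp] theorem grad_sub (u v : D.H1) : grad (u - v) = grad u - grad v := rfl
@[simp] theorem grad_zero : grad (0 : D.H1) = 0 := rfl
@[simp] theorem grad_smul (c : ℝ) (u : D.H1) : grad (c • u) = c • grad u := rfl

theorem inner_H1 (u v : D.H1) : ⟪u, v⟫ = ⟪toL2 u, toL2 v⟫ + ⟪grad u, grad v⟫ := by
  change ⟪(u : WithLp 2 (D.H × Lp (Space d) 2 D.vol)), v⟫ = _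
  rw [WithLp.prod_inner_apply]
  rfl

theorem norm_sq_H1 (u : D.H1) : ‖u‖ ^ 2 = ‖toL2 u‖ ^ 2 + ‖grad u‖ ^ 2 := by
  rw [← real_inner_self_eq_norm_sq, inner_H1, real_inner_self_eq_norm_sq,
    real_inner_self_eq_norm_sq]

theorem norm_toL2_le (u : D.H1) : ‖toL2 u‖ ≤ ‖u‖ := by
  have := norm_sq_H1 u
  nlinarith [norm_nonneg (toL2 u), norm_nonneg u, sq_nonneg ‖grad u‖,
    abs_le_of_sq_le_sq' (a := ‖toL2 u‖) (b := ‖u‖) (by nlinarith [sq_nonneg ‖grad u‖])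
      (norm_nonneg u)]

theorem norm_grad_le (u : D.H1) : ‖grad u‖ ≤ ‖u‖ := by
  have := norm_sq_H1 u
  exact (abs_le_of_sq_le_sq' (a := ‖grad u‖) (b := ‖u‖) (by nlinarith [sq_nonneg ‖toL2 u‖])
      (norm_nonneg u)).2

theorem SpatialDomain.IsTest.memLp_smul {φ : Space d → ℝ} (hφ : D.IsTest φ) (e : Space d) :
    MemLp (fun x => φ x • e) 2 D.vol :=
  (ContinuousLinearMap.toSpanSingleton ℝ e).comp_memLp' (D.memLp_of_continuous hφ.1.continuous)

theorem SpatialDomain.IsTest.memLp_fderiv {φ : Space d → ℝ} (hφ : D.IsTest φ) (e : Space d) :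
    MemLp (fun x => fderiv ℝ φ x e) 2 D.vol :=
  D.memLp_of_continuous ((hφ.1.continuous_fderiv (by simp)).clm_apply continuous_const)

/-- The pair of `L²` functions against which membership in `H¹` is tested. -/
def testVec {φ : Space d → ℝ} (hφ : D.IsTest φ) (e : Space d) :
    WithLp 2 (D.H × Lp (Space d) 2 D.vol) :=
  WithLp.toLp 2 ((hφ.memLp_fderiv e).toLp _,
    (hφ.memLp_smul e).toLp _)

theorem inner_L2_eq {E : Type*} [NormedAddCommGroup E] [InnerProductSpace ℝ E]
    {μ : Measure (Space d)} (u : Lp E 2 μ)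
    {v : Space d → E} (hv : MemLp v 2 μ) : ⟪u, hv.toLp v⟫ = ∫ x, ⟪u x, v x⟫ ∂μ := by
  rw [L2.inner_def]
  refine integral_congr_ae ?_
  filter_upwards [hv.coeFn_toLp] with x hx
  rw [hx]

theorem inner_toLp {E : Type*} [NormedAddCommGroup E] [InnerProductSpace ℝ E]
    {μ : Measure (Space d)} {u v : Space d → E} (hu : MemLp u 2 μ) (hv : MemLp v 2 μ) :
    ⟪hu.toLp u, hv.toLp v⟫ = ∫ x, ⟪u x, v x⟫ ∂μ := by
  rw [inner_L2_eq]
  refine integral_congr_ae ?_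
  filter_upwards [hu.coeFn_toLp] with x hx
  rw [hx]

/-- Exhibits `H¹` as an orthogonal complement in `L² × L²`, from which closedness and completeness
follow. -/
theorem isWeakGrad_iff_inner (x : WithLp 2 (D.H × Lp (Space d) 2 D.vol)) :
    D.IsWeakGrad x.fst x.snd ↔
      ∀ φ : Space d → ℝ, ∀ hφ : D.IsTest φ, ∀ e : Space d, ⟪x, testVec hφ e⟫ = 0 := by
  refine forall_congr' fun φ => forall_congr' fun hφ => forall_congr' fun e => ?_
  have h : ⟪x, testVec hφ e⟫ = (∫ y in D.Ω, x.fst y * fderiv ℝ φ y e) +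
      ∫ y in D.Ω, ⟪x.snd y, e⟫ * φ y := by
    rw [WithLp.prod_inner_apply]
    congr 1
    · refine (inner_L2_eq _ (hφ.memLp_fderiv e)).trans (integral_congr_ae (ae_of_all _ fun y => ?_))
      simp [mul_comm]
    · refine (inner_L2_eq _ (hφ.memLp_smul e)).trans (integral_congr_ae (ae_of_all _ fun y => ?_))
      simp [real_inner_smul_right, mul_comm]
  rw [h]
  constructor <;> intro h <;> linarith

theorem isClosed_H1 : IsClosed (D.H1 : Set (WithLp 2 (D.H × Lp (Space d) 2 D.vol))) := by
  have : (D.H1 : Set (WithLp 2 (D.H × Lp (Space d) 2 D.vol))) =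
      ⋂ (φ : Space d → ℝ) (hφ : D.IsTest φ) (e : Space d), {x | ⟪x, testVec hφ e⟫ = 0} := by
    ext x
    simp only [Set.mem_iInter, Set.mem_ofPred_eq]
    exact isWeakGrad_iff_inner x
  rw [this]
  refine isClosed_iInter fun φ => isClosed_iInter fun hφ => isClosed_iInter fun e => ?_
  exact isClosed_eq (by fun_prop) continuous_const

instance : CompleteSpace D.H1 := isClosed_H1.completeSpace_coe

instance {E : Type*} [NormedAddCommGroup E] [TopologicalSpace.SeparableSpace E]
    (D : SpatialDomain d) : SecondCountableTopology (Lp E 2 D.vol) :=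
  have : Fact ((2 : ℝ≥0∞) ≠ ⊤) := ⟨by simp⟩
  Lp.SecondCountableTopology

instance : SecondCountableTopology (WithLp 2 (D.H × Lp (Space d) 2 D.vol)) :=
  (WithLp.homeomorphProd 2 D.H (Lp (Space d) 2 D.vol)).secondCountableTopology

theorem isOpen_domain (D : SpatialDomain d) : IsOpen D.Ω := by
  obtain ⟨bc, Ω, h⟩ := D
  cases bc with
  | neumann => exact h.1
  | periodic L =>
    obtain ⟨-, rfl⟩ := h
    simp only [Set.ofPred_forall]
    exact isOpen_iInter_of_finite fun i => isOpen_Ioo.preimage (by fun_prop)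

theorem isPreconnected_domain (D : SpatialDomain d) : IsPreconnected D.Ω := by
  obtain ⟨bc, Ω, h⟩ := D
  cases bc with
  | neumann => exact h.2.1.isPreconnected
  | periodic L =>
    obtain ⟨-, rfl⟩ := h
    refine Convex.isPreconnected ?_
    simp only [Set.ofPred_forall]
    refine convex_iInter fun i => ?_
    exact (convex_Ioo 0 L).linear_preimage (EuclideanSpace.proj i : Space d →L[ℝ] ℝ).toLinearMap

end

section

variable {d : ℕ}

/-! ### Square integrable functions -/

theorem norm_toLp_sq {E : Type*} [NormedAddCommGroup E] [InnerProductSpace ℝ E]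
    {μ : Measure (Space d)} {v : Space d → E} (hv : MemLp v 2 μ) :
    ‖hv.toLp v‖ ^ 2 = ∫ x, ‖v x‖ ^ 2 ∂μ := by
  rw [← real_inner_self_eq_norm_sq, inner_toLp]
  simp

theorem norm_toLp_eq_sqrt {E : Type*} [NormedAddCommGroup E] [InnerProductSpace ℝ E]
    {μ : Measure (Space d)} {v : Space d → E} (hv : MemLp v 2 μ) :
    ‖hv.toLp v‖ = √(∫ x, ‖v x‖ ^ 2 ∂μ) := by
  rw [← norm_toLp_sq, Real.sqrt_sq (norm_nonneg _)]

theorem norm_Lp_sq {E : Type*} [NormedAddCommGroup E] [InnerProductSpace ℝ E]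
    {μ : Measure (Space d)} (v : Lp E 2 μ) : ‖v‖ ^ 2 = ∫ x, ‖v x‖ ^ 2 ∂μ := by
  rw [← norm_toLp_sq (Lp.memLp v), Lp.toLp_coeFn]

/-- The Cauchy-Schwarz inequality for integrals. -/
theorem abs_integral_mul_le {μ : Measure (Space d)} {u v : Space d → ℝ} (hu : MemLp u 2 μ)
    (hv : MemLp v 2 μ) : |∫ x, u x * v x ∂μ| ≤ √(∫ x, u x ^ 2 ∂μ) * √(∫ x, v x ^ 2 ∂μ) := by
  have h := abs_real_inner_le_norm (hu.toLp u) (hv.toLp v)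
  rw [inner_toLp, norm_toLp_eq_sqrt, norm_toLp_eq_sqrt] at h
  simpa [mul_comm] using h

/-- Functions that are square integrable on compact sets. -/
def LocL2 {E : Type*} [NormedAddCommGroup E] (u : Space d → E) : Prop :=
  ∀ K, IsCompact K → MemLp u 2 (volume.restrict K)

section LocL2

variable {E : Type*} [NormedAddCommGroup E] {u : Space d → E}

theorem LocL2.memLp (hu : LocL2 u) {V : Set (Space d)} (hV : Bornology.IsBounded V) :
    MemLp u 2 (volume.restrict V) :=
  (hu _ hV.isCompact_closure).mono_measure (Measure.restrict_mono subset_closure le_rfl)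

theorem LocL2.locallyIntegrable (hu : LocL2 u) : LocallyIntegrable u volume := by
  refine locallyIntegrable_iff.2 fun K hK => ?_
  have : IsFiniteMeasure (volume.restrict K) := ⟨by simpa using hK.measure_lt_top⟩
  exact (hu K hK).integrable (by norm_num)

theorem locL2_of_memLp (hu : MemLp u 2 volume) : LocL2 u := fun K _ => hu.restrict K

theorem LocL2.comp_add_right (hu : LocL2 u) (h : Space d) : LocL2 (fun x => u (x + h)) := by
  intro K hK
  have hmp : MeasurePreserving (fun x : Space d => x + h) (volume.restrict K)
      (volume.restrict ((fun x : Space d => x + h) '' K)) :=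
    (measurePreserving_add_right volume h).restrict_image_emb
      (measurableEmbedding_addRight h) K
  exact (hu _ (hK.image (by fun_prop))).comp_measurePreserving hmp

end LocL2

/-! ### Local weak gradients -/

/-- `g` is the weak gradient of `u` in the set `U`. -/
def LocWeakGrad (U : Set (Space d)) (u : Space d → ℝ) (g : Space d → Space d) : Prop :=
  ∀ φ : Space d → ℝ, ContDiff ℝ ∞ φ → HasCompactSupport φ → tsupport φ ⊆ U → ∀ e : Space d,
    ∫ x, u x * fderiv ℝ φ x e = -∫ x, ⟪g x, e⟫ * φ x

theorem LocWeakGrad.mono {U V : Set (Space d)} {u : Space d → ℝ} {g : Space d → Space d}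
    (h : LocWeakGrad U u g) (hVU : V ⊆ U) : LocWeakGrad V u g :=
  fun φ h1 h2 h3 e => h φ h1 h2 (h3.trans hVU) e

/-- Differentiation of the correlation of a locally integrable function with a smooth function. -/
theorem hasDerivAt_correlation_of_contDiff {u : Space d → ℝ} (hu : LocallyIntegrable u volume)
    {φ : Space d → ℝ} (hφ : ContDiff ℝ ∞ φ) (hc : HasCompactSupport φ) (e : Space d) (s : ℝ) :
    HasDerivAt (fun s : ℝ => ∫ y, u y * φ (y - s • e))
      (-∫ y, u y * fderiv ℝ φ (y - s • e) e) s := by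
  -- With the reflected function the correlation becomes a convolution evaluated at `s • e`, so the
  -- derivative of a convolution applies.
  set ψ : Space d → ℝ := fun x => φ (-x) with hψ
  have hψ1 : ContDiff ℝ ∞ ψ := hφ.comp contDiff_neg
  have hψc : HasCompactSupport ψ := hc.comp_homeomorph (Homeomorph.neg (Space d))
  have h1 := hψc.hasFDerivAt_convolution_right (ContinuousLinearMap.mul ℝ ℝ) hu
    (hψ1.of_le (by simp)) (s • e) (μ := volume)
  have h2 : HasDerivAt (fun s : ℝ => s • e) e s := by
    simpa using (hasDerivAt_id s).smul_const e
  have h3 := h1.comp_hasDerivAt s h2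
  have e1 : (MeasureTheory.convolution u ψ (ContinuousLinearMap.mul ℝ ℝ) volume) ∘
      (fun s : ℝ => s • e) = fun s : ℝ => ∫ y, u y * φ (y - s • e) := by
    funext s
    simp [MeasureTheory.convolution, hψ]
  have e2 : (MeasureTheory.convolution u (fderiv ℝ ψ)
      ((ContinuousLinearMap.mul ℝ ℝ).precompR (Space d)) volume) (s • e) e =
      -∫ y, u y * fderiv ℝ φ (y - s • e) e := by
    rw [convolution_precompR_apply _ hu (hψc.fderiv ℝ)
      (hψ1.continuous_fderiv (by simp)), MeasureTheory.convolution, ← integral_neg]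
    refine integral_congr_ae (ae_of_all _ fun y => ?_)
    have : fderiv ℝ ψ (s • e - y) e = -fderiv ℝ φ (y - s • e) e := by
      have h4 : HasFDerivAt ψ _ (s • e - y) :=
        ((hφ.differentiable (by simp)).differentiableAt
          (x := -(s • e - y))).hasFDerivAt.comp _ (hasFDerivAt_id _).neg
      rw [h4.fderiv]
      simp
    simp [this]
  rw [e1, e2] at h3
  exact h3

theorem tsupport_comp_sub (φ : Space d → ℝ) (h : Space d) :
    tsupport (fun x => φ (x - h)) = (fun x => x - h) ⁻¹' tsupport φ :=
  tsupport_comp_eq_preimage φ (Homeomorph.subRight h)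

theorem hasCompactSupport_comp_sub {φ : Space d → ℝ} (hc : HasCompactSupport φ) (h : Space d) :
    HasCompactSupport (fun x => φ (x - h)) :=
  hc.comp_homeomorph (Homeomorph.subRight h)

/-- The derivative first falls on `φ` and is then moved to `u` by the weak gradient. The second move
needs the translated support to stay in `U`, which is the hypothesis `hs`. -/
theorem LocWeakGrad.hasDerivAt_correlation {U : Set (Space d)} {u : Space d → ℝ}
    {g : Space d → Space d} (h : LocWeakGrad U u g) (hu : LocallyIntegrable u volume)
    {φ : Space d → ℝ} (hφ : ContDiff ℝ ∞ φ) (hc : HasCompactSupport φ) (e : Space d) (s : ℝ)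
    (hs : ∀ x ∈ tsupport φ, x + s • e ∈ U) :
    HasDerivAt (fun s : ℝ => ∫ y, u y * φ (y - s • e)) (∫ y, ⟪g y, e⟫ * φ (y - s • e)) s := by
  have h1 := hasDerivAt_correlation_of_contDiff hu hφ hc e s
  have h2 := h (fun y => φ (y - s • e)) (hφ.comp (contDiff_id.sub contDiff_const))
    (hasCompactSupport_comp_sub hc _) (by
      rw [tsupport_comp_sub]
      intro x hx
      simpa using hs _ hx) e
  simp only [fderiv_comp_sub] at h2
  rw [h2, neg_neg] at h1
  exact h1

theorem integral_comp_add_mul {u φ : Space d → ℝ} (h : Space d) :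
    ∫ x, u (x + h) * φ x = ∫ x, u x * φ (x - h) := by
  rw [← integral_add_right_eq_self (fun x => u x * φ (x - h)) h]
  simp

theorem continuous_memLp {φ : Space d → ℝ} (hφ : Continuous φ) (hc : HasCompactSupport φ) :
    MemLp φ 2 volume := hφ.memLp_of_hasCompactSupport hc

/-- Smooth functions with compact support in `V` are dense in `L²(V)`. -/
theorem dense_smooth {V : Set (Space d)} (hV : IsOpen V) :
    Dense {f : Lp ℝ 2 (volume.restrict V) | ∃ ψ : Space d → ℝ, ContDiff ℝ ∞ ψ ∧
      HasCompactSupport ψ ∧ tsupport ψ ⊆ V ∧ f =ᵐ[volume.restrict V] ψ} := by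
  let S : Submodule ℝ (Lp ℝ 2 (volume.restrict V)) :=
    { carrier := {f : Lp ℝ 2 (volume.restrict V) | ∃ ψ : Space d → ℝ, ContDiff ℝ ∞ ψ ∧
        HasCompactSupport ψ ∧ tsupport ψ ⊆ V ∧ f =ᵐ[volume.restrict V] ψ}
      zero_mem' := ⟨0, contDiff_const, HasCompactSupport.zero, by simp [tsupport],
        Lp.coeFn_zero _ _ _⟩
      add_mem' := by
        rintro a b ⟨ψ, h1, h2, h3, h4⟩ ⟨χ, k1, k2, k3, k4⟩
        refine ⟨ψ + χ, h1.add k1, h2.add k2, (tsupport_add ψ χ).trans (Set.union_subset h3 k3), ?_⟩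
        exact (Lp.coeFn_add a b).trans (h4.add k4)
      smul_mem' := by
        rintro c a ⟨ψ, h1, h2, h3, h4⟩
        refine ⟨c • ψ, contDiff_const.smul h1, h2.smul_left (f := fun _ => c), ?_, ?_⟩
        · exact (tsupport_smul_subset_right (fun _ => c) ψ).trans h3
        · exact (Lp.coeFn_smul c a).trans (h4.const_smul c) }
  change Dense (S : Set (Lp ℝ 2 (volume.restrict V)))
  -- Density is equivalent to a trivial orthogonal complement, and that is the fundamental lemma of
  -- the calculus of variations.
  rw [Submodule.dense_iff_topologicalClosure_eq_top, Submodule.topologicalClosure_eq_top_iff,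
    Submodule.eq_bot_iff]
  intro f hf
  have hloc : LocallyIntegrableOn f V volume := by
    rw [locallyIntegrableOn_iff hV.isLocallyClosed]
    intro K hKV hK
    have : IsFiniteMeasure (volume.restrict K) := ⟨by simpa using hK.measure_lt_top⟩
    exact ((Lp.memLp f).mono_measure (Measure.restrict_mono hKV le_rfl)).integrable (by norm_num)
  have h0 := hV.ae_eq_zero_of_integral_contDiff_smul_eq_zero hloc (by
    intro ψ h1 h2 h3
    have hψ : MemLp ψ 2 (volume.restrict V) := (continuous_memLp h1.continuous h2).restrict V
    have hmem : hψ.toLp ψ ∈ S := ⟨ψ, h1, h2, h3, hψ.coeFn_toLp⟩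
    have h4 := (Submodule.mem_orthogonal' S f).1 hf _ hmem
    rw [inner_L2_eq] at h4
    rw [← h4, ← integral_indicator hV.measurableSet]
    refine integral_congr_ae (ae_of_all _ fun x => ?_)
    by_cases hx : x ∈ V
    · simp [hx]
    · have : ψ x = 0 := image_eq_zero_of_notMem_tsupport fun h => hx (h3 h)
      simp [hx, this])
  rw [Lp.eq_zero_iff_ae_eq_zero]
  exact (ae_restrict_iff' hV.measurableSet).2 h0

theorem setIntegral_mul_of_tsupport {V : Set (Space d)} (hV : MeasurableSet V) {φ : Space d → ℝ}
    (hφ : tsupport φ ⊆ V) (u : Space d → ℝ) : ∫ x in V, u x * φ x = ∫ x, u x * φ x := by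
  rw [← integral_indicator hV]
  refine integral_congr_ae (ae_of_all _ fun x => ?_)
  by_cases hx : x ∈ V
  · simp [hx]
  · have : φ x = 0 := image_eq_zero_of_notMem_tsupport fun h => hx (hφ h)
    simp [hx, this]

theorem integral_translate_sub_mul {u φ : Space d → ℝ} (hu : LocL2 u) (hφ : Continuous φ)
    (hc : HasCompactSupport φ) (h : Space d) :
    ∫ x, (u (x + h) - u x) * φ x = (∫ y, u y * φ (y - h)) - ∫ y, u y * φ y := by
  have h1 : Integrable (fun x => u (x + h) * φ x) := by
    simpa [mul_comm] using (hu.comp_add_right h).locallyIntegrable.integrable_smul_left_of_hasCompactSupport hφ hc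
  have h2 : Integrable (fun x => u x * φ x) := by
    simpa [mul_comm] using hu.locallyIntegrable.integrable_smul_left_of_hasCompactSupport hφ hc
  simp only [sub_mul]
  rw [integral_sub h1 h2, integral_comp_add_mul]

/-- Translations by `h` change a function with weak gradient `g` by at most `|h| ‖g‖` in `L²`. -/
theorem LocWeakGrad.integral_translate_sub_sq_le {U V : Set (Space d)} {u : Space d → ℝ}
    {g : Space d → Space d} (hw : LocWeakGrad U u g) (hu : LocL2 u) (hU : MeasurableSet U)
    (hg : MemLp g 2 (volume.restrict U)) (hV : IsOpen V) (hVb : Bornology.IsBounded V)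
    (h : Space d) (hh : ∀ x ∈ V, ∀ s ∈ Set.Icc (0 : ℝ) 1, x + s • h ∈ U) :
    √(∫ x in V, (u (x + h) - u x) ^ 2) ≤ ‖h‖ * √(∫ x in U, ‖g x‖ ^ 2) := by
  have hwm : MemLp (fun x => u (x + h) - u x) 2 (volume.restrict V) :=
    ((hu.comp_add_right h).memLp hVb).sub (hu.memLp hVb)
  -- The norm is computed by duality against test functions, so `u` never has to be mollified.
  have key : ‖hwm.toLp _‖ ≤ ‖h‖ * √(∫ x in U, ‖g x‖ ^ 2) := by
    refine norm_le_of_dense (dense_smooth hV) (by positivity) ?_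
    rintro f ⟨ψ, h1, h2, h3, h4⟩
    have hψ : MemLp ψ 2 (volume.restrict V) := (continuous_memLp h1.continuous h2).restrict V
    have hf : f = hψ.toLp ψ := by
      apply Lp.ext
      exact h4.trans hψ.coeFn_toLp.symm
    have hψn : ‖f‖ = √(∫ x, ψ x ^ 2) := by
      rw [hf, norm_toLp_eq_sqrt]
      have := setIntegral_mul_of_tsupport hV.measurableSet h3 ψ
      simp only [← pow_two] at this
      simp [this]
    rw [hψn]
    have e1 : ⟪hwm.toLp _, f⟫ = (∫ y, u y * ψ (y - (1 : ℝ) • h)) - ∫ y, u y * ψ (y - (0 : ℝ) • h) := by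
      rw [hf, inner_toLp]
      simp only [one_smul, zero_smul, sub_zero]
      rw [← integral_translate_sub_mul hu h1.continuous h2,
        ← setIntegral_mul_of_tsupport hV.measurableSet h3]
      simp [mul_comm]
    rw [e1, ← Real.norm_eq_abs]
    -- Mean value inequality in `s` along the segment from `0` to `h`; the derivative is estimated
    -- by Cauchy–Schwarz.
    refine norm_image_sub_le_of_norm_deriv_le_segment_01'
      (f := fun s : ℝ => ∫ y, u y * ψ (y - s • h)) (f' := fun s : ℝ => ∫ y, ⟪g y, h⟫ * ψ (y - s • h))
      (fun s hs => (hw.hasDerivAt_correlation hu.locallyIntegrable h1 h2 h s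
        (fun x hx => hh x (h3 hx) s hs)).hasDerivWithinAt) ?_
    intro s hs
    have hsub : tsupport (fun x => ψ (x - s • h)) ⊆ U := by
      rw [tsupport_comp_sub]
      intro x hx
      simpa using hh _ (h3 hx) s ⟨hs.1, hs.2.le⟩
    rw [← setIntegral_mul_of_tsupport hU hsub (fun y => ⟪g y, h⟫), Real.norm_eq_abs]
    have hψs : MemLp (fun x => ψ (x - s • h)) 2 volume :=
      continuous_memLp (h1.continuous.comp (by fun_prop)) (hasCompactSupport_comp_sub h2 _)
    refine (abs_integral_mul_le (hg.inner_const h) (hψs.restrict U)).trans ?_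
    refine mul_le_mul ?_ ?_ (Real.sqrt_nonneg _) (by positivity)
    · rw [← Real.sqrt_sq (norm_nonneg h), ← Real.sqrt_mul (sq_nonneg _), ← integral_const_mul]
      refine Real.sqrt_le_sqrt (integral_mono_of_nonneg (ae_of_all _ fun x => sq_nonneg _)
        ((hg.integrable_norm_pow (by simp)).const_mul _) (ae_of_all _ fun x => ?_))
      have := abs_real_inner_le_norm (g x) h
      simp only
      rw [← sq_abs, ← mul_pow, mul_comm ‖h‖]
      gcongr
    · refine Real.sqrt_le_sqrt ?_
      rw [← integral_sub_right_eq_self (fun x => ψ x ^ 2) (s • h)]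
      exact setIntegral_le_integral hψs.integrable_sq (ae_of_all _ fun x => sq_nonneg _)
  rw [norm_toLp_eq_sqrt] at key
  simpa using key

end

/-! ### Difference quotients and the chain rule. -/

section

variable {d : ℕ}

/-- Difference quotients converge weakly to the directional derivative. -/
theorem LocWeakGrad.tendsto_diffQuot {U V : Set (Space d)} {u : Space d → ℝ}
    {g : Space d → Space d} (hw : LocWeakGrad U u g) (hu : LocL2 u) (hU : MeasurableSet U)
    (hVU : V ⊆ U) (hg : MemLp g 2 (volume.restrict U)) (hV : IsOpen V)
    (hVb : Bornology.IsBounded V) (e : Space d)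
    (he : ∀ᶠ t in 𝓝[≠] (0 : ℝ), ∀ x ∈ V, ∀ s ∈ Set.Icc (0 : ℝ) 1, x + s • t • e ∈ U)
    {ψ : Space d → ℝ} (hψ : MemLp ψ 2 (volume.restrict V)) :
    Tendsto (fun t : ℝ => ∫ x in V, (u (x + t • e) - u x) / t * ψ x) (𝓝[≠] 0)
      (𝓝 (∫ x in V, ⟪g x, e⟫ * ψ x)) := by
  have hm : ∀ t : ℝ, MemLp (fun x => (u (x + t • e) - u x) / t) 2 (volume.restrict V) := by
    intro t
    simp only [div_eq_inv_mul]
    exact (((hu.comp_add_right _).memLp hVb).sub (hu.memLp hVb)).const_mul _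
  have hgV : MemLp (fun x => ⟪g x, e⟫) 2 (volume.restrict V) :=
    (hg.mono_measure (Measure.restrict_mono hVU le_rfl)).inner_const e
  -- The translation estimate bounds the quotients, so convergence against smooth functions extends
  -- to every `ψ` in `L²`. The chain rule needs this, because its multiplier `G'(u) φ` is not
  -- smooth.
  have key := tendsto_inner_of_dense (l := 𝓝[≠] (0 : ℝ)) (x := fun t => (hm t).toLp _)
    (a := hgV.toLp _) (C := ‖e‖ * √(∫ x in U, ‖g x‖ ^ 2)) (S := _) ?_ (dense_smooth hV) ?_
    (hψ.toLp ψ)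
  · simp only [inner_toLp] at key
    simpa [mul_comm] using key
  · filter_upwards [he, self_mem_nhdsWithin] with t ht ht0
    have ht0' : 0 < |t| := abs_pos.2 ht0
    have h1 := hw.integral_translate_sub_sq_le hu hU hg hV hVb (t • e) ht
    rw [norm_toLp_eq_sqrt]
    have : ∫ x in V, ‖(u (x + t • e) - u x) / t‖ ^ 2 =
        (|t|⁻¹) ^ 2 * ∫ x in V, (u (x + t • e) - u x) ^ 2 := by
      rw [← integral_const_mul]
      refine integral_congr_ae (ae_of_all _ fun x => ?_)
      simp [div_eq_inv_mul, mul_pow]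
    rw [this, Real.sqrt_mul (by positivity), Real.sqrt_sq (by positivity), inv_mul_le_iff₀ ht0']
    refine h1.trans (le_of_eq ?_)
    rw [norm_smul, Real.norm_eq_abs]; ring
  · rintro f ⟨χ, h1, h2, h3, h4⟩
    have hχ : MemLp χ 2 (volume.restrict V) := (continuous_memLp h1.continuous h2).restrict V
    have hf : f = hχ.toLp χ := by
      apply Lp.ext
      exact h4.trans hχ.coeFn_toLp.symm
    have h5 := hw.hasDerivAt_correlation hu.locallyIntegrable h1 h2 e 0
      (by simpa using fun x hx => hVU (h3 hx))
    have h6 := h5.tendsto_slope_zero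
    rw [hf]
    simp only [inner_toLp]
    convert h6 using 2 with t
    · simp only [zero_add, zero_smul, sub_zero, smul_eq_mul]
      rw [← integral_translate_sub_mul hu h1.continuous h2, ← integral_const_mul]
      simp only [← mul_assoc]
      rw [← setIntegral_mul_of_tsupport hV.measurableSet h3]
      refine integral_congr_ae (ae_of_all _ fun x => ?_)
      simp [div_eq_inv_mul, mul_comm]
    · simp only [zero_smul, sub_zero]
      rw [← setIntegral_mul_of_tsupport hV.measurableSet h3 (fun x => ⟪g x, e⟫)]
      simp [mul_comm]

/-- The chain rule for weak gradients. -/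
theorem LocWeakGrad.comp {U : Set (Space d)} (hU : IsOpen U) {u : Space d → ℝ}
    {g : Space d → Space d} (hw : LocWeakGrad U u g) (hu : LocL2 u) (hg : LocL2 g)
    {G G' : ℝ → ℝ} (hG : Continuous G) (hG' : Continuous G') {M : ℝ} (hGM : ∀ a, |G a| ≤ M)
    (hGM' : ∀ a, |G' a| ≤ M) (hT : ∀ a b, |G b - G a - G' a * (b - a)| ≤ M * (b - a) ^ 2) :
    LocWeakGrad U (fun x => G (u x)) (fun x => G' (u x) • g x) := by
  intro φ hφ hc hφU e
  have hM0 : 0 ≤ M := (abs_nonneg _).trans (hGM 0)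
  -- Room for translations: the support of `φ` lies in `V`, and small translates of `V` stay in a
  -- bounded neighbourhood `W` inside `U`.
  obtain ⟨V, hV, hKV, hVU, hVc⟩ := exists_open_between_and_isCompact_closure hc hU hφU
  obtain ⟨δ, hδ, hδU⟩ := hVc.exists_thickening_subset_open hU hVU
  set W := Metric.thickening δ (closure V) with hW
  have hWo : IsOpen W := Metric.isOpen_thickening
  have hVb : Bornology.IsBounded V := hVc.isBounded.subset subset_closure
  have hWb : Bornology.IsBounded W := hVc.isBounded.thickening
  have hVW : V ⊆ W := subset_closure.trans (Metric.self_subset_thickening hδ _)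
  have he : ∀ᶠ t in 𝓝[≠] (0 : ℝ), ∀ x ∈ V, ∀ s ∈ Set.Icc (0 : ℝ) 1, x + s • t • e ∈ W := by
    have h1 : Tendsto (fun t : ℝ => ‖t • e‖) (𝓝[≠] 0) (𝓝 0) := by
      have : Tendsto (fun t : ℝ => ‖t • e‖) (𝓝 0) (𝓝 ‖(0 : ℝ) • e‖) :=
        (by fun_prop : Continuous fun t : ℝ => ‖t • e‖).tendsto 0
      rw [zero_smul, norm_zero] at this
      exact this.mono_left nhdsWithin_le_nhds
    filter_upwards [h1.eventually_lt_const hδ] with t ht x hx s hs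
    refine Metric.mem_thickening_iff.2 ⟨x, subset_closure hx, ?_⟩
    rw [dist_eq_norm, add_sub_cancel_left, norm_smul, Real.norm_eq_abs, abs_of_nonneg hs.1]
    nlinarith [norm_nonneg (t • e), hs.2]
  have hwW := hw.mono hδU
  have hgW := hg.memLp hWb
  obtain ⟨B, hB⟩ := hc.exists_bound_of_continuous hφ.continuous
  have hB0 : 0 ≤ B := (norm_nonneg _).trans (hB 0)
  have hVfin : IsFiniteMeasure (volume.restrict V) := ⟨by simpa using hVb.measure_lt_top⟩
  have huV := hu.memLp hVb
  have hψ : MemLp (fun x => G' (u x) * φ x) 2 (volume.restrict V) := by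
    refine MemLp.of_bound (hG'.comp_aestronglyMeasurable huV.1 |>.mul
      hφ.continuous.aestronglyMeasurable) (M * B) (ae_of_all _ fun x => ?_)
    rw [norm_mul]
    exact mul_le_mul (hGM' _) (hB x) (norm_nonneg _) hM0
  have hlim1 := hwW.tendsto_diffQuot hu hWo.measurableSet hVW hgW hV hVb e he hψ
  have hGu : LocL2 (fun x => G (u x)) := by
    intro K hK
    have : IsFiniteMeasure (volume.restrict K) := ⟨by simpa using hK.measure_lt_top⟩
    exact MemLp.of_bound (hG.comp_aestronglyMeasurable (hu K hK).1) M (ae_of_all _ fun x => hGM _)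
  have hlim2 := (hasDerivAt_correlation_of_contDiff hGu.locallyIntegrable hφ hc e 0).tendsto_slope_zero
  simp only [zero_add, zero_smul, sub_zero, smul_eq_mul] at hlim2
  -- The error of linearizing `G` is quadratic in `u(x + t e) - u(x)`, whose squared `L²` norm is
  -- `O(t²)`. After division by `t` it is `O(|t|)`.
  have hdiff : Tendsto (fun t : ℝ => t⁻¹ * ((∫ y, G (u y) * φ (y - t • e)) - ∫ y, G (u y) * φ y) -
      ∫ x in V, (u (x + t • e) - u x) / t * (G' (u x) * φ x)) (𝓝[≠] 0) (𝓝 0) := by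
    have hC : Tendsto (fun t : ℝ => |t| * (M * B * (‖e‖ * √(∫ x in W, ‖g x‖ ^ 2)) ^ 2)) (𝓝[≠] 0)
        (𝓝 0) := by
      have : Tendsto (fun t : ℝ => |t| * (M * B * (‖e‖ * √(∫ x in W, ‖g x‖ ^ 2)) ^ 2)) (𝓝 0)
        (𝓝 (|0| * (M * B * (‖e‖ * √(∫ x in W, ‖g x‖ ^ 2)) ^ 2))) :=
        (by fun_prop : Continuous fun t : ℝ =>
          |t| * (M * B * (‖e‖ * √(∫ x in W, ‖g x‖ ^ 2)) ^ 2)).tendsto 0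
      rw [abs_zero, zero_mul] at this
      exact this.mono_left nhdsWithin_le_nhds
    refine squeeze_zero_norm' ?_ hC
    filter_upwards [he, self_mem_nhdsWithin] with t ht ht0
    have ht0' : 0 < |t| := abs_pos.2 ht0
    have h1 := hwW.integral_translate_sub_sq_le hu hWo.measurableSet hgW hV hVb (t • e) ht
    have hdm : MemLp (fun x => u (x + t • e) - u x) 2 (volume.restrict V) :=
      ((hu.comp_add_right _).memLp hVb).sub huV
    rw [← integral_translate_sub_mul hGu hφ.continuous hc, ← integral_const_mul]
    have e1 : ∫ x, t⁻¹ * ((G (u (x + t • e)) - G (u x)) * φ x) =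
        ∫ x in V, t⁻¹ * ((G (u (x + t • e)) - G (u x)) * φ x) := by
      simp only [← mul_assoc]
      rw [setIntegral_mul_of_tsupport hV.measurableSet hKV]
    have hφV : MemLp φ 2 (volume.restrict V) := (continuous_memLp hφ.continuous hc).restrict V
    rw [e1, ← integral_sub]
    rotate_left
    · exact (MemLp.integrable_mul (((hGu.comp_add_right _).memLp hVb).sub (hGu.memLp hVb))
        hφV).const_mul _
    · refine MemLp.integrable_mul (p := 2) (q := 2) ?_ hψ
      simp only [div_eq_inv_mul]
      exact hdm.const_mul _
    have h2 : ∀ x, ‖t⁻¹ * ((G (u (x + t • e)) - G (u x)) * φ x) -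
        (u (x + t • e) - u x) / t * (G' (u x) * φ x)‖ ≤
        |t|⁻¹ * (M * B) * (u (x + t • e) - u x) ^ 2 := by
      intro x
      have : t⁻¹ * ((G (u (x + t • e)) - G (u x)) * φ x) -
        (u (x + t • e) - u x) / t * (G' (u x) * φ x) =
        t⁻¹ * (G (u (x + t • e)) - G (u x) - G' (u x) * (u (x + t • e) - u x)) * φ x := by ring
      rw [this, norm_mul, norm_mul, norm_inv, Real.norm_eq_abs, Real.norm_eq_abs]
      calc |t|⁻¹ * |G (u (x + t • e)) - G (u x) - G' (u x) * (u (x + t • e) - u x)| * ‖φ x‖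
          ≤ |t|⁻¹ * (M * (u (x + t • e) - u x) ^ 2) * B := by
            gcongr
            · exact hT _ _
            · exact hB x
        _ = _ := by ring
    refine (norm_integral_le_of_norm_le (hdm.integrable_sq.const_mul _)
      (ae_of_all _ h2)).trans ?_
    rw [integral_const_mul]
    have h3 : ∫ x in V, (u (x + t • e) - u x) ^ 2 ≤ (‖t • e‖ * √(∫ x in W, ‖g x‖ ^ 2)) ^ 2 := by
      rw [← Real.sqrt_le_left (by positivity)]
      exact h1
    calc |t|⁻¹ * (M * B) * ∫ x in V, (u (x + t • e) - u x) ^ 2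
        ≤ |t|⁻¹ * (M * B) * (‖t • e‖ * √(∫ x in W, ‖g x‖ ^ 2)) ^ 2 := by gcongr
      _ = _ := by
        rw [norm_smul, Real.norm_eq_abs]
        field_simp
  have hlim3 := hdiff.add hlim1
  simp only [sub_add_cancel, zero_add] at hlim3
  have huniq := tendsto_nhds_unique hlim2 hlim3
  rw [← neg_eq_iff_eq_neg, huniq, ← setIntegral_mul_of_tsupport hV.measurableSet hKV]
  refine integral_congr_ae (ae_of_all _ fun x => ?_)
  simp [real_inner_smul_left]
  ring

end

section

variable {d : ℕ}

/-! ### Periodic functions -/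

section Periodic

variable {L : ℝ} (hL : 0 < L)

/-- The basis `L e₁, …, L e_d`. -/
def cubeBasis : Module.Basis (Fin d) ℝ (Space d) :=
  (EuclideanSpace.basisFun (Fin d) ℝ).toBasis.isUnitSMul (w := fun _ => L)
    (fun _ => hL.ne'.isUnit)

theorem cubeBasis_apply (i : Fin d) : cubeBasis hL i = EuclideanSpace.single i L := by
  ext j
  simp [cubeBasis, Module.Basis.isUnitSMul_apply]

theorem cubeBasis_repr (x : Space d) (i : Fin d) : (cubeBasis hL).repr x i = x i / L := by
  have h := (cubeBasis hL).sum_repr x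
  have h2 := congrArg (fun y : Space d => y i) h
  simp only [cubeBasis_apply, WithLp.ofLp_sum, WithLp.ofLp_smul, Finset.sum_apply, Pi.smul_apply,
    PiLp.single_apply, smul_eq_mul, mul_ite, mul_zero, Finset.sum_ite_eq,
    Finset.mem_univ, if_true] at h2
  rw [← h2]
  field_simp

/-- The lattice of periods. -/
abbrev periodLattice : Submodule ℤ (Space d) :=
  Submodule.span ℤ (Set.range (cubeBasis (d := d) hL))

/-- The half-open period cube. -/
abbrev periodCube : Set (Space d) := ZSpan.fundamentalDomain (cubeBasis hL)

theorem periodic_lattice {E : Type*} {v : Space d → E}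
    (hv : ∀ (i : Fin d) (x : Space d), v (x + EuclideanSpace.single i L) = v x)
    (k : periodLattice (d := d) hL) (x : Space d) : v (x + k) = v x := by
  obtain ⟨k, hk⟩ := k
  simp only
  induction hk using Submodule.span_induction generalizing x with
  | mem k hk =>
    obtain ⟨i, rfl⟩ := hk
    rw [cubeBasis_apply, hv]
  | zero => simp
  | add a b _ _ ha hb => rw [← add_assoc, hb, ha]
  | smul n a _ ha =>
    induction n with
    | zero => simp
    | succ n ih => rw [add_smul, one_smul, ← add_assoc, ha, ih]
    | pred n ih =>
      rw [← ih, ← ha (x + ((-(n : ℤ) - 1) • a))]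
      congr 1
      rw [add_assoc, sub_smul, one_smul, sub_add_cancel]

theorem single_mem_lattice (i : Fin d) : EuclideanSpace.single i L ∈ periodLattice (d := d) hL := by
  rw [← cubeBasis_apply hL]
  exact Submodule.subset_span ⟨i, rfl⟩

theorem isBounded_periodCube : Bornology.IsBounded (periodCube (d := d) hL) :=
  ZSpan.fundamentalDomain_isBounded _

theorem measurableSet_periodCube : MeasurableSet (periodCube (d := d) hL) :=
  ZSpan.fundamentalDomain_measurableSet _

theorem mem_periodCube {x : Space d} : x ∈ periodCube hL ↔ ∀ i, x i ∈ Set.Ico 0 L := by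
  simp only [periodCube, ZSpan.mem_fundamentalDomain, cubeBasis_repr, Set.mem_Ico]
  refine forall_congr' fun i => ?_
  rw [div_lt_one hL, div_nonneg_iff]
  constructor
  · rintro ⟨h, h'⟩
    exact ⟨by rcases h with h | h <;> linarith, h'⟩
  · rintro ⟨h, h'⟩
    exact ⟨Or.inl ⟨h, hL.le⟩, h'⟩

/-- The domain is the open cube, while the fundamental domain of the lattice is half-open. They
differ only inside coordinate hyperplanes, which are null sets. -/
theorem openCube_ae_eq :
    ({x | ∀ i, x i ∈ Set.Ioo 0 L} : Set (Space d)) =ᵐ[volume] periodCube hL := by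
  refine (LE.le.eventuallyLE fun x hx => ?_).antisymm ?_
  · exact (mem_periodCube hL).2 fun i => ⟨(hx i).1.le, (hx i).2⟩
  · have h0 : ∀ i : Fin d, volume {x : Space d | x i = 0} = 0 := by
      intro i
      have := Measure.addHaar_submodule (volume : Measure (Space d))
        (LinearMap.ker (EuclideanSpace.proj i : Space d →L[ℝ] ℝ).toLinearMap) (by
          rw [Ne, LinearMap.ker_eq_top]
          intro h
          have := LinearMap.congr_fun h (EuclideanSpace.single i 1)
          simp at this)
      exact this
    have h1 : ∀ᵐ x : Space d, ∀ i, x i ≠ 0 := by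
      rw [ae_all_iff]
      exact fun i => by simpa [ae_iff] using h0 i
    filter_upwards [h1] with x hx hxc i
    have := (mem_periodCube hL).1 hxc i
    exact ⟨lt_of_le_of_ne this.1 (hx i).symm, this.2⟩

theorem restrict_openCube :
    (volume : Measure (Space d)).restrict {x | ∀ i, x i ∈ Set.Ioo 0 L} =
      volume.restrict (periodCube hL) :=
  Measure.restrict_congr_set (openCube_ae_eq hL)

open scoped Pointwise in
/-- Only finitely many translates of a compactly supported function meet a bounded set. -/
theorem exists_finset_translates {φ : Space d → ℝ} (hc : HasCompactSupport φ) {B : Set (Space d)}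
    (hB : Bornology.IsBounded B) :
    ∃ s : Finset (periodLattice (d := d) hL), ∀ x ∈ B, ∀ k ∉ s, x + (k : Space d) ∉ tsupport φ := by
  have hb : Bornology.IsBounded (tsupport φ - B) := hc.isBounded.sub hB
  have hf := ZSpan.setFinite_inter (cubeBasis hL) hb
  have hf' : Set.Finite {k : periodLattice (d := d) hL | (k : Space d) ∈ tsupport φ - B} := by
    refine Set.Finite.of_finite_image (f := Subtype.val) (hf.subset ?_)
      Subtype.val_injective.injOn
    rintro _ ⟨k, hk, rfl⟩
    exact ⟨hk, k.2⟩
  refine ⟨hf'.toFinset, fun x hx k hk hxk => hk ?_⟩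
  rw [Set.Finite.mem_toFinset]
  exact ⟨_, hxk, x, hx, by simp⟩

/-- The periodization of a function. -/
def periodize (φ : Space d → ℝ) (x : Space d) : ℝ :=
  ∑ᶠ k : periodLattice (d := d) hL, φ (x + k)

theorem periodize_eq_sum {φ : Space d → ℝ} {B : Set (Space d)}
    {s : Finset (periodLattice (d := d) hL)}
    (hs : ∀ x ∈ B, ∀ k ∉ s, x + (k : Space d) ∉ tsupport φ) {x : Space d} (hx : x ∈ B) :
    periodize hL φ x = ∑ k ∈ s, φ (x + k) := by
  refine finsum_eq_sum_of_support_subset _ fun k hk => ?_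
  by_contra h
  exact hk (image_eq_zero_of_notMem_tsupport (hs x hx k h))

theorem periodize_add (φ : Space d → ℝ) (x : Space d) (l : periodLattice (d := d) hL) :
    periodize hL φ (x + l) = periodize hL φ x := by
  unfold periodize
  rw [← finsum_comp_equiv (Equiv.addLeft l) (f := fun k : periodLattice (d := d) hL => φ (x + k))]
  simp [add_assoc]

theorem contDiff_periodize {φ : Space d → ℝ} (hφ : ContDiff ℝ ∞ φ) (hc : HasCompactSupport φ) :
    ContDiff ℝ ∞ (periodize hL φ) := by
  rw [contDiff_iff_contDiffAt]
  intro x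
  obtain ⟨s, hs⟩ := exists_finset_translates hL hc (Metric.isBounded_ball (x := x) (r := 1))
  have h1 : periodize hL φ =ᶠ[𝓝 x] fun y => ∑ k ∈ s, φ (y + k) := by
    filter_upwards [Metric.ball_mem_nhds x one_pos] with y hy
    exact periodize_eq_sum hL hs hy
  refine ContDiffAt.congr_of_eventuallyEq ?_ h1
  exact (ContDiff.sum fun k _ => hφ.comp (contDiff_id.add contDiff_const)).contDiffAt

theorem fderiv_periodize {φ : Space d → ℝ} (hφ : ContDiff ℝ ∞ φ) (hc : HasCompactSupport φ)
    (e x : Space d) :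
    fderiv ℝ (periodize hL φ) x e = periodize hL (fun y => fderiv ℝ φ y e) x := by
  obtain ⟨s, hs⟩ := exists_finset_translates hL hc (Metric.isBounded_ball (x := x) (r := 1))
  have h1 : periodize hL φ =ᶠ[𝓝 x] fun y => ∑ k ∈ s, φ (y + k) := by
    filter_upwards [Metric.ball_mem_nhds x one_pos] with y hy
    exact periodize_eq_sum hL hs hy
  have hs' : ∀ y ∈ Metric.ball x 1, ∀ k ∉ s,
      y + (k : Space d) ∉ tsupport (fun y => fderiv ℝ φ y e) :=
    fun y hy k hk h => hs y hy k hk (tsupport_fderiv_apply_subset ℝ e h)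
  rw [h1.fderiv_eq, periodize_eq_sum hL hs' (Metric.mem_ball_self one_pos), fderiv_fun_sum]
  · simp [fderiv_comp_add_right]
  · intro k _
    exact ((hφ.comp (contDiff_id.add contDiff_const)).differentiable (by simp)).differentiableAt

/-- Unfolding of integrals against a periodization. -/
theorem integral_mul_eq_periodize {v : Space d → ℝ} (hv : LocallyIntegrable v volume)
    (hvp : ∀ (k : periodLattice (d := d) hL) (x : Space d), v (x + k) = v x)
    {φ : Space d → ℝ} (hφ : Continuous φ) (hc : HasCompactSupport φ) :
    ∫ x, v x * φ x = ∫ x in periodCube hL, v x * periodize hL φ x := by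
  obtain ⟨s, hs⟩ := exists_finset_translates hL hc (isBounded_periodCube (d := d) hL)
  have hint : Integrable (fun x => v x * φ x) := by
    simpa [mul_comm] using hv.integrable_smul_left_of_hasCompactSupport hφ hc
  have : VAddInvariantMeasure (periodLattice (d := d) hL) (Space d) volume :=
    inferInstanceAs (VAddInvariantMeasure (periodLattice (d := d) hL).toAddSubgroup (Space d) volume)
  rw [(ZSpan.isAddFundamentalDomain (cubeBasis (d := d) hL) volume).integral_eq_tsum'' _ hint]
  have h1 : ∀ k : periodLattice (d := d) hL, ∀ x, v (k +ᵥ x) * φ (k +ᵥ x) =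
      v x * φ (x + k) := by
    intro k x
    have : (k +ᵥ x : Space d) = x + k := by rw [add_comm]; rfl
    rw [this, hvp]
  simp only [h1]
  rw [tsum_eq_sum (s := s), ← integral_finsetSum]
  · refine setIntegral_congr_fun (measurableSet_periodCube hL) fun x hx => ?_
    rw [periodize_eq_sum hL hs hx, Finset.mul_sum]
  · intro k _
    have h2 : Integrable (fun x => v (x + k) * φ (x + k)) := hint.comp_add_right (k : Space d)
    refine (h2.congr (ae_of_all _ fun x => ?_)).integrableOn
    exact congrArg (· * φ (x + k)) (hvp k x)
  · intro k hk
    refine setIntegral_eq_zero_of_forall_eq_zero fun x hx => ?_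
    rw [image_eq_zero_of_notMem_tsupport (hs x hx k hk), mul_zero]

/-- There is a smooth compactly supported function with periodization `1`. -/
theorem exists_periodize_eq_one :
    ∃ θ : Space d → ℝ, ContDiff ℝ ∞ θ ∧ HasCompactSupport θ ∧ ∀ x, periodize hL θ x = 1 := by
  obtain ⟨R, hR⟩ := (isBounded_periodCube (d := d) hL).subset_ball (0 : Space d)
  -- The bump equals `1` on the whole period cube, so its periodization is positive everywhere and
  -- can be divided out.
  let b : ContDiffBump (0 : Space d) := ⟨|R| + 1, |R| + 2, by positivity, by linarith⟩
  have hc : HasCompactSupport (b : Space d → ℝ) := b.hasCompactSupport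
  have hfin : ∀ x, ∃ s : Finset (periodLattice (d := d) hL),
      ∀ k ∉ s, x + (k : Space d) ∉ tsupport b := by
    intro x
    obtain ⟨s, hs⟩ := exists_finset_translates hL hc (Bornology.isBounded_singleton (x := x))
    exact ⟨s, fun k hk => hs x rfl k hk⟩
  have hpos : ∀ x, 0 < periodize hL b x := by
    intro x
    obtain ⟨s, hs⟩ := hfin x
    rw [periodize_eq_sum hL (B := {x}) (by rintro y rfl; exact hs) rfl]
    obtain ⟨k, hk, -⟩ := ZSpan.exist_unique_vadd_mem_fundamentalDomain (cubeBasis hL) x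
    have hk' : x + (k : Space d) ∈ Metric.ball (0 : Space d) R := by
      rw [add_comm]; exact hR hk
    have h1 : b (x + k) = 1 := by
      refine b.one_of_mem_closedBall ?_
      have := Metric.mem_ball.1 hk'
      rw [Metric.mem_closedBall]
      exact this.le.trans ((le_abs_self R).trans (by change |R| ≤ |R| + 1; linarith))
    have hks : k ∈ s := by
      by_contra h
      have := image_eq_zero_of_notMem_tsupport (hs k h)
      rw [h1] at this
      exact one_ne_zero this
    exact Finset.sum_pos' (fun l _ => b.nonneg) ⟨k, hks, by rw [h1]; exact one_pos⟩
  refine ⟨fun x => b x / periodize hL b x,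
    b.contDiff.div (contDiff_periodize hL b.contDiff hc) fun x => (hpos x).ne', ?_, fun x => ?_⟩
  · simp only [div_eq_mul_inv]
    exact hc.mul_right
  · unfold periodize
    change ∑ᶠ k : periodLattice (d := d) hL, b (x + k) / periodize hL b (x + k) = 1
    simp only [periodize_add]
    simp only [div_eq_mul_inv]
    rw [← finsum_mul]
    exact mul_inv_cancel₀ (hpos x).ne'

theorem periodize_mul {Φ θ : Space d → ℝ}
    (hΦ : ∀ (k : periodLattice (d := d) hL) (x : Space d), Φ (x + k) = Φ x)
    (x : Space d) :
    periodize hL (fun y => θ y * Φ y) x = periodize hL θ x * Φ x := by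
  unfold periodize
  simp only [hΦ]
  rw [finsum_mul]

/-- The periodic extension of a function on the period cube. -/
def periodicExt {E : Type*} (u : Space d → E) (x : Space d) : E := u (ZSpan.fract (cubeBasis hL) x)

theorem periodicExt_add {E : Type*} (u : Space d → E) (k : periodLattice (d := d) hL)
    (x : Space d) : periodicExt hL u (x + k) = periodicExt hL u x := by
  unfold periodicExt
  rw [ZSpan.fract_add_ZSpan _ _ k.2]

theorem periodicExt_of_mem {E : Type*} (u : Space d → E) {x : Space d} (hx : x ∈ periodCube hL) :
    periodicExt hL u x = u x := by
  unfold periodicExt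
  rw [ZSpan.fract_eq_self.2 hx]

theorem measurable_fract : Measurable (ZSpan.fract (cubeBasis (d := d) hL)) := by
  have : ∀ x, ZSpan.fract (cubeBasis (d := d) hL) x =
      x - ∑ i, ⌊x i / L⌋ • (cubeBasis (d := d) hL i) := by
    intro x
    rw [ZSpan.fract_apply, ZSpan.floor]
    simp [cubeBasis_repr]
  rw [funext this]
  refine measurable_id.sub (Finset.measurable_fun_sum _ fun i _ => ?_)
  have h1 : Measurable fun x : Space d => ⌊x i / L⌋ :=
    Int.measurable_floor.comp ((by fun_prop : Continuous fun x : Space d => x i / L).measurable)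
  exact (measurable_from_top (f := fun n : ℤ => n • (cubeBasis (d := d) hL i))).comp h1

-- A compact set is covered by finitely many lattice translates of the cube, and the extension has
-- the same square integral over each of them.
open scoped Pointwise in
theorem locL2_periodicExt {E : Type*} [NormedAddCommGroup E] [MeasurableSpace E] [BorelSpace E]
    [SecondCountableTopology E] {u : Space d → E} (hum : Measurable u)
    (hu : MemLp u 2 (volume.restrict (periodCube hL))) : LocL2 (periodicExt hL u) := by
  intro K hK
  have hm : Measurable (periodicExt hL u) := hum.comp (measurable_fract hL)
  rw [memLp_two_iff_integrable_sq_norm hm.aestronglyMeasurable]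
  have hcube : IntegrableOn (fun x => ‖periodicExt hL u x‖ ^ 2) (periodCube hL) := by
    refine (hu.integrable_norm_pow (by simp)).congr ?_
    refine (ae_restrict_mem (measurableSet_periodCube hL)).mono fun x hx => ?_
    simp [periodicExt_of_mem hL u hx]
  obtain ⟨s, hs⟩ : ∃ s : Finset (periodLattice (d := d) hL), ∀ x ∈ K, ∃ k ∈ s,
      x + (k : Space d) ∈ periodCube hL := by
    have hb : Bornology.IsBounded (periodCube hL - K) := (isBounded_periodCube hL).sub hK.isBounded
    have hf := ZSpan.setFinite_inter (cubeBasis hL) hb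
    have hf' : Set.Finite {k : periodLattice (d := d) hL | (k : Space d) ∈ periodCube hL - K} := by
      refine Set.Finite.of_finite_image (f := Subtype.val) (hf.subset ?_)
        Subtype.val_injective.injOn
      rintro _ ⟨k, hk, rfl⟩
      exact ⟨hk, k.2⟩
    refine ⟨hf'.toFinset, fun x hx => ?_⟩
    obtain ⟨k, hk, -⟩ := ZSpan.exist_unique_vadd_mem_fundamentalDomain (cubeBasis hL) x
    have hk' : x + (k : Space d) ∈ periodCube hL := by rw [add_comm]; exact hk
    refine ⟨k, ?_, hk'⟩
    rw [Set.Finite.mem_toFinset]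
    exact ⟨_, hk', x, hx, by simp⟩
  have hun : IntegrableOn (fun x => ‖periodicExt hL u x‖ ^ 2)
      (⋃ k ∈ s, (fun x : Space d => x + (k : Space d)) ⁻¹' periodCube hL) := by
    rw [integrableOn_finset_iUnion]
    intro k _
    have h1 := ((measurePreserving_add_right (volume : Measure (Space d)) (k : Space d)).integrableOn_comp_preimage
      (measurableEmbedding_addRight (k : Space d))).2 hcube
    refine h1.congr_fun (fun x _ => ?_) ?_
    · simp [periodicExt_add]
    · exact (measurableSet_periodCube hL).preimage (by fun_prop)
  refine hun.mono_set fun x hx => ?_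
  obtain ⟨k, hk, hxk⟩ := hs x hx
  exact Set.mem_biUnion hk hxk

end Periodic

end

section

variable {d : ℕ} {D : SpatialDomain d}

/-! ### From functions on `Ω` to locally defined functions -/

/-- The set on which functions on `Ω` live locally: `Ω` itself for the Neumann condition, and the
whole space for the periodic condition. -/
def SpatialDomain.locSet (D : SpatialDomain d) : Set (Space d) :=
  match D.bc with
  | .neumann => D.Ω
  | .periodic _ => Set.univ

open Classical in
/-- The extension of a function from `Ω` to the whole space: by zero for the Neumann condition,
and periodically for the periodic condition. -/
def SpatialDomain.ext {E : Type*} [Zero E] (D : SpatialDomain d) (u : Space d → E) :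
    Space d → E :=
  match D.bc with
  | .neumann => D.Ω.indicator u
  | .periodic L => if hL : 0 < L then periodicExt hL u else u

theorem isOpen_locSet (D : SpatialDomain d) : IsOpen D.locSet := by
  obtain ⟨bc, Ω, h⟩ := D
  cases bc with
  | neumann => exact h.1
  | periodic L => exact isOpen_univ

theorem subset_locSet (D : SpatialDomain d) : D.Ω ⊆ D.locSet := by
  obtain ⟨bc, Ω, h⟩ := D
  cases bc with
  | neumann => exact subset_rfl
  | periodic L => exact Set.subset_univ _

theorem ext_of_mem {E : Type*} [Zero E] (D : SpatialDomain d) (u : Space d → E) {x : Space d}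
    (hx : x ∈ D.Ω) : D.ext u x = u x := by
  obtain ⟨bc, Ω, h⟩ := D
  cases bc with
  | neumann => exact Set.indicator_of_mem hx u
  | periodic L =>
    obtain ⟨hL, rfl⟩ := h
    simp only [SpatialDomain.ext, hL, dite_true]
    exact periodicExt_of_mem hL u ((mem_periodCube hL).2 fun i => ⟨(hx i).1.le, (hx i).2⟩)

theorem locL2_ext {E : Type*} [NormedAddCommGroup E] [MeasurableSpace E] [BorelSpace E]
    [SecondCountableTopology E] (D : SpatialDomain d) {u : Space d → E} (hum : Measurable u)
    (hu : MemLp u 2 D.vol) : LocL2 (D.ext u) := by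
  obtain ⟨bc, Ω, h⟩ := D
  cases bc with
  | neumann => exact locL2_of_memLp ((memLp_indicator_iff_restrict h.1.measurableSet).2 hu)
  | periodic L =>
    obtain ⟨hL, rfl⟩ := h
    simp only [SpatialDomain.ext, hL, dite_true]
    refine locL2_periodicExt hL hum ?_
    simpa only [SpatialDomain.vol, restrict_openCube hL] using hu

/-- `g` is the weak gradient of `u`, for functions instead of elements of `L²`. -/
def FunWeakGrad (D : SpatialDomain d) (u : Space d → ℝ) (g : Space d → Space d) : Prop :=
  ∀ φ : Space d → ℝ, D.IsTest φ → ∀ e : Space d,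
    ∫ x in D.Ω, u x * fderiv ℝ φ x e = -∫ x in D.Ω, ⟪g x, e⟫ * φ x

theorem FunWeakGrad.congr {u v : Space d → ℝ} {g h : Space d → Space d}
    (H : FunWeakGrad D u g) (huv : u =ᵐ[D.vol] v) (hgh : g =ᵐ[D.vol] h) : FunWeakGrad D v h := by
  intro φ hφ e
  have h1 : ∫ x in D.Ω, v x * fderiv ℝ φ x e = ∫ x in D.Ω, u x * fderiv ℝ φ x e :=
    integral_congr_ae (huv.mono fun x hx => by simp [hx])
  have h2 : ∫ x in D.Ω, ⟪h x, e⟫ * φ x = ∫ x in D.Ω, ⟪g x, e⟫ * φ x :=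
    integral_congr_ae (hgh.mono fun x hx => by simp [hx])
  rw [h1, h2]
  exact H φ hφ e

theorem periodize_test {L : ℝ} (hL : 0 < L) {φ : Space d → ℝ} (i : Fin d) (x : Space d) :
    periodize hL φ (x + EuclideanSpace.single i L) = periodize hL φ x :=
  periodize_add hL φ x ⟨_, single_mem_lattice hL i⟩

theorem integral_periodicExt_mul {L : ℝ} (hL : 0 < L) {v : Space d → ℝ} (hvm : Measurable v)
    (hv : MemLp v 2 (volume.restrict (periodCube hL))) {φ : Space d → ℝ} (hφ : Continuous φ)
    (hc : HasCompactSupport φ) :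
    ∫ x, periodicExt hL v x * φ x = ∫ x in periodCube hL, v x * periodize hL φ x := by
  rw [integral_mul_eq_periodize hL (locL2_periodicExt hL hvm hv).locallyIntegrable
    (periodicExt_add hL v) hφ hc]
  refine setIntegral_congr_fun (measurableSet_periodCube hL) fun x hx => ?_
  simp only [periodicExt_of_mem hL v hx]

/-- In the periodic case the periodic test functions are exactly the periodizations of compactly
supported ones: given periodic `Φ`, the function `θ Φ` has periodization `Φ` when `θ` has
periodization `1`. Unfolding the integrals then matches the two notions of weak gradient. -/
theorem funWeakGrad_iff_loc (D : SpatialDomain d) {u : Space d → ℝ} {g : Space d → Space d}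
    (hum : Measurable u) (hu : MemLp u 2 D.vol) (hgm : Measurable g) (hg : MemLp g 2 D.vol) :
    FunWeakGrad D u g ↔ LocWeakGrad D.locSet (D.ext u) (D.ext g) := by
  obtain ⟨bc, Ω, h⟩ := D
  cases bc with
  | neumann =>
    have hΩ : MeasurableSet Ω := h.1.measurableSet
    have h1 : ∀ φ : Space d → ℝ, ∀ e, ∫ x, Ω.indicator u x * fderiv ℝ φ x e =
        ∫ x in Ω, u x * fderiv ℝ φ x e := by
      intro φ e
      rw [← integral_indicator hΩ]
      refine integral_congr_ae (ae_of_all _ fun x => ?_)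
      by_cases hx : x ∈ Ω <;> simp [hx]
    have h2 : ∀ φ : Space d → ℝ, ∀ e, ∫ x, ⟪Ω.indicator g x, e⟫ * φ x =
        ∫ x in Ω, ⟪g x, e⟫ * φ x := by
      intro φ e
      rw [← integral_indicator hΩ]
      refine integral_congr_ae (ae_of_all _ fun x => ?_)
      by_cases hx : x ∈ Ω <;> simp [hx]
    constructor
    · intro H φ k1 k2 k3 e
      simp only [SpatialDomain.ext]
      rw [h1, h2]
      exact H φ ⟨k1, k2, k3⟩ e
    · rintro H φ ⟨k1, k2, k3⟩ e
      have := H φ k1 k2 k3 e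
      simp only [SpatialDomain.ext] at this
      rw [h1, h2] at this
      exact this
  | periodic L =>
    obtain ⟨hL, rfl⟩ := h
    simp only [SpatialDomain.vol, restrict_openCube hL] at hu hg
    simp only [SpatialDomain.ext, hL, dite_true, SpatialDomain.locSet]
    have key : ∀ φ : Space d → ℝ, ContDiff ℝ ∞ φ → HasCompactSupport φ → ∀ e,
        ∫ x, periodicExt hL u x * fderiv ℝ φ x e =
          (∫ x in {x : Space d | ∀ i, x i ∈ Set.Ioo 0 L}, u x * fderiv ℝ (periodize hL φ) x e) ∧
        ∫ x, ⟪periodicExt hL g x, e⟫ * φ x =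
          ∫ x in {x : Space d | ∀ i, x i ∈ Set.Ioo 0 L}, ⟪g x, e⟫ * periodize hL φ x := by
      intro φ k1 k2 e
      rw [restrict_openCube hL]
      simp only [fderiv_periodize hL k1 k2]
      refine ⟨integral_periodicExt_mul hL hum hu
        ((k1.continuous_fderiv (by simp)).clm_apply continuous_const) (k2.fderiv_apply ℝ e), ?_⟩
      exact integral_periodicExt_mul hL (hgm.inner_const) (hg.inner_const e) k1.continuous k2
    constructor
    · intro H φ k1 k2 _ e
      rw [(key φ k1 k2 e).1, (key φ k1 k2 e).2]
      exact H _ ⟨contDiff_periodize hL k1 k2, fun i x => periodize_test hL i x⟩ e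
    · rintro H Φ ⟨k1, k2⟩ e
      obtain ⟨θ, t1, t2, t3⟩ := exists_periodize_eq_one (d := d) hL
      have hP : periodize hL (fun y => θ y * Φ y) = Φ := by
        funext x
        rw [periodize_mul hL (periodic_lattice hL k2), t3, one_mul]
      have m1 : ContDiff ℝ ∞ fun y => θ y * Φ y := t1.mul k1
      have m2 : HasCompactSupport fun y => θ y * Φ y := t2.mul_right
      have := H _ m1 m2 (Set.subset_univ _) e
      rw [(key _ m1 m2 e).1, (key _ m1 m2 e).2, hP] at this
      exact this

theorem LocWeakGrad.congr {U : Set (Space d)} {u v : Space d → ℝ} {g h : Space d → Space d}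
    (H : LocWeakGrad U u g) (huv : ∀ x ∈ U, u x = v x) (hgh : ∀ x ∈ U, g x = h x) :
    LocWeakGrad U v h := by
  intro φ h1 h2 h3 e
  have e1 : ∫ x, v x * fderiv ℝ φ x e = ∫ x, u x * fderiv ℝ φ x e := by
    refine integral_congr_ae (ae_of_all _ fun x => ?_)
    by_cases hx : x ∈ U
    · simp [huv x hx]
    · have : fderiv ℝ φ x = 0 :=
        image_eq_zero_of_notMem_tsupport fun h => hx (h3 (tsupport_fderiv_subset ℝ h))
      simp [this]
  have e2 : ∫ x, ⟪h x, e⟫ * φ x = ∫ x, ⟪g x, e⟫ * φ x := by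
    refine integral_congr_ae (ae_of_all _ fun x => ?_)
    by_cases hx : x ∈ U
    · simp [hgh x hx]
    · simp [image_eq_zero_of_notMem_tsupport fun h => hx (h3 h)]
  rw [e1, e2]
  exact H φ h1 h2 h3 e

theorem measurable_Lp {E : Type*} [NormedAddCommGroup E] [MeasurableSpace E] [BorelSpace E]
    {μ : Measure (Space d)} (u : Lp E 2 μ) : Measurable u := (Lp.stronglyMeasurable u).measurable

theorem funWeakGrad_H1 (u : D.H1) : FunWeakGrad D (toL2 u) (grad u) := u.2

theorem locWeakGrad_ext (u : D.H1) : LocWeakGrad D.locSet (D.ext (toL2 u)) (D.ext (grad u)) :=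
  (funWeakGrad_iff_loc D (measurable_Lp _) (Lp.memLp _) (measurable_Lp _) (Lp.memLp _)).1
    (funWeakGrad_H1 u)

theorem locWeakGrad_H1 (u : D.H1) : LocWeakGrad D.Ω (D.ext (toL2 u)) (D.ext (grad u)) :=
  (locWeakGrad_ext u).mono (subset_locSet D)

/-- An element of `H¹` from functions. -/
theorem exists_H1_of_funWeakGrad {u : Space d → ℝ} {g : Space d → Space d} (hu : MemLp u 2 D.vol)
    (hg : MemLp g 2 D.vol) (h : FunWeakGrad D u g) :
    ∃ v : D.H1, toL2 v = hu.toLp u ∧ grad v = hg.toLp g :=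
  ⟨⟨WithLp.toLp 2 (hu.toLp u, hg.toLp g),
    h.congr hu.coeFn_toLp.symm hg.coeFn_toLp.symm⟩, rfl, rfl⟩

/-- The restriction to `D.locSet` matters: outside `Ω`, extension by zero does not commute with `G`
unless `G 0 = 0`. -/
theorem ext_comp (D : SpatialDomain d) {E F : Type*} [Zero E] [Zero F] (G : E → F)
    (u : Space d → E) {x : Space d} (hx : x ∈ D.locSet) :
    D.ext (fun x => G (u x)) x = G (D.ext u x) := by
  obtain ⟨bc, Ω, h⟩ := D
  cases bc with
  | neumann =>
    change x ∈ Ω at hx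
    simp [SpatialDomain.ext, hx]
  | periodic L =>
    simp only [SpatialDomain.ext, h.1, dite_true, periodicExt]

theorem ext_smul (D : SpatialDomain d) (a : Space d → ℝ) (g : Space d → Space d) {x : Space d}
    (hx : x ∈ D.locSet) : D.ext (fun x => a x • g x) x = D.ext a x • D.ext g x := by
  obtain ⟨bc, Ω, h⟩ := D
  cases bc with
  | neumann =>
    change x ∈ Ω at hx
    simp [SpatialDomain.ext, hx]
  | periodic L =>
    simp only [SpatialDomain.ext, h.1, dite_true, periodicExt]

/-- The chain rule in `H¹`. -/
theorem exists_H1_comp (u : D.H1) {G G' : ℝ → ℝ} (hG : Continuous G) (hG' : Continuous G')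
    {M : ℝ} (hGM : ∀ a, |G a| ≤ M) (hGM' : ∀ a, |G' a| ≤ M)
    (hT : ∀ a b, |G b - G a - G' a * (b - a)| ≤ M * (b - a) ^ 2) :
    ∃ v : D.H1, (toL2 v =ᵐ[D.vol] fun x => G (toL2 u x)) ∧
      grad v =ᵐ[D.vol] fun x => G' (toL2 u x) • grad u x := by
  have m1 : Measurable fun x => G (toL2 u x) := hG.measurable.comp (measurable_Lp _)
  have m2 : Measurable fun x => G' (toL2 u x) • grad u x :=
    (hG'.measurable.comp (measurable_Lp _)).smul (measurable_Lp _)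
  have l1 : MemLp (fun x => G (toL2 u x)) 2 D.vol :=
    MemLp.of_bound m1.aestronglyMeasurable M (ae_of_all _ fun x => hGM _)
  have l2 : MemLp (fun x => G' (toL2 u x) • grad u x) 2 D.vol := by
    refine MemLp.of_le_mul (c := M) (Lp.memLp (grad u)) m2.aestronglyMeasurable
      (ae_of_all _ fun x => ?_)
    rw [norm_smul]
    gcongr
    exact hGM' _
  have h1 := (locWeakGrad_ext u).comp (isOpen_locSet D) (locL2_ext D (measurable_Lp _) (Lp.memLp _))
    (locL2_ext D (measurable_Lp _) (Lp.memLp _)) hG hG' hGM hGM' hT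
  have h2 : LocWeakGrad D.locSet (D.ext fun x => G (toL2 u x))
      (D.ext fun x => G' (toL2 u x) • grad u x) := by
    refine h1.congr (fun x hx => (ext_comp D G _ hx).symm) fun x hx => ?_
    rw [ext_smul D _ _ hx, ext_comp D G' _ hx]
  obtain ⟨v, hv1, hv2⟩ := exists_H1_of_funWeakGrad l1 l2
    ((funWeakGrad_iff_loc D m1 l1 m2 l2).2 h2)
  exact ⟨v, hv1 ▸ l1.coeFn_toLp, hv2 ▸ l2.coeFn_toLp⟩

/-- Constants belong to `H¹`. -/
theorem exists_H1_const (D : SpatialDomain d) (a : ℝ) :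
    ∃ v : D.H1, toL2 v = Lp.const 2 D.vol a ∧ grad v = 0 := by
  obtain ⟨v, hv1, hv2⟩ := exists_H1_comp (D := D) 0 (G := fun _ => a) (G' := fun _ => 0)
    continuous_const continuous_const (M := |a|) (fun _ => le_rfl) (fun _ => by simp)
    (fun x y => by simp; positivity)
  refine ⟨v, ?_, ?_⟩
  · apply Lp.ext
    filter_upwards [hv1, Lp.coeFn_const (p := 2) (μ := D.vol) a] with x h1 h2
    rw [h1, h2]; rfl
  · apply Lp.ext
    filter_upwards [hv2, Lp.coeFn_zero (Space d) 2 D.vol] with x h1 h2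
    rw [h1, h2]; simp

/-- Weak gradients are unique. -/
theorem toL2_injective : Function.Injective (toL2 : D.H1 → D.H) := by
  suffices h : ∀ u : D.H1, toL2 u = 0 → u = 0 by
    intro u v huv
    rw [← sub_eq_zero]
    exact h _ (by rw [toL2_sub, huv, sub_self])
  intro u hu
  have hg0 : grad u = 0 := by
    have hloc := locL2_ext D (measurable_Lp (grad u)) (Lp.memLp _)
    have h0 : ∀ e : Space d, ∀ᵐ x, x ∈ D.Ω → ⟪D.ext (grad u) x, e⟫ = 0 := by
      intro e
      refine (isOpen_domain D).ae_eq_zero_of_integral_contDiff_smul_eq_zero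
        (LocallyIntegrable.locallyIntegrableOn ?_ _) ?_
      · have : LocL2 fun x => ⟪D.ext (grad u) x, e⟫ := fun K hK => (hloc K hK).inner_const e
        exact this.locallyIntegrable
      · intro φ h1 h2 h3
        have h4 := locWeakGrad_H1 u φ h1 h2 h3 e
        have h5 : ∫ x, D.ext (toL2 u) x * fderiv ℝ φ x e = 0 := by
          have h6 : tsupport (fun x => fderiv ℝ φ x e) ⊆ D.Ω :=
            (tsupport_fderiv_apply_subset ℝ e).trans h3
          rw [← setIntegral_mul_of_tsupport (isOpen_domain D).measurableSet h6]
          refine integral_eq_zero_of_ae ?_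
          have h7 : (toL2 u : Space d → ℝ) =ᵐ[D.vol] 0 := by rw [hu]; exact Lp.coeFn_zero _ _ _
          filter_upwards [h7, ae_restrict_mem (isOpen_domain D).measurableSet] with x hx hxΩ
          rw [ext_of_mem D _ hxΩ, hx]
          simp
        rw [h5] at h4
        simp only [smul_eq_mul, mul_comm (φ _)]
        linarith
    have h1 : ∀ i : Fin d, ∀ᵐ x ∂D.vol, ⟪D.ext (grad u) x, EuclideanSpace.single i (1 : ℝ)⟫ = 0 :=
      fun i => (ae_restrict_iff' (isOpen_domain D).measurableSet).2 (h0 _)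
    apply Lp.ext
    filter_upwards [ae_all_iff.2 h1, Lp.coeFn_zero (Space d) 2 D.vol,
      ae_restrict_mem (isOpen_domain D).measurableSet] with x hx h2 hxΩ
    rw [h2]
    ext i
    have := hx i
    rw [ext_of_mem D _ hxΩ, EuclideanSpace.inner_single_right] at this
    simpa using this
  have : ‖u‖ ^ 2 = 0 := by rw [norm_sq_H1, hu, hg0]; simp
  exact norm_eq_zero.1 (by simpa using this)

end

section

variable {d : ℕ} {D : SpatialDomain d}

/-! ### Compactness of the embedding of `H¹` into `L²` -/

/-- The axis `e` is a direction in which `ρ` decreases, with slope `-m`. Strict differentiability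
makes the linearization uniform in the base point. The error and the opening of the cone each cost
at most `m/4`, so `ρ` stays negative along the cone. -/
theorem inner_cone_of_boundary {Ω : Set (Space d)} {x₀ : Space d} {ρ : Space d → ℝ}
    (h1 : ContDiffAt ℝ 2 ρ x₀) (h2 : fderiv ℝ ρ x₀ ≠ 0) (h3 : ∀ᶠ y in 𝓝 x₀, (y ∈ Ω ↔ ρ y < 0)) :
    ∃ (O : Set (Space d)) (e : Space d) (a t₀ : ℝ), IsOpen O ∧ x₀ ∈ O ∧ 0 < a ∧ 0 < t₀ ∧
      ∀ x ∈ O ∩ Ω, ∀ y, ‖y‖ < a → ∀ t, 0 < t → t < t₀ → x + t • (e + y) ∈ Ω := by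
  set f := fderiv ℝ ρ x₀ with hf
  obtain ⟨v, hv⟩ : ∃ v, f v ≠ 0 := by
    by_contra h
    push Not at h
    exact h2 (ContinuousLinearMap.ext h)
  obtain ⟨e, hfe⟩ : ∃ e, f e < 0 := by
    refine ⟨-(f v) • v, ?_⟩
    rw [map_smul, smul_eq_mul, neg_mul, neg_lt_zero]
    exact mul_self_pos.2 hv
  set m := -f e with hm
  have hmpos : 0 < m := by linarith
  have hstrict := h1.hasStrictFDerivAt (by norm_num)
  have hlo := (hasStrictFDerivAt_iff_isLittleO.1 hstrict).def
    (c := m / (4 * (‖e‖ + 1))) (by positivity)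
  rw [nhds_prod_eq] at hlo
  obtain ⟨P, hP, Q, hQ, hPQ⟩ := eventually_prod_iff.1 hlo
  obtain ⟨δ, hδ, hball⟩ := Metric.eventually_nhds_iff_ball.1 (hP.and (hQ.and h3))
  refine ⟨Metric.ball x₀ (δ / 2), e, min 1 (m / (4 * (‖f‖ + 1))), δ / (2 * (‖e‖ + 1)),
    Metric.isOpen_ball, Metric.mem_ball_self (by positivity), by positivity, by positivity, ?_⟩
  rintro x ⟨hxO, hxΩ⟩ y hy t ht ht0
  have hy1 : ‖y‖ < 1 := hy.trans_le (min_le_left _ _)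
  have hy2 : ‖y‖ < m / (4 * (‖f‖ + 1)) := hy.trans_le (min_le_right _ _)
  have hey : ‖e + y‖ ≤ ‖e‖ + 1 := (norm_add_le _ _).trans (by linarith)
  have hx' := hball x (Metric.ball_subset_ball (by linarith) hxO)
  have hz : x + t • (e + y) ∈ Metric.ball x₀ δ := by
    rw [Metric.mem_ball, dist_eq_norm] at hxO ⊢
    have e1 : x + t • (e + y) - x₀ = (x - x₀) + t • (e + y) := by abel
    rw [e1]
    refine (norm_add_le _ _).trans_lt ?_
    have : ‖t • (e + y)‖ ≤ δ / 2 := by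
      rw [norm_smul, Real.norm_eq_abs, abs_of_pos ht]
      calc t * ‖e + y‖ ≤ δ / (2 * (‖e‖ + 1)) * (‖e‖ + 1) := by gcongr
        _ = δ / 2 := by field_simp
    linarith
  have hz' := hball _ hz
  rw [hz'.2.2]
  have hρx : ρ x < 0 := hx'.2.2.1 hxΩ
  have key := hPQ hz'.1 hx'.2.1
  simp only [add_sub_cancel_left] at key
  have k1 := (le_abs_self _).trans key
  rw [norm_smul, Real.norm_eq_abs, abs_of_pos ht, map_smul, map_add, smul_eq_mul, ← hf] at k1
  have k2 : f y ≤ m / 4 := by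
    refine (le_abs_self _).trans ((f.le_opNorm y).trans ?_)
    calc ‖f‖ * ‖y‖ ≤ (‖f‖ + 1) * (m / (4 * (‖f‖ + 1))) := by gcongr; linarith
      _ = m / 4 := by field_simp
  have k3 : m / (4 * (‖e‖ + 1)) * (t * ‖e + y‖) ≤ t * (m / 4) := by
    calc m / (4 * (‖e‖ + 1)) * (t * ‖e + y‖) ≤ m / (4 * (‖e‖ + 1)) * (t * (‖e‖ + 1)) := by gcongr
      _ = t * (m / 4) := by field_simp
  nlinarith

/-- Near `x₀`, moving by `t (z - x₀ + y)` is a convex combination with weight `t` of the point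
itself and a point in a ball around `z` contained in `Ω`. -/
theorem inner_cone_of_convex {Ω : Set (Space d)} (hΩ : IsOpen Ω) (hc : Convex ℝ Ω)
    (hne : Ω.Nonempty) (x₀ : Space d) :
    ∃ (O : Set (Space d)) (e : Space d) (a t₀ : ℝ), IsOpen O ∧ x₀ ∈ O ∧ 0 < a ∧ 0 < t₀ ∧
      ∀ x ∈ O ∩ Ω, ∀ y, ‖y‖ < a → ∀ t, 0 < t → t < t₀ → x + t • (e + y) ∈ Ω := by
  obtain ⟨z, hz⟩ := hne
  obtain ⟨r, hr, hball⟩ := Metric.isOpen_iff.1 hΩ z hz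
  refine ⟨Metric.ball x₀ (r / 2), z - x₀, r / 2, 1, Metric.isOpen_ball,
    Metric.mem_ball_self (by positivity), by positivity, one_pos, ?_⟩
  rintro x ⟨hxO, hxΩ⟩ y hy t ht ht1
  have h1 : z + (x - x₀) + y ∈ Ω := by
    refine hball ?_
    rw [Metric.mem_ball, dist_eq_norm] at hxO ⊢
    have : z + (x - x₀) + y - z = (x - x₀) + y := by abel
    rw [this]
    exact (norm_add_le _ _).trans_lt (by linarith)
  have h2 := hc hxΩ h1 (a := 1 - t) (b := t) (by linarith) ht.le (by ring)
  convert h2 using 1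
  module

theorem domain_nonempty (D : SpatialDomain d) : D.Ω.Nonempty := by
  obtain ⟨bc, Ω, h⟩ := D
  cases bc with
  | neumann => exact h.2.1.nonempty
  | periodic L =>
    obtain ⟨hL, rfl⟩ := h
    exact ⟨WithLp.toLp 2 fun _ => L / 2, fun i => ⟨by simp; linarith, by simp; linarith⟩⟩

/-- The domain satisfies a uniform inner cone condition. -/
theorem exists_inner_cone (D : SpatialDomain d) {x₀ : Space d} (hx₀ : x₀ ∈ closure D.Ω) :
    ∃ (O : Set (Space d)) (e : Space d) (a t₀ : ℝ), IsOpen O ∧ x₀ ∈ O ∧ 0 < a ∧ 0 < t₀ ∧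
      ∀ x ∈ O ∩ D.Ω, ∀ y, ‖y‖ < a → ∀ t, 0 < t → t < t₀ → x + t • (e + y) ∈ D.Ω := by
  have hopen := isOpen_domain D
  have hne := domain_nonempty D
  obtain ⟨bc, Ω, h⟩ := D
  cases bc with
  | neumann =>
    by_cases hx : x₀ ∈ Ω
    · obtain ⟨r, hr, hball⟩ := Metric.isOpen_iff.1 h.1 x₀ hx
      refine ⟨Metric.ball x₀ (r / 2), 0, 1, r / 2, Metric.isOpen_ball,
        Metric.mem_ball_self (by positivity), one_pos, by positivity, ?_⟩
      rintro x ⟨hxO, -⟩ y hy t ht ht0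
      refine hball ?_
      rw [Metric.mem_ball, dist_eq_norm] at hxO ⊢
      have : x + t • (0 + y) - x₀ = (x - x₀) + t • y := by rw [zero_add]; abel
      rw [this]
      refine (norm_add_le _ _).trans_lt ?_
      rw [norm_smul, Real.norm_eq_abs, abs_of_pos ht]
      nlinarith [norm_nonneg y]
    · have hfr : x₀ ∈ frontier Ω := by
        rw [frontier, h.1.interior_eq]
        exact ⟨hx₀, hx⟩
      obtain ⟨ρ, h1, h2, h3⟩ := h.2.2.2 x₀ hfr
      exact inner_cone_of_boundary h1 h2 h3
  | periodic L =>
    refine inner_cone_of_convex hopen ?_ hne x₀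
    obtain ⟨-, rfl⟩ := h
    simp only [Set.ofPred_forall]
    refine convex_iInter fun i => ?_
    exact (convex_Ioo 0 L).linear_preimage (EuclideanSpace.proj i : Space d →L[ℝ] ℝ).toLinearMap

/-- The extension by zero of an element of `L²(Ω)`. -/
def zeroExt (u : D.H) : Space d → ℝ := D.Ω.indicator u

theorem measurable_zeroExt (u : D.H) : Measurable (zeroExt u) :=
  (measurable_Lp u).indicator (isOpen_domain D).measurableSet

theorem memLp_zeroExt (u : D.H) : MemLp (zeroExt u) 2 volume :=
  (memLp_indicator_iff_restrict (isOpen_domain D).measurableSet).2 (Lp.memLp u)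

theorem zeroExt_ae_eq (u : D.H) : zeroExt u =ᵐ[D.vol] u :=
  (ae_restrict_mem (isOpen_domain D).measurableSet).mono fun _ hx => Set.indicator_of_mem hx _

theorem integral_zeroExt_mul (u : D.H) (v : Space d → ℝ) :
    ∫ x, zeroExt u x * v x = ∫ x in D.Ω, u x * v x := by
  rw [← integral_indicator (isOpen_domain D).measurableSet]
  refine integral_congr_ae (ae_of_all _ fun x => ?_)
  by_cases hx : x ∈ D.Ω <;> simp [zeroExt, hx]

theorem integral_zeroExt_sq (u : D.H) : ∫ x, zeroExt u x ^ 2 = ‖u‖ ^ 2 := by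
  rw [norm_Lp_sq, ← integral_indicator (isOpen_domain D).measurableSet]
  refine integral_congr_ae (ae_of_all _ fun x => ?_)
  by_cases hx : x ∈ D.Ω <;> simp [zeroExt, hx]

theorem setIntegral_zeroExt_sq_le (u : D.H) (V : Set (Space d)) :
    ∫ x in V, zeroExt u x ^ 2 ≤ ‖u‖ ^ 2 := by
  rw [← integral_zeroExt_sq]
  exact setIntegral_le_integral (memLp_zeroExt u).integrable_sq (ae_of_all _ fun x => sq_nonneg _)

theorem locWeakGrad_zeroExt (u : D.H1) :
    LocWeakGrad D.Ω (zeroExt (toL2 u)) (D.ext (grad u)) :=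
  (locWeakGrad_H1 u).congr (fun x hx => by rw [ext_of_mem D _ hx, zeroExt, Set.indicator_of_mem hx])
    fun _ _ => rfl

theorem memLp_ext_grad (u : D.H1) : MemLp (D.ext (grad u)) 2 D.vol := by
  refine (Lp.memLp (grad u)).ae_eq ?_
  filter_upwards [ae_restrict_mem (isOpen_domain D).measurableSet] with x hx
  rw [ext_of_mem D _ hx]

theorem sqrt_integral_ext_grad (u : D.H1) : √(∫ x in D.Ω, ‖D.ext (grad u) x‖ ^ 2) = ‖grad u‖ := by
  rw [← Real.sqrt_sq (norm_nonneg (grad u)), norm_Lp_sq]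
  congr 1
  refine setIntegral_congr_fun (isOpen_domain D).measurableSet fun x hx => ?_
  simp only [ext_of_mem D _ hx]

/-- Translation estimate for elements of `H¹`. -/
theorem translate_sub_le (u : D.H1) {V : Set (Space d)} (hV : IsOpen V) (hVΩ : V ⊆ D.Ω)
    (h : Space d) (hh : ∀ x ∈ V, ∀ s ∈ Set.Icc (0 : ℝ) 1, x + s • h ∈ D.Ω) :
    √(∫ x in V, (zeroExt (toL2 u) (x + h) - zeroExt (toL2 u) x) ^ 2) ≤ ‖h‖ * ‖grad u‖ := by
  have := (locWeakGrad_zeroExt u).integral_translate_sub_sq_le (locL2_of_memLp (memLp_zeroExt _))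
    (isOpen_domain D).measurableSet (memLp_ext_grad u) hV (D.isBounded.subset hVΩ) h hh
  rwa [sqrt_integral_ext_grad] at this

/-- If `u` is weakly small, its local averages are small. -/
theorem setIntegral_sq_le_average (u : D.H1) {C : ℝ} (hC : ‖u‖ ≤ C) {V : Set (Space d)}
    (hV : IsOpen V) (hVΩ : V ⊆ D.Ω) (e : Space d) {b B : ℝ} (hb : 0 < b)
    (hB : ‖e‖ + b ≤ B)
    (hh : ∀ x ∈ V, ∀ y ∈ Metric.ball (0 : Space d) b, ∀ s ∈ Set.Icc (0 : ℝ) 1,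
      x + s • (e + y) ∈ D.Ω) :
    ∫ x in V, zeroExt (toL2 u) x ^ 2 ≤ C * (B * C) +
      (volume.real (Metric.ball (0 : Space d) b))⁻¹ * (C *
        √(∫ x in V, (∫ y in Metric.ball (0 : Space d) b, zeroExt (toL2 u) (x + (e + y))) ^ 2)) := by
  have htr := translate_sub_le u hV hVΩ
  have hvmeas := measurable_zeroExt (toL2 u)
  have hvm := memLp_zeroExt (toL2 u)
  have hsq := integral_zeroExt_sq (toL2 u)
  have hsqV := setIntegral_zeroExt_sq_le (toL2 u) V
  generalize zeroExt (toL2 u) = v at *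
  set Y := Metric.ball (0 : Space d) b with hY
  have hC0 : 0 ≤ C := (norm_nonneg _).trans hC
  have hB0 : 0 ≤ B := by linarith [norm_nonneg e]
  have hYpos : 0 < volume.real Y := by
    rw [measureReal_def, ENNReal.toReal_pos_iff]
    exact ⟨Metric.measure_ball_pos _ _ hb, measure_ball_lt_top⟩
  have hYfin : IsFiniteMeasure (volume.restrict Y) := ⟨by simp [hY, measure_ball_lt_top]⟩
  have hVfin : IsFiniteMeasure (volume.restrict V) :=
    ⟨by simpa using (D.isBounded.subset hVΩ).measure_lt_top⟩
  have hvV := hvm.restrict V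
  have hvt : ∀ h : Space d, MemLp (fun x => v (x + h)) 2 volume :=
    fun h => hvm.comp_measurePreserving (measurePreserving_add_right volume h)
  have hnu : ‖toL2 u‖ ≤ C := (norm_toL2_le u).trans hC
  have hvC : √(∫ x in V, v x ^ 2) ≤ C := by
    rw [Real.sqrt_le_left hC0]
    exact hsqV.trans (by gcongr)
  have hvtC : ∀ h, √(∫ x in V, v (x + h) ^ 2) ≤ C := by
    intro h
    rw [Real.sqrt_le_left hC0]
    refine (setIntegral_le_integral (hvt h).integrable_sq (ae_of_all _ fun x => sq_nonneg _)).trans ?_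
    rw [integral_add_right_eq_self (fun x => v x ^ 2), hsq]
    gcongr
  -- One factor of `v²` is replaced by its translate; the translation estimate and Cauchy–Schwarz
  -- pay for the replacement.
  have step1 : ∀ y ∈ Y, ∫ x in V, v x ^ 2 ≤ C * (B * C) + ∫ x in V, v x * v (x + (e + y)) := by
    intro y hy
    have i1 : Integrable (fun x => v x * v (x + (e + y))) (volume.restrict V) :=
      hvV.integrable_mul ((hvt _).restrict V)
    have i2 : Integrable (fun x => v x * (v (x + (e + y)) - v x)) (volume.restrict V) :=
      hvV.integrable_mul (((hvt _).restrict V).sub hvV)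
    have e1 : ∫ x in V, v x ^ 2 =
        (∫ x in V, v x * v (x + (e + y))) - ∫ x in V, v x * (v (x + (e + y)) - v x) := by
      rw [← integral_sub i1 i2]
      refine integral_congr_ae (ae_of_all _ fun x => ?_)
      simp only
      ring
    have e2 := abs_integral_mul_le hvV (((hvt (e + y)).restrict V).sub hvV)
    have e3 := htr (e + y) (fun x hx s hs => hh x hx y hy s hs)
    have e4 : ‖e + y‖ ≤ B := by
      have : ‖y‖ < b := by simpa [hY] using hy
      exact (norm_add_le _ _).trans (by linarith)
    have e5 : √(∫ x in V, v x ^ 2) * √(∫ x in V, (v (x + (e + y)) - v x) ^ 2) ≤ C * (B * C) := by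
      refine mul_le_mul hvC (e3.trans ?_) (Real.sqrt_nonneg _) hC0
      exact mul_le_mul e4 ((norm_grad_le u).trans hC) (norm_nonneg _) hB0
    have e6 := neg_abs_le (∫ x in V, v x * (v (x + (e + y)) - v x))
    have e7 : |∫ x in V, v x * (v (x + (e + y)) - v x)| ≤ C * (B * C) := e2.trans e5
    linarith
  have hmeas : Measurable fun z : Space d × Space d => v z.2 * v (z.2 + (e + z.1)) :=
    (hvmeas.comp measurable_snd).mul (hvmeas.comp (by fun_prop))
  have hprod : Integrable (fun z : Space d × Space d => v z.2 * v (z.2 + (e + z.1)))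
      ((volume.restrict Y).prod (volume.restrict V)) := by
    rw [integrable_prod_iff hmeas.aestronglyMeasurable]
    have hi : ∀ y, Integrable (fun x => v x * v (x + (e + y))) (volume.restrict V) :=
      fun y => hvV.integrable_mul ((hvt (e + y)).restrict V)
    refine ⟨ae_of_all _ hi, ?_⟩
    refine Integrable.of_bound (hmeas.aestronglyMeasurable.norm.integral_prod_right') (C * C)
      (ae_of_all _ fun y => ?_)
    have := abs_integral_mul_le (u := fun x => |v x|) (v := fun x => |v (x + (e + y))|)
      hvV.abs ((hvt (e + y)).restrict V).abs
    simp only [sq_abs] at this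
    simp only [norm_mul, Real.norm_eq_abs]
    exact this.trans (mul_le_mul hvC (hvtC _) (Real.sqrt_nonneg _) hC0)
  -- Averaging over `y` in the ball and exchanging the integrals turns the translated factor into a
  -- local mean, which weak convergence controls.
  have step2 : volume.real Y * ∫ x in V, v x ^ 2 ≤
      volume.real Y * (C * (B * C)) + ∫ y in Y, ∫ x in V, v x * v (x + (e + y)) := by
    have hi : Integrable (fun y => ∫ x in V, v x * v (x + (e + y))) (volume.restrict Y) :=
      hprod.integral_prod_left
    have := setIntegral_mono_on (μ := volume) (s := Y) (f := fun _ => ∫ x in V, v x ^ 2)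
      (g := fun y => C * (B * C) + ∫ x in V, v x * v (x + (e + y)))
      (by change Integrable _ (volume.restrict Y); exact integrable_const _)
      (by change Integrable _ (volume.restrict Y); exact (integrable_const _).add hi)
      measurableSet_ball step1
    rw [setIntegral_const, integral_add (integrable_const _) hi, setIntegral_const] at this
    simpa using this
  have step3 : ∫ y in Y, ∫ x in V, v x * v (x + (e + y)) =
      ∫ x in V, v x * ∫ y in Y, v (x + (e + y)) := by
    rw [integral_integral_swap hprod]
    simp only [integral_const_mul]
  have hmY : MemLp (fun x => ∫ y in Y, v (x + (e + y))) 2 (volume.restrict V) := by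
    have hm : StronglyMeasurable fun x => ∫ y in Y, v (x + (e + y)) := by
      have : Measurable fun z : Space d × Space d => v (z.1 + (e + z.2)) :=
        hvmeas.comp (by fun_prop)
      exact this.stronglyMeasurable.integral_prod_right
    refine MemLp.of_bound hm.aestronglyMeasurable (√(volume.real Y) * C) (ae_of_all _ fun x => ?_)
    have h1 := abs_integral_mul_le (μ := volume.restrict Y) (u := fun _ => 1)
      (v := fun y => v (x + (e + y))) (memLp_const _) (by
        have := (hvt (x + e)).restrict Y
        simpa [add_comm, add_left_comm] using this)
    simp only [one_mul, one_pow, setIntegral_const, smul_eq_mul, mul_one] at h1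
    refine h1.trans ?_
    gcongr
    rw [Real.sqrt_le_left hC0]
    have h2 : Integrable fun y => v (x + (e + y)) ^ 2 := by
      have := (hvt (x + e)).integrable_sq
      simpa [add_comm, add_left_comm] using this
    refine (setIntegral_le_integral h2 (ae_of_all _ fun x => sq_nonneg _)).trans ?_
    have : ∫ y, v (x + (e + y)) ^ 2 = ∫ y, v y ^ 2 := by
      rw [← integral_add_right_eq_self (fun x => v x ^ 2) (x + e)]
      refine integral_congr_ae (ae_of_all _ fun y => ?_)
      simp only
      congr 2
      abel
    rw [this, hsq]
    gcongr
  have step4 : ∫ x in V, v x * ∫ y in Y, v (x + (e + y)) ≤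
      C * √(∫ x in V, (∫ y in Y, v (x + (e + y))) ^ 2) :=
    (le_abs_self _).trans ((abs_integral_mul_le hvV hmY).trans
      (mul_le_mul_of_nonneg_right hvC (Real.sqrt_nonneg _)))
  rw [step3] at step2
  have step5 := step2.trans (add_le_add_right step4 _)
  rw [← sub_nonneg] at step5 ⊢
  have : C * (B * C) + (volume.real Y)⁻¹ * (C * √(∫ x in V, (∫ y in Y, v (x + (e + y))) ^ 2)) -
      ∫ x in V, v x ^ 2 = (volume.real Y)⁻¹ * (volume.real Y * (C * (B * C)) +
      C * √(∫ x in V, (∫ y in Y, v (x + (e + y))) ^ 2) - volume.real Y * ∫ x in V, v x ^ 2) := by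
    field_simp
  rw [this]
  positivity

end

/-! ### Rellich's theorem and the Poincaré inequality. -/

section

variable {d : ℕ} {D : SpatialDomain d}

theorem tendsto_toL2_inner {u : ℕ → D.H1} {a : D.H1}
    (h : ∀ y : D.H1, Tendsto (fun n => ⟪u n, y⟫) atTop (𝓝 ⟪a, y⟫)) (χ : D.H) :
    Tendsto (fun n => ⟪toL2 (u n), χ⟫) atTop (𝓝 ⟪toL2 a, χ⟫) := by
  have := h ((toL2L D).adjoint χ)
  simp only [ContinuousLinearMap.adjoint_inner_right] at this
  exact this

theorem tendsto_grad_inner {u : ℕ → D.H1} {a : D.H1}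
    (h : ∀ y : D.H1, Tendsto (fun n => ⟪u n, y⟫) atTop (𝓝 ⟪a, y⟫)) (χ : Lp (Space d) 2 D.vol) :
    Tendsto (fun n => ⟪grad (u n), χ⟫) atTop (𝓝 ⟪grad a, χ⟫) := by
  have := h ((gradL D).adjoint χ)
  simp only [ContinuousLinearMap.adjoint_inner_right] at this
  exact this

theorem tendsto_average {u : ℕ → D.H} (h : ∀ χ : D.H, Tendsto (fun n => ⟪u n, χ⟫) atTop (𝓝 0))
    (z : Space d) (b : ℝ) :
    Tendsto (fun n => ∫ y in Metric.ball (0 : Space d) b, zeroExt (u n) (z + y)) atTop (𝓝 0) := by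
  have hχ : MemLp ((Metric.ball z b).indicator fun _ => (1 : ℝ)) 2 D.vol :=
    (memLp_const 1).indicator measurableSet_ball
  have e : ∀ n, ∫ y in Metric.ball (0 : Space d) b, zeroExt (u n) (z + y) = ⟪u n, hχ.toLp _⟫ := by
    intro n
    rw [inner_L2_eq, ← integral_indicator measurableSet_ball]
    have h1 := integral_zeroExt_mul (u n) ((Metric.ball z b).indicator fun _ => (1 : ℝ))
    have h2 : ∫ x in D.Ω, ⟪u n x, (Metric.ball z b).indicator (fun _ => (1 : ℝ)) x⟫ =
      ∫ x in D.Ω, u n x * (Metric.ball z b).indicator (fun _ => (1 : ℝ)) x := by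
      simp [mul_comm]
    rw [h2, ← h1, ← integral_add_left_eq_self (fun x => zeroExt (u n) x * _) z]
    refine integral_congr_ae (ae_of_all _ fun y => ?_)
    by_cases hy : y ∈ Metric.ball (0 : Space d) b
    · have : z + y ∈ Metric.ball z b := by simpa using hy
      simp only [Set.indicator_of_mem hy, Set.indicator_of_mem this, mul_one]
    · have : z + y ∉ Metric.ball z b := by simpa using hy
      simp only [Set.indicator_of_notMem hy, Set.indicator_of_notMem this, mul_zero]
  simp only [e]
  exact h _

theorem abs_average_le (u : D.H) (z : Space d) (b : ℝ) :
    |∫ y in Metric.ball (0 : Space d) b, zeroExt u (z + y)| ≤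
      √(volume.real (Metric.ball (0 : Space d) b)) * ‖u‖ := by
  have hfin : IsFiniteMeasure (volume.restrict (Metric.ball (0 : Space d) b)) :=
    ⟨by simp [measure_ball_lt_top]⟩
  have hvt : MemLp (fun y => zeroExt u (z + y)) 2 volume :=
    (memLp_zeroExt u).comp_measurePreserving (measurePreserving_add_left volume z)
  have h1 := abs_integral_mul_le (μ := volume.restrict (Metric.ball (0 : Space d) b))
    (u := fun _ => 1) (memLp_const _) (hvt.restrict _)
  simp only [one_mul, one_pow, setIntegral_const, smul_eq_mul, mul_one] at h1
  refine h1.trans ?_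
  gcongr
  rw [Real.sqrt_le_left (norm_nonneg _)]
  refine (setIntegral_le_integral hvt.integrable_sq (ae_of_all _ fun x => sq_nonneg _)).trans ?_
  rw [integral_add_left_eq_self (fun x => zeroExt u x ^ 2) z, integral_zeroExt_sq]

/-- Local form of Rellich's theorem. -/
theorem tendsto_setIntegral_sq {u : ℕ → D.H1} {C : ℝ} (hC : ∀ n, ‖u n‖ ≤ C)
    (hu : ∀ χ : D.H, Tendsto (fun n => ⟪toL2 (u n), χ⟫) atTop (𝓝 0))
    {O : Set (Space d)} (hO : IsOpen O) {e : Space d} {a t₀ : ℝ} (ha : 0 < a) (ht₀ : 0 < t₀)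
    (hcone : ∀ x ∈ O ∩ D.Ω, ∀ y, ‖y‖ < a → ∀ t, 0 < t → t < t₀ → x + t • (e + y) ∈ D.Ω) :
    Tendsto (fun n => ∫ x in O ∩ D.Ω, zeroExt (toL2 (u n)) x ^ 2) atTop (𝓝 0) := by
  have hC0 : 0 ≤ C := (norm_nonneg _).trans (hC 0)
  have hV : IsOpen (O ∩ D.Ω) := hO.inter (isOpen_domain D)
  have hVΩ : O ∩ D.Ω ⊆ D.Ω := Set.inter_subset_right
  have hVfin : IsFiniteMeasure (volume.restrict (O ∩ D.Ω)) :=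
    ⟨by simpa using (D.isBounded.subset hVΩ).measure_lt_top⟩
  -- At a fixed scale `t`, the displacements `t e + y` with `|y| < t a` lie in the cone. The local
  -- means vanish in the limit by dominated convergence, leaving an error of order `t`. Only
  -- afterwards is `t` made small.
  have key : ∀ t, 0 < t → t < t₀ → ∀ᶠ n in atTop,
      ∫ x in O ∩ D.Ω, zeroExt (toL2 (u n)) x ^ 2 < C * (t * (‖e‖ + a) * C) + t := by
    intro t ht htt
    have hest : ∀ n, _ := fun n => setIntegral_sq_le_average (u n) (hC n) hV hVΩ (t • e)
      (b := t * a) (B := t * (‖e‖ + a)) (by positivity)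
      (by rw [norm_smul, Real.norm_eq_abs, abs_of_pos ht]; linarith) (by
        intro x hx y hy s hs
        rcases eq_or_lt_of_le hs.1 with h0 | h0
        · rw [← h0, zero_smul, add_zero]; exact hx.2
        · have h1 : s • (t • e + y) = (s * t) • (e + t⁻¹ • y) := by
            rw [smul_add, smul_add, smul_smul, smul_smul]
            congr 2
            field_simp
          rw [h1]
          refine hcone x hx _ ?_ _ (by positivity) ?_
          · have : ‖y‖ < t * a := by simpa using hy
            rw [norm_smul, norm_inv, Real.norm_eq_abs, abs_of_pos ht, inv_mul_lt_iff₀ ht]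
            exact this
          · nlinarith [hs.2])
    have hlim : Tendsto (fun n => ∫ x in O ∩ D.Ω, (∫ y in Metric.ball (0 : Space d) (t * a),
        zeroExt (toL2 (u n)) (x + (t • e + y))) ^ 2) atTop (𝓝 (∫ x in O ∩ D.Ω, (0 : ℝ))) := by
      refine tendsto_integral_of_dominated_convergence
        (fun _ => (√(volume.real (Metric.ball (0 : Space d) (t * a))) * C) ^ 2) ?_
        (integrable_const _) ?_ ?_
      · intro n
        have hm : StronglyMeasurable fun x => ∫ y in Metric.ball (0 : Space d) (t * a),
            zeroExt (toL2 (u n)) (x + (t • e + y)) := by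
          have : Measurable fun z : Space d × Space d =>
              zeroExt (toL2 (u n)) (z.1 + (t • e + z.2)) :=
            (measurable_zeroExt _).comp (by fun_prop)
          exact this.stronglyMeasurable.integral_prod_right
        exact (hm.pow 2).aestronglyMeasurable
      · intro n
        refine ae_of_all _ fun x => ?_
        rw [norm_pow, Real.norm_eq_abs]
        simp only [← add_assoc]
        gcongr
        refine (abs_average_le _ _ _).trans ?_
        gcongr
        exact (norm_toL2_le _).trans (hC n)
      · refine ae_of_all _ fun x => ?_
        simp only [← add_assoc]
        have := (tendsto_average hu (x + t • e) (t * a)).pow 2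
        simpa using this
    rw [integral_zero] at hlim
    have hlim2 : Tendsto (fun n => C * (t * (‖e‖ + a) * C) +
        (volume.real (Metric.ball (0 : Space d) (t * a)))⁻¹ * (C *
        √(∫ x in O ∩ D.Ω, (∫ y in Metric.ball (0 : Space d) (t * a),
          zeroExt (toL2 (u n)) (x + (t • e + y))) ^ 2))) atTop
        (𝓝 (C * (t * (‖e‖ + a) * C) + (volume.real (Metric.ball (0 : Space d) (t * a)))⁻¹ *
          (C * √0))) :=
      (((Real.continuous_sqrt.tendsto 0).comp hlim).const_mul C |>.const_mul _).const_add _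
    rw [Real.sqrt_zero, mul_zero, mul_zero, add_zero] at hlim2
    filter_upwards [hlim2.eventually_lt_const (show _ < C * (t * (‖e‖ + a) * C) + t by linarith)]
      with n hn
    exact (hest n).trans_lt hn
  rw [Metric.tendsto_nhds]
  intro η hη
  have hpos : 0 < C * ((‖e‖ + a) * C) + 1 := by positivity
  set t := min (t₀ / 2) (η / (C * ((‖e‖ + a) * C) + 1)) with ht
  have ht0 : 0 < t := by positivity
  have ht1 : t < t₀ := (min_le_left _ _).trans_lt (by linarith)
  have ht2 : t * (C * ((‖e‖ + a) * C) + 1) ≤ η := by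
    rw [← le_div_iff₀ hpos]
    exact min_le_right _ _
  filter_upwards [key t ht0 ht1] with n hn
  rw [Real.dist_eq, sub_zero, abs_of_nonneg (integral_nonneg fun x => sq_nonneg _)]
  linarith

/-- Rellich's theorem: weak convergence in `H¹` implies strong convergence in `L²`. -/
theorem tendsto_toL2_of_weakly {u : ℕ → D.H1} {a : D.H1} {C : ℝ} (hC : ∀ n, ‖u n‖ ≤ C)
    (hu : ∀ y : D.H1, Tendsto (fun n => ⟪u n, y⟫) atTop (𝓝 ⟪a, y⟫)) :
    Tendsto (fun n => toL2 (u n)) atTop (𝓝 (toL2 a)) := by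
  set w : ℕ → D.H1 := fun n => u n - a with hw
  have hwC : ∀ n, ‖w n‖ ≤ C + ‖a‖ := fun n => (norm_sub_le _ _).trans (by linarith [hC n])
  have hw0 : ∀ χ : D.H, Tendsto (fun n => ⟪toL2 (w n), χ⟫) atTop (𝓝 0) := by
    intro χ
    have := (tendsto_toL2_inner hu χ).sub_const ⟪toL2 a, χ⟫
    simpa [hw, inner_sub_left] using this
  have hloc : ∃ O : Set (Space d), closure D.Ω ⊆ O ∧ IsOpen O ∧
      Tendsto (fun n => ∫ x in O ∩ D.Ω, zeroExt (toL2 (w n)) x ^ 2) atTop (𝓝 0) := by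
    -- Compactness of the closure patches the local statements together from finitely many cone
    -- neighbourhoods.
    refine D.isBounded.isCompact_closure.induction_on (p := fun s => ∃ O : Set (Space d),
      s ⊆ O ∧ IsOpen O ∧
      Tendsto (fun n => ∫ x in O ∩ D.Ω, zeroExt (toL2 (w n)) x ^ 2) atTop (𝓝 0))
      ⟨∅, subset_rfl, isOpen_empty, by simp⟩ ?_ ?_ ?_
    · rintro s t hst ⟨O, h1, h2⟩
      exact ⟨O, hst.trans h1, h2⟩
    · rintro s t ⟨O, h1, h2, h3⟩ ⟨P, k1, k2, k3⟩
      refine ⟨O ∪ P, Set.union_subset_union h1 k1, h2.union k2, ?_⟩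
      have hsum := h3.add k3
      rw [add_zero] at hsum
      refine squeeze_zero (fun n => integral_nonneg fun x => sq_nonneg _) (fun n => ?_) hsum
      have hi := (memLp_zeroExt (toL2 (w n))).integrable_sq
      rw [← integral_add_measure hi.integrableOn hi.integrableOn, Set.union_inter_distrib_right]
      exact integral_mono_measure (Measure.restrict_union_le _ _)
        (ae_of_all _ fun x => sq_nonneg _)
        (hi.integrableOn.integrable.add_measure hi.integrableOn.integrable)
    · intro x hx
      obtain ⟨O, e, b, t₀, h1, h2, h3, h4, h5⟩ := exists_inner_cone D hx
      exact ⟨O, mem_nhdsWithin_of_mem_nhds (h1.mem_nhds h2), O, subset_rfl, h1,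
        tendsto_setIntegral_sq hwC hw0 h1 h3 h4 h5⟩
  obtain ⟨O, h1, -, h3⟩ := hloc
  rw [Set.inter_eq_self_of_subset_right (subset_closure.trans h1)] at h3
  rw [tendsto_iff_norm_sub_tendsto_zero]
  have h4 : ∀ n, ∫ x in D.Ω, zeroExt (toL2 (w n)) x ^ 2 = ‖toL2 (u n) - toL2 a‖ ^ 2 := by
    intro n
    change _ = ‖toL2 (w n)‖ ^ 2
    rw [norm_Lp_sq]
    refine integral_congr_ae ?_
    filter_upwards [zeroExt_ae_eq (toL2 (w n))] with x hx
    rw [hx, Real.norm_eq_abs, sq_abs]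
  simp only [h4] at h3
  have := (Real.continuous_sqrt.tendsto 0).comp h3
  simpa [Function.comp_def, Real.sqrt_sq] using this

/-! ### The Poincaré inequality -/

theorem volume_domain_pos (D : SpatialDomain d) : 0 < volume.real D.Ω := by
  rw [measureReal_def, ENNReal.toReal_pos_iff]
  exact ⟨(isOpen_domain D).measure_pos volume (domain_nonempty D), D.isBounded.measure_lt_top⟩

/-- Functions with vanishing gradient are constant. -/
theorem exists_const_of_grad_eq_zero {u : D.H1} (hu : grad u = 0) :
    ∃ c : ℝ, toL2 u = Lp.const 2 D.vol c := by
  set v := zeroExt (toL2 u) with hv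
  have hvm : Measurable v := measurable_zeroExt _
  have hvL : MemLp v 2 volume := memLp_zeroExt _
  have hloc : ∀ x ∈ D.Ω, ∃ c : ℝ, ∃ r > 0, ∀ᵐ y, y ∈ Metric.ball x r → v y = c := by
    intro x hx
    obtain ⟨r, hr, hball⟩ := Metric.isOpen_iff.1 (isOpen_domain D) x hx
    set V := Metric.ball x (r / 2) with hV
    have hVΩ : V ⊆ D.Ω := (Metric.ball_subset_ball (by linarith)).trans hball
    -- With zero gradient the translation estimate says that small translations do not change `v`.
    have h1 : ∀ h ∈ Metric.ball (0 : Space d) (r / 2), ∀ᵐ y ∂volume.restrict V, v (y + h) = v y := by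
      intro h hh
      have h2 := translate_sub_le u (V := V) Metric.isOpen_ball hVΩ h (by
        intro y hy s hs
        refine hball ?_
        rw [hV, Metric.mem_ball, dist_eq_norm] at hy
        rw [mem_ball_zero_iff] at hh
        rw [Metric.mem_ball, dist_eq_norm]
        have : y + s • h - x = (y - x) + s • h := by abel
        rw [this]
        refine (norm_add_le _ _).trans_lt ?_
        rw [norm_smul, Real.norm_eq_abs, abs_of_nonneg hs.1]
        nlinarith [norm_nonneg h, hs.2])
      rw [hu, norm_zero, mul_zero] at h2
      have hm : MemLp (fun y => v (y + h) - v y) 2 (volume.restrict V) :=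
        ((hvL.comp_measurePreserving (measurePreserving_add_right volume h)).sub hvL).restrict V
      have h3 : ∫ y in V, (v (y + h) - v y) ^ 2 = 0 := by
        refine le_antisymm ?_ (integral_nonneg fun y => sq_nonneg _)
        exact Real.sqrt_eq_zero'.1 (le_antisymm h2 (Real.sqrt_nonneg _))
      rw [integral_eq_zero_iff_of_nonneg (fun y => sq_nonneg _) hm.integrable_sq] at h3
      filter_upwards [h3] with y hy
      simpa [sub_eq_zero] using hy
    have h4 : ∀ᵐ h ∂volume.restrict (Metric.ball (0 : Space d) (r / 2)),
        ∀ᵐ y ∂volume.restrict V, v (y + h) = v y :=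
      (ae_restrict_iff' measurableSet_ball).2 (ae_of_all _ h1)
    have hms : MeasurableSet {z : Space d × Space d | v (z.2 + z.1) = v z.2} :=
      measurableSet_eq_fun (hvm.comp (by fun_prop)) (hvm.comp measurable_snd)
    -- Fubini exchanges the null sets. A single base point `y` then serves for almost every `h`, and
    -- `v` is constant near `x`.
    rw [Measure.ae_ae_comm (p := fun h y => v (y + h) = v y) hms] at h4
    have hVpos : (volume.restrict V) (Metric.ball x (r / 4)) ≠ 0 := by
      rw [Measure.restrict_apply measurableSet_ball, Set.inter_eq_self_of_subset_left
        (Metric.ball_subset_ball (by linarith))]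
      exact (Metric.measure_ball_pos _ _ (by linarith)).ne'
    obtain ⟨y, hy, hyv⟩ : ∃ y ∈ Metric.ball x (r / 4),
        ∀ᵐ h ∂volume.restrict (Metric.ball (0 : Space d) (r / 2)), v (y + h) = v y := by
      by_contra hcon
      exact hVpos (measure_mono_null (fun y hy h => hcon ⟨y, hy, h⟩) h4)
    refine ⟨v y, r / 4, by linarith, ?_⟩
    rw [ae_restrict_iff' measurableSet_ball] at hyv
    have h5 := (measurePreserving_sub_right (volume : Measure (Space d)) y).quasiMeasurePreserving.ae hyv
    filter_upwards [h5] with z hz hzx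
    have h6 : z - y ∈ Metric.ball (0 : Space d) (r / 2) := by
      rw [mem_ball_zero_iff, ← dist_eq_norm]
      refine (dist_triangle_right _ _ x).trans_lt ?_
      rw [Metric.mem_ball] at hzx hy
      linarith
    have := hz h6
    rwa [add_sub_cancel] at this
  choose! c r hr hc using hloc
  obtain ⟨x₀, hx₀⟩ := domain_nonempty D
  have hconst : ∀ x ∈ D.Ω, c x = c x₀ := by
    intro x hx
    refine (isPreconnected_domain D).induction₂ (P := fun x y => c x = c y) ?_ ?_ ?_ hx hx₀
    · intro x hx
      filter_upwards [self_mem_nhdsWithin,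
        mem_nhdsWithin_of_mem_nhds (Metric.ball_mem_nhds x (hr x hx))] with y hy hyx
      have hpos : volume (Metric.ball x (r x) ∩ Metric.ball y (r y)) ≠ 0 :=
        ((Metric.isOpen_ball.inter Metric.isOpen_ball).measure_pos volume
          ⟨y, hyx, Metric.mem_ball_self (hr y hy)⟩).ne'
      by_contra hne
      refine hpos (measure_mono_null (fun z hz => ?_) ((hc x hx).and (hc y hy)))
      intro hz'
      exact hne ((hz'.1 hz.1).symm.trans (hz'.2 hz.2))
    · intro x y z _ _ _ h1 h2
      exact h1.trans h2
    · intro x y _ _ h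
      exact h.symm
  refine ⟨c x₀, ?_⟩
  have hae : ∀ᵐ x ∂D.vol, v x = c x₀ := by
    rw [ae_restrict_iff' (isOpen_domain D).measurableSet]
    refine measure_null_of_locally_null _ fun x hx => ?_
    rw [Set.mem_compl_iff, Set.mem_ofPred_eq, Classical.not_imp] at hx
    refine ⟨_, inter_mem_nhdsWithin _ (Metric.ball_mem_nhds x (hr x hx.1)),
      measure_mono_null (fun y hy => ?_) (hc x hx.1)⟩
    intro hy'
    refine hy.1 fun hyΩ => ?_
    rw [hy' hy.2, hconst x hx.1]
  apply Lp.ext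
  filter_upwards [hae, zeroExt_ae_eq (toL2 u), Lp.coeFn_const (p := 2) (μ := D.vol) (c x₀)]
    with x h1 h2 h3
  rw [h3, ← h2]
  exact h1

/-- The constant function `1`. -/
def oneL2 (D : SpatialDomain d) : D.H := Lp.const 2 D.vol 1

theorem inner_const (u : D.H) (a : ℝ) : ⟪u, Lp.const 2 D.vol a⟫ = a * ∫ x in D.Ω, u x := by
  rw [L2.inner_def, ← integral_const_mul]
  refine integral_congr_ae ?_
  filter_upwards [Lp.coeFn_const (p := 2) (μ := D.vol) a] with x hx
  rw [hx]
  simp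

theorem mean_eq_inner (u : D.H) : mean u = (volume.real D.Ω)⁻¹ * ⟪u, oneL2 D⟫ := by
  rw [oneL2, inner_const, one_mul, mean]

theorem mean_const (a : ℝ) : mean (Lp.const 2 D.vol a : D.H) = a := by
  have h : ∫ x in D.Ω, (Lp.const 2 D.vol a : D.H) x = volume.real D.Ω * a := by
    rw [integral_congr_ae (Lp.coeFn_const (p := 2) (μ := D.vol) a)]
    simp [SpatialDomain.vol]
  rw [mean, h, inv_mul_cancel_left₀ (volume_domain_pos D).ne']

theorem mean_sub (u v : D.H) : mean (u - v) = mean u - mean v := by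
  simp only [mean_eq_inner, inner_sub_left, mul_sub]

theorem mean_smul (a : ℝ) (u : D.H) : mean (a • u) = a * mean u := by
  simp only [mean_eq_inner, real_inner_smul_left]; ring

theorem continuous_mean : Continuous (mean : D.H → ℝ) := by
  simp only [funext mean_eq_inner]
  fun_prop

theorem mean_center (u : D.H) : mean (center u) = 0 := by
  rw [center, mean_sub, mean_const, sub_self]

/-- The Poincaré inequality. -/
theorem exists_poincare (D : SpatialDomain d) :
    ∃ C > 0, ∀ u : D.H1, mean (toL2 u) = 0 → ‖toL2 u‖ ≤ C * ‖grad u‖ := by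
  by_contra hcon
  push Not at hcon
  -- Failure of the inequality yields normalized functions with vanishing gradients. Their Rellich
  -- limit is a constant of mean zero and norm one, which is absurd.
  have h1 : ∀ n : ℕ, ∃ u : D.H1, mean (toL2 u) = 0 ∧ ‖toL2 u‖ = 1 ∧ ‖grad u‖ ≤ 1 / ((n : ℝ) + 1) := by
    intro n
    obtain ⟨u, hu1, hu2⟩ := hcon (n + 1) (by positivity)
    have hpos : 0 < ‖toL2 u‖ := lt_of_le_of_lt (by positivity) hu2
    refine ⟨‖toL2 u‖⁻¹ • u, ?_, ?_, ?_⟩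
    · rw [toL2_smul, mean_smul, hu1, mul_zero]
    · rw [toL2_smul, norm_smul, norm_inv, norm_norm, inv_mul_cancel₀ hpos.ne']
    · rw [grad_smul, norm_smul, norm_inv, norm_norm, inv_mul_le_iff₀ hpos, mul_one_div,
        le_div_iff₀ (by positivity)]
      linarith
  choose u hu0 hu1 hug using h1
  have hC : ∀ n, ‖u n‖ ≤ 2 := by
    intro n
    have h2 := norm_sq_H1 (u n)
    have h3 : ‖grad (u n)‖ ≤ 1 := (hug n).trans (by
      rw [div_le_one (by positivity)]; linarith [(n.cast_nonneg : (0 : ℝ) ≤ n)])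
    rw [hu1] at h2
    nlinarith [norm_nonneg (u n), norm_nonneg (grad (u n))]
  obtain ⟨a, φ, hφ, ha⟩ := exists_subseq_weakly_tendsto hC
  have hstrong := tendsto_toL2_of_weakly (fun n => hC (φ n)) ha
  have hga : grad a = 0 := by
    rw [← inner_self_eq_zero (𝕜 := ℝ)]
    have h4 := tendsto_grad_inner ha (grad a)
    have h5 : Tendsto (fun n => ⟪grad (u (φ n)), grad a⟫) atTop (𝓝 0) := by
      have h6 : Tendsto (fun n : ℕ => 1 / ((φ n : ℝ) + 1) * ‖grad a‖) atTop (𝓝 0) := by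
        have := (tendsto_one_div_add_atTop_nhds_zero_nat (𝕜 := ℝ)).comp hφ.tendsto_atTop
        simpa using this.mul_const ‖grad a‖
      refine squeeze_zero_norm (fun n => ?_) h6
      exact (abs_real_inner_le_norm _ _).trans (mul_le_mul_of_nonneg_right (hug _) (norm_nonneg _))
    exact tendsto_nhds_unique h4 h5
  obtain ⟨c, hc⟩ := exists_const_of_grad_eq_zero hga
  have hm : mean (toL2 a) = 0 := by
    have h7 := (continuous_mean.tendsto (toL2 a)).comp hstrong
    simp only [Function.comp_def, hu0] at h7
    exact tendsto_nhds_unique h7 tendsto_const_nhds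
  have hn : ‖toL2 a‖ = 1 := by
    have h8 := hstrong.norm
    simp only [hu1] at h8
    exact tendsto_nhds_unique h8 tendsto_const_nhds
  rw [hc, mean_const] at hm
  rw [hc, hm] at hn
  simp at hn

end

section

variable {d : ℕ} {D : SpatialDomain d}

/-! ### Monotone functions of elements of `𝒟(A)` -/

/-- The Steklov average `δ⁻¹ ∫_s^{s+δ} g`. -/
def steklov (δ : ℝ) (g : ℝ → ℝ) (s : ℝ) : ℝ := δ⁻¹ * ∫ t in s..(s + δ), g t

section Steklov

variable {δ K : ℝ} {g : ℝ → ℝ}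

theorem hasDerivAt_steklov (hg : Continuous g) (s : ℝ) :
    HasDerivAt (steklov δ g) (δ⁻¹ * (g (s + δ) - g s)) s := by
  have hF : ∀ s, HasDerivAt (fun s => ∫ t in (0 : ℝ)..s, g t) (g s) s := fun s =>
    intervalIntegral.integral_hasDerivAt_right (hg.intervalIntegrable _ _)
      (hg.stronglyMeasurableAtFilter _ _) hg.continuousAt
  have h1 : steklov δ g = fun s => δ⁻¹ * ((∫ t in (0 : ℝ)..(s + δ), g t) - ∫ t in (0 : ℝ)..s, g t) := by
    funext s
    rw [steklov, intervalIntegral.integral_interval_sub_left (hg.intervalIntegrable _ _)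
      (hg.intervalIntegrable _ _)]
  rw [h1]
  have h2 : HasDerivAt (fun s => ∫ t in (0 : ℝ)..(s + δ), g t) (g (s + δ)) s :=
    (hF (s + δ)).comp_add_const s δ
  exact (h2.sub (hF s)).const_mul _

theorem continuous_steklov (hg : Continuous g) : Continuous (steklov δ g) :=
  continuous_iff_continuousAt.2 fun s => (hasDerivAt_steklov hg s).continuousAt

theorem le_steklov (hδ : 0 < δ) (hg : Continuous g) (hm : Monotone g) (s : ℝ) :
    g s ≤ steklov δ g s := by
  have := intervalIntegral.integral_mono_on (μ := volume) (a := s) (b := s + δ) (f := fun _ => g s) (g := g)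
    (by linarith) (continuous_const.intervalIntegrable _ _) (hg.intervalIntegrable _ _) fun x hx => hm hx.1
  rw [intervalIntegral.integral_const, smul_eq_mul, add_sub_cancel_left] at this
  rw [steklov, le_inv_mul_iff₀ hδ]
  exact this

theorem steklov_le (hδ : 0 < δ) (hg : Continuous g) (hm : Monotone g) (s : ℝ) :
    steklov δ g s ≤ g (s + δ) := by
  have := intervalIntegral.integral_mono_on (μ := volume) (a := s) (b := s + δ) (g := fun _ => g (s + δ)) (f := g)
    (by linarith) (hg.intervalIntegrable _ _) (continuous_const.intervalIntegrable _ _) fun x hx => hm hx.2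
  rw [intervalIntegral.integral_const, smul_eq_mul, add_sub_cancel_left] at this
  rw [steklov, inv_mul_le_iff₀ hδ]
  exact this

theorem monotone_steklov (hδ : 0 < δ) (hg : Continuous g) (hm : Monotone g) :
    Monotone (steklov δ g) := by
  refine monotone_of_hasDerivAt_nonneg (fun s => hasDerivAt_steklov hg s) fun s => ?_
  have := hm (show s ≤ s + δ by linarith)
  have h2 : 0 ≤ g (s + δ) - g s := by linarith
  positivity

theorem abs_steklov_le (hδ : 0 < δ) (hg : Continuous g) (hm : Monotone g) (hK : ∀ s, |g s| ≤ K)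
    (s : ℝ) : |steklov δ g s| ≤ K := by
  have h1 := le_steklov hδ hg hm s
  have h2 := steklov_le hδ hg hm s
  have h3 := abs_le.1 (hK s)
  have h4 := abs_le.1 (hK (s + δ))
  exact abs_le.2 ⟨by linarith, by linarith⟩

theorem abs_deriv_steklov_le (hδ : 0 < δ) (hK : ∀ s, |g s| ≤ K) (s : ℝ) :
    |δ⁻¹ * (g (s + δ) - g s)| ≤ 2 * K / δ := by
  rw [abs_mul, abs_of_pos (inv_pos.2 hδ), div_eq_inv_mul]
  have h1 := hK (s + δ)
  have h2 := hK s
  have h3 := abs_sub (g (s + δ)) (g s)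
  have : |g (s + δ) - g s| ≤ 2 * K := by linarith
  gcongr

theorem abs_steklov_sub_le (hδ : 0 < δ) (hg : Continuous g) (hK : ∀ s, |g s| ≤ K) (a b : ℝ) :
    |steklov δ g b - steklov δ g a| ≤ 2 * K / δ * |b - a| := by
  have := Convex.norm_image_sub_le_of_norm_hasDerivWithin_le (s := Set.univ) (x := a) (y := b)
    (fun s _ => (hasDerivAt_steklov (δ := δ) hg s).hasDerivWithinAt)
    (fun s _ => abs_deriv_steklov_le hδ hK s) convex_univ trivial trivial
  simpa using this

end Steklov

/-- A bounded monotone continuous function composed with `u ∈ 𝒟(A)` pairs non-negatively with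
`A u`. -/
theorem IsA.integral_mul_nonneg_of_bounded {u : D.H1} {z : D.H} (h : IsA u z) {g : ℝ → ℝ}
    (hg : Continuous g) (hm : Monotone g) {K : ℝ} (hK : ∀ s, |g s| ≤ K) :
    0 ≤ ∫ x in D.Ω, z x * g (toL2 u x) := by
  have hK0 : 0 ≤ K := (abs_nonneg _).trans (hK 0)
  have hum := measurable_Lp (toL2 u)
  have hzi : Integrable z D.vol := (Lp.memLp z).integrable (by norm_num)
  -- The chain rule `exists_H1_comp` asks for a quadratic Taylor remainder. Two averages of a
  -- bounded continuous function have a Lipschitz derivative, which provides it, and they keep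
  -- monotonicity.
  have key : ∀ δ, 0 < δ → 0 ≤ ∫ x in D.Ω, z x * steklov δ (steklov δ g) (toL2 u x) := by
    intro δ hδ
    have hg1 := continuous_steklov (δ := δ) hg
    have hm1 := monotone_steklov hδ hg hm
    have hK1 := abs_steklov_le hδ hg hm hK
    have hd := hasDerivAt_steklov (δ := δ) hg1
    have hcG' : Continuous fun s => δ⁻¹ * (steklov δ g (s + δ) - steklov δ g s) := by fun_prop
    set M := K + 2 * K / δ + δ⁻¹ * (2 * (2 * K / δ)) with hM
    have hM1 : K ≤ M := by
      have : 0 ≤ 2 * K / δ + δ⁻¹ * (2 * (2 * K / δ)) := by positivity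
      linarith
    have hM2 : 2 * K / δ ≤ M := by
      have : 0 ≤ K + δ⁻¹ * (2 * (2 * K / δ)) := by positivity
      linarith
    have hM3 : δ⁻¹ * (2 * (2 * K / δ)) ≤ M := by
      have : 0 ≤ K + 2 * K / δ := by positivity
      linarith
    have hT : ∀ a b, |steklov δ (steklov δ g) b - steklov δ (steklov δ g) a -
        δ⁻¹ * (steklov δ g (a + δ) - steklov δ g a) * (b - a)| ≤ M * (b - a) ^ 2 := by
      intro a b
      have hb := Convex.norm_image_sub_le_of_norm_hasDerivWithin_le (s := Set.uIcc a b) (x := a)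
        (y := b) (C := δ⁻¹ * (2 * (2 * K / δ)) * |b - a|)
        (f := fun t => steklov δ (steklov δ g) t -
          δ⁻¹ * (steklov δ g (a + δ) - steklov δ g a) * t)
        (fun t _ => ((hd t).sub ((hasDerivAt_id t).const_mul
          (δ⁻¹ * (steklov δ g (a + δ) - steklov δ g a)))).hasDerivWithinAt) ?_
        (convex_uIcc a b) Set.left_mem_uIcc Set.right_mem_uIcc
      · have e1 : steklov δ (steklov δ g) b -
            δ⁻¹ * (steklov δ g (a + δ) - steklov δ g a) * b - (steklov δ (steklov δ g) a -
            δ⁻¹ * (steklov δ g (a + δ) - steklov δ g a) * a) =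
            steklov δ (steklov δ g) b - steklov δ (steklov δ g) a -
            δ⁻¹ * (steklov δ g (a + δ) - steklov δ g a) * (b - a) := by ring
        rw [e1, Real.norm_eq_abs, Real.norm_eq_abs] at hb
        refine hb.trans ?_
        rw [mul_assoc, abs_mul_abs_self, ← pow_two]
        gcongr
      · intro t ht
        have h1 := abs_steklov_sub_le hδ hg hK (a + δ) (t + δ)
        have h2 := abs_steklov_sub_le hδ hg hK a t
        have h3 : |t - a| ≤ |b - a| := Set.abs_sub_left_of_mem_uIcc ht
        have e2 : δ⁻¹ * (steklov δ g (t + δ) - steklov δ g t) -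
            δ⁻¹ * (steklov δ g (a + δ) - steklov δ g a) * 1 = δ⁻¹ *
            ((steklov δ g (t + δ) - steklov δ g (a + δ)) - (steklov δ g t - steklov δ g a)) := by
          ring
        rw [e2, norm_mul, Real.norm_eq_abs, Real.norm_eq_abs, abs_of_pos (inv_pos.2 hδ), mul_assoc]
        rw [show t + δ - (a + δ) = t - a by ring] at h1
        have h4 := abs_sub (steklov δ g (t + δ) - steklov δ g (a + δ))
          (steklov δ g t - steklov δ g a)
        have h5 : 2 * K / δ * |t - a| ≤ 2 * K / δ * |b - a| := by gcongr
        gcongr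
        linarith
    obtain ⟨V, hV1, hV2⟩ := exists_H1_comp u (continuous_steklov (δ := δ) hg1) hcG' (M := M)
      (fun a => (abs_steklov_le hδ hg1 hm1 hK1 a).trans hM1)
      (fun a => (abs_deriv_steklov_le hδ hK1 a).trans hM2) hT
    have h1 := h V
    have h2 : ⟪z, toL2 V⟫ = ∫ x in D.Ω, z x * steklov δ (steklov δ g) (toL2 u x) := by
      rw [L2.inner_def]
      refine integral_congr_ae ?_
      filter_upwards [hV1] with x hx
      rw [hx]
      simp [mul_comm]
    rw [← h2, ← h1, L2.inner_def]
    refine integral_nonneg_of_ae ?_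
    filter_upwards [hV2] with x hx
    rw [hx, real_inner_smul_right, real_inner_self_eq_norm_sq]
    have h3 := hm1 (show toL2 u x ≤ toL2 u x + δ by linarith)
    have h4 : 0 ≤ steklov δ g (toL2 u x + δ) - steklov δ g (toL2 u x) := by linarith
    simp only [Pi.zero_apply]
    positivity
  have hδn : Tendsto (fun n : ℕ => 1 / ((n : ℝ) + 1)) atTop (𝓝 0) :=
    tendsto_one_div_add_atTop_nhds_zero_nat
  refine ge_of_tendsto' (f := fun n : ℕ => ∫ x in D.Ω, z x *
    steklov (1 / ((n : ℝ) + 1)) (steklov (1 / ((n : ℝ) + 1)) g) (toL2 u x)) (x := atTop) ?_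
    fun n => key _ (by positivity)
  refine tendsto_integral_of_dominated_convergence (fun x => ‖z x‖ * K) ?_ (hzi.norm.mul_const K)
    ?_ ?_
  · intro n
    exact ((measurable_Lp z).mul ((continuous_steklov (continuous_steklov hg)).measurable.comp
      hum)).aestronglyMeasurable
  · intro n
    refine ae_of_all _ fun x => ?_
    rw [norm_mul]
    have hpos : (0 : ℝ) < 1 / ((n : ℝ) + 1) := by positivity
    gcongr
    exact abs_steklov_le hpos (continuous_steklov hg) (monotone_steklov hpos hg hm)
      (abs_steklov_le hpos hg hm hK) _
  · refine ae_of_all _ fun x => Tendsto.const_mul _ ?_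
    generalize toL2 u x = s
    have hup : Tendsto (fun n : ℕ => g (s + 1 / ((n : ℝ) + 1) + 1 / ((n : ℝ) + 1))) atTop
        (𝓝 (g s)) := by
      have h1 : Tendsto (fun n : ℕ => s + 1 / ((n : ℝ) + 1) + 1 / ((n : ℝ) + 1)) atTop (𝓝 s) := by
        simpa using (hδn.const_add s).add hδn
      exact (hg.tendsto s).comp h1
    refine tendsto_of_tendsto_of_tendsto_of_le_of_le tendsto_const_nhds hup (fun n => ?_)
      fun n => ?_
    · have hpos : (0 : ℝ) < 1 / ((n : ℝ) + 1) := by positivity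
      exact (le_steklov hpos hg hm s).trans
        (le_steklov hpos (continuous_steklov hg) (monotone_steklov hpos hg hm) s)
    · have hpos : (0 : ℝ) < 1 / ((n : ℝ) + 1) := by positivity
      exact (steklov_le hpos (continuous_steklov hg) (monotone_steklov hpos hg hm) s).trans
        (steklov_le hpos hg hm _)

/-- Monotonicity: `(A u, g(u)) ≥ 0` for monotone `g`. -/
theorem IsA.inner_monotone_nonneg {u : D.H1} {z ζ : D.H} (h : IsA u z) {g : ℝ → ℝ}
    (hg : Continuous g) (hm : Monotone g) (hg0 : g 0 = 0)
    (hζ : ζ =ᵐ[D.vol] fun x => g (toL2 u x)) : 0 ≤ ⟪z, ζ⟫ := by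
  have hint : Integrable (fun x => ‖z x‖ * ‖ζ x‖) D.vol :=
    (Lp.memLp z).norm.integrable_mul (Lp.memLp ζ).norm
  have e : ⟪z, ζ⟫ = ∫ x in D.Ω, z x * g (toL2 u x) := by
    rw [L2.inner_def]
    refine integral_congr_ae ?_
    filter_upwards [hζ] with x hx
    rw [hx]
    simp [mul_comm]
  rw [e]
  -- Truncating the argument makes `g` bounded. As `g 0 = 0` and `g` is monotone, the truncation
  -- never exceeds `|g|`, so `|z| |ζ|` dominates.
  have hcl : ∀ (n : ℕ), Continuous fun s : ℝ => g (max (-(n : ℝ)) (min n s)) := fun n => by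
    fun_prop
  refine ge_of_tendsto' (f := fun n : ℕ => ∫ x in D.Ω, z x *
    g (max (-(n : ℝ)) (min n (toL2 u x)))) (x := atTop) ?_ fun n => ?_
  · refine tendsto_integral_of_dominated_convergence (fun x => ‖z x‖ * ‖ζ x‖) ?_ hint ?_ ?_
    · intro n
      exact ((measurable_Lp z).mul ((hcl n).measurable.comp
        (measurable_Lp (toL2 u)))).aestronglyMeasurable
    · intro n
      filter_upwards [hζ] with x hx
      rw [norm_mul, hx]
      gcongr
      generalize toL2 u x = s
      have hn : (0 : ℝ) ≤ n := n.cast_nonneg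
      simp only [Real.norm_eq_abs]
      rcases le_total 0 s with hs | hs
      · have h1 : 0 ≤ max (-(n : ℝ)) (min n s) := le_max_of_le_right (le_min hn hs)
        have h2 : max (-(n : ℝ)) (min n s) ≤ s :=
          max_le (by linarith) (min_le_right _ _)
        have h3 := hm h1
        have h4 := hm h2
        rw [hg0] at h3
        rw [abs_of_nonneg h3, abs_of_nonneg (h3.trans h4)]
        exact h4
      · have h1 : max (-(n : ℝ)) (min n s) ≤ 0 := max_le (by linarith) ((min_le_right _ _).trans hs)
        have h2 : s ≤ max (-(n : ℝ)) (min n s) :=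
          le_max_of_le_right (le_min (by linarith) le_rfl)
        have h3 := hm h1
        have h4 := hm h2
        rw [hg0] at h3
        rw [abs_of_nonpos h3, abs_of_nonpos (h4.trans h3)]
        linarith
    · refine ae_of_all _ fun x => Tendsto.const_mul _ (tendsto_const_nhds.congr' ?_)
      generalize toL2 u x = s
      obtain ⟨N, hN⟩ := exists_nat_ge |s|
      filter_upwards [eventually_ge_atTop N] with n hn
      have h1 : |s| ≤ n := hN.trans (by exact_mod_cast hn)
      have h2 := abs_le.1 h1
      rw [min_eq_right h2.2, max_eq_right h2.1]
  · refine h.integral_mul_nonneg_of_bounded (hcl n) (fun a b hab => hm ?_)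
      (K := max |g (-n)| |g n|) fun s => ?_
    · gcongr
    · have hn : (0 : ℝ) ≤ n := n.cast_nonneg
      exact abs_le_max_abs_abs (hm (le_max_left _ _))
        (hm (max_le (by linarith) (min_le_left _ _)))

end

section

variable {d : ℕ} {D : SpatialDomain d}

/-! ### The operator `A` and the dual norm -/

theorem exists_oneH1 (D : SpatialDomain d) : ∃ o : D.H1, toL2 o = oneL2 D ∧ grad o = 0 :=
  exists_H1_const D 1

theorem IsA.inner_one {V : D.H1} {z : D.H} (h : IsA V z) : ⟪z, oneL2 D⟫ = 0 := by
  obtain ⟨o, ho1, ho2⟩ := exists_oneH1 D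
  rw [← ho1, ← h o, ho2, inner_zero_right]

theorem IsA.sub {V W : D.H1} {z y : D.H} (h : IsA V z) (k : IsA W y) : IsA (V - W) (z - y) := by
  intro φ
  rw [grad_sub, inner_sub_left, inner_sub_left, h φ, k φ]

theorem mean_eq_zero_iff {q : D.H} : mean q = 0 ↔ ⟪q, oneL2 D⟫ = 0 := by
  rw [mean_eq_inner]
  simp [(volume_domain_pos D).ne']

theorem const_eq_smul (a : ℝ) : (Lp.const 2 D.vol a : D.H) = a • oneL2 D := by
  apply Lp.ext
  filter_upwards [Lp.coeFn_const (p := 2) (μ := D.vol) a, Lp.coeFn_smul a (oneL2 D),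
    Lp.coeFn_const (p := 2) (μ := D.vol) (1 : ℝ)] with x h1 h2 h3
  rw [h1, h2, Pi.smul_apply, oneL2, h3]
  simp

theorem center_eq (u : D.H) : center u = u - mean u • oneL2 D := by
  rw [center, const_eq_smul]

theorem exists_centerH1 (v : D.H1) :
    ∃ w : D.H1, toL2 w = center (toL2 v) ∧ grad w = grad v := by
  obtain ⟨o, ho1, ho2⟩ := exists_oneH1 D
  refine ⟨v - mean (toL2 v) • o, ?_, ?_⟩
  · rw [toL2_sub, toL2_smul, ho1, center_eq]
  · rw [grad_sub, grad_smul, ho2, smul_zero, sub_zero]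

theorem inner_center_of_mean_zero {q : D.H} (hq : mean q = 0) (v : D.H) :
    ⟪q, center v⟫ = ⟪q, v⟫ := by
  rw [center_eq, inner_sub_right, inner_smul_right, mean_eq_zero_iff.1 hq, mul_zero, sub_zero]

/-- `C` is a constant in the Poincaré inequality. -/
def IsPoincareConst (D : SpatialDomain d) (C : ℝ) : Prop :=
  0 < C ∧ ∀ u : D.H1, mean (toL2 u) = 0 → ‖toL2 u‖ ≤ C * ‖grad u‖

theorem IsPoincareConst.norm_center_le {C : ℝ} (hC : IsPoincareConst D C) (v : D.H1) :
    ‖center (toL2 v)‖ ≤ C * ‖grad v‖ := by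
  obtain ⟨w, hw1, hw2⟩ := exists_centerH1 v
  rw [← hw1, ← hw2]
  refine hC.2 w ?_
  rw [hw1, mean_center]

/-- The Lax–Milgram theorem for the form `⟪g u, g v⟫ + T u * T v`. -/
theorem exists_inner_add_mul_eq {X Y : Type*} [NormedAddCommGroup X] [InnerProductSpace ℝ X]
    [CompleteSpace X] [NormedAddCommGroup Y] [InnerProductSpace ℝ Y] (g : X →L[ℝ] Y)
    (T ℓ : X →L[ℝ] ℝ) {K : ℝ} (hK : 0 < K) (h : ∀ x, ‖x‖ ^ 2 ≤ K * (‖g x‖ ^ 2 + T x ^ 2)) :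
    ∃ N : X, ∀ φ, ⟪g N, g φ⟫ + T N * T φ = ℓ φ := by
  let B : X →L[ℝ] X →L[ℝ] ℝ :=
    (isBoundedBilinearMap_inner (𝕜 := ℝ) (E := Y)).toContinuousLinearMap.bilinearComp g g + (ContinuousLinearMap.mul ℝ ℝ).bilinearComp T T
  have hB : ∀ u v, B u v = ⟪g u, g v⟫ + T u * T v := fun u v => rfl
  have hcoer : IsCoercive B := by
    refine ⟨K⁻¹, by positivity, fun u => ?_⟩
    rw [hB, real_inner_self_eq_norm_sq, mul_assoc, ← pow_two, inv_mul_le_iff₀ hK, ← pow_two]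
    exact h u
  refine ⟨hcoer.continuousLinearEquivOfBilin.symm ((InnerProductSpace.toDual ℝ X).symm ℓ),
    fun φ => ?_⟩
  have h1 := hcoer.continuousLinearEquivOfBilin_apply
    (hcoer.continuousLinearEquivOfBilin.symm ((InnerProductSpace.toDual ℝ X).symm ℓ)) φ
  rw [ContinuousLinearEquiv.apply_symm_apply, InnerProductSpace.toDual_symm_apply, hB] at h1
  exact h1.symm

/-- Solvability of `A N = q` for `q` of mean value zero. -/
theorem exists_isA {q : D.H} (hq : mean q = 0) : ∃ N : D.H1, IsA N q := by
  obtain ⟨C, hC0, hC⟩ := exists_poincare D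
  have hC' : IsPoincareConst D C := ⟨hC0, hC⟩
  obtain ⟨o, ho1, ho2⟩ := exists_oneH1 D
  have hv := volume_domain_pos D
  -- The Dirichlet form degenerates on constants; adding the square of the integral restores
  -- coercivity.
  set T : D.H1 →L[ℝ] ℝ := (innerSL ℝ (oneL2 D)).comp (toL2L D) with hT
  have hTa : ∀ u, T u = ⟪oneL2 D, toL2 u⟫ := fun u => rfl
  set K : ℝ := 2 * C ^ 2 + 1 + 2 * ((volume.real D.Ω)⁻¹ * ‖oneL2 D‖) ^ 2 with hK
  obtain ⟨N, hN⟩ := exists_inner_add_mul_eq (gradL D) T ((innerSL ℝ q).comp (toL2L D))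
    (K := K) (by positivity) fun u => by
      have h1 := hC'.norm_center_le u
      have h2 : ‖toL2 u‖ ≤ ‖center (toL2 u)‖ + |mean (toL2 u)| * ‖oneL2 D‖ := by
        have : toL2 u = center (toL2 u) + mean (toL2 u) • oneL2 D := by
          rw [center_eq, sub_add_cancel]
        calc ‖toL2 u‖ = ‖center (toL2 u) + mean (toL2 u) • oneL2 D‖ := by rw [← this]
          _ ≤ _ := by
            refine (norm_add_le _ _).trans ?_
            rw [norm_smul, Real.norm_eq_abs]
      have h3 : |mean (toL2 u)| = (volume.real D.Ω)⁻¹ * |T u| := by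
        rw [mean_eq_inner, abs_mul, abs_of_pos (inv_pos.2 hv), hTa, real_inner_comm]
      rw [h3] at h2
      have h4 : ‖toL2 u‖ ^ 2 ≤ (C * ‖grad u‖ + (volume.real D.Ω)⁻¹ * ‖oneL2 D‖ * |T u|) ^ 2 := by
        gcongr
        linarith
      have h5 := sq_nonneg (C * ‖grad u‖ - (volume.real D.Ω)⁻¹ * ‖oneL2 D‖ * |T u|)
      have h6 := sq_abs (T u)
      rw [norm_sq_H1 u]
      change _ ≤ K * (‖grad u‖ ^ 2 + T u ^ 2)
      rw [← h6, hK]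
      have h7 : 0 ≤ ((volume.real D.Ω)⁻¹ * ‖oneL2 D‖) ^ 2 * ‖grad u‖ ^ 2 := by positivity
      have h8 : 0 ≤ (2 * C ^ 2 + 1) * |T u| ^ 2 := by positivity
      nlinarith
  have hN' : ∀ φ, ⟪grad N, grad φ⟫ + T N * T φ = ⟪q, toL2 φ⟫ := hN
  -- Testing with the constant `1` and using that `q` has mean zero shows that the added term does
  -- not affect the solution.
  have h0 : T N = 0 := by
    have h1 := hN' o
    rw [ho2, inner_zero_right, ho1, mean_eq_zero_iff.1 hq, zero_add, hTa o, ho1,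
      real_inner_self_eq_norm_sq] at h1
    have h2 : ‖oneL2 D‖ ≠ 0 := by
      intro h
      have h3 : mean (oneL2 D) = 1 := mean_const 1
      rw [norm_eq_zero] at h
      rw [h, mean_eq_inner, inner_zero_left] at h3
      simp at h3
    simpa [h2] using h1
  refine ⟨N, fun φ => ?_⟩
  rw [← hN' φ, h0, zero_mul, add_zero]

/-- An upper bound for the dual norm. -/
theorem IsA.dualNorm_le {N : D.H1} {q : D.H} (h : IsA N q) :
    dualNorm q ≤ ENNReal.ofReal ‖grad N‖ := by
  refine iSup_le fun χ => ENNReal.ofReal_le_ofReal ?_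
  rw [← h χ]
  exact div_le_of_le_mul₀ (norm_nonneg _) (norm_nonneg _) (abs_real_inner_le_norm _ _)

/-- A lower bound for the dual norm. -/
theorem IsA.norm_grad_le_of_dualNorm_le {N : D.H1} {q : D.H} (h : IsA N q) {R : ℝ}
    (hR : dualNorm q ≤ ENNReal.ofReal R) : ‖grad N‖ ≤ max R 0 := by
  have h1 := (le_iSup (fun χ : D.H1 => ENNReal.ofReal (|⟪q, toL2 χ⟫| / semi1 χ)) N).trans hR
  rcases eq_or_lt_of_le (norm_nonneg (grad N)) with h0 | h0
  · rw [← h0]; exact le_max_right _ _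
  · rw [← h N, real_inner_self_eq_norm_sq, semi1, abs_of_nonneg (sq_nonneg _), pow_two,
      mul_div_cancel_right₀ _ h0.ne', ENNReal.ofReal_le_ofReal_iff'] at h1
    rcases h1 with h1 | h1
    · exact h1.trans (le_max_left _ _)
    · exact h1.trans (le_max_right _ _)

/-- Testing with `N` itself; as `q` has mean zero, `N` may be centred before Poincaré's inequality
is applied. -/
theorem IsA.norm_grad_le_mul {C : ℝ} (hC : IsPoincareConst D C) {N : D.H1} {q : D.H} (h : IsA N q)
    (hq : mean q = 0) : ‖grad N‖ ≤ C * ‖q‖ := by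
  have h1 := h N
  rw [real_inner_self_eq_norm_sq, ← inner_center_of_mean_zero hq] at h1
  have h2 := real_inner_le_norm q (center (toL2 N))
  have h3 := hC.norm_center_le N
  have h4 : ‖q‖ * ‖center (toL2 N)‖ ≤ ‖q‖ * (C * ‖grad N‖) := by gcongr
  rcases eq_or_lt_of_le (norm_nonneg (grad N)) with h0 | h0
  · rw [← h0]
    have := hC.1
    positivity
  · nlinarith

/-- Poincaré's inequality is used twice, once for the inverse Laplacian and once for the function,
so its constant squared is admissible. -/
theorem exists_isDualPoincareConst (D : SpatialDomain d) : ∃ γ > 0, IsDualPoincareConst D γ := by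
  obtain ⟨C, hC⟩ := exists_poincare D
  have hC : IsPoincareConst D C := hC
  refine ⟨C * C, mul_pos hC.1 hC.1, fun v => ?_⟩
  obtain ⟨N, hN⟩ := exists_isA (mean_center (toL2 v))
  refine hN.dualNorm_le.trans (ENNReal.ofReal_le_ofReal ?_)
  refine (hN.norm_grad_le_mul hC (mean_center _)).trans ?_
  rw [mul_assoc]
  have := hC.norm_center_le v
  have := hC.1
  exact mul_le_mul_of_nonneg_left (hC.norm_center_le v) hC.1.le

/-! ### The nonlinearity -/

section Nonlinearity

variable {f F : ℝ → ℝ} {p c₀ c₁ c₃ c : ℝ} {c₂ : ℝ → ℝ}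

theorem IsNonlinearity.continuous_f (hf : IsNonlinearity d f F p c₀ c₁ c₂ c₃ c) : Continuous f :=
  hf.differentiable_f.continuous

theorem IsNonlinearity.continuous_F (hf : IsNonlinearity d f F p c₀ c₁ c₂ c₃ c) : Continuous F :=
  continuous_iff_continuousAt.2 fun s => (hf.hasDerivAt_F s).continuousAt

theorem IsNonlinearity.monotone (hf : IsNonlinearity d f F p c₀ c₁ c₂ c₃ c) :
    Monotone fun s => f s + c * s := by
  refine monotone_of_hasDerivAt_nonneg (f' := fun s => deriv f s + c) (fun s => ?_) fun s => ?_
  · exact ((hf.differentiable_f s).hasDerivAt.add ((hasDerivAt_id s).const_mul c)).congr_deriv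
      (by rw [mul_one])
  · have := hf.deriv_f s
    simp only [Pi.zero_apply]
    linarith

theorem IsNonlinearity.sub_mul_sub (hf : IsNonlinearity d f F p c₀ c₁ c₂ c₃ c) (a b : ℝ) :
    -(c * (b - a) ^ 2) ≤ (f b - f a) * (b - a) := by
  rcases le_total a b with h | h
  · have := hf.monotone h
    simp only at this
    nlinarith
  · have := hf.monotone h
    simp only at this
    nlinarith

/-- The function `k` in the proof has derivative `f t + c t - (f b + c b)`, which is monotone and
vanishes at `b`, so `b` is a minimum of `k`. -/
theorem IsNonlinearity.convexity (hf : IsNonlinearity d f F p c₀ c₁ c₂ c₃ c) (a b : ℝ) :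
    F b - F a - c / 2 * (b - a) ^ 2 ≤ f b * (b - a) := by
  set k : ℝ → ℝ := fun t => F t + c / 2 * (t - b) ^ 2 - f b * (t - b) with hk
  have hd : ∀ t, HasDerivAt k (f t + c * (t - b) - f b) t := by
    intro t
    have h1 : HasDerivAt (fun t => t - b) 1 t := (hasDerivAt_id t).sub_const b
    have h2 := ((hf.hasDerivAt_F t).add ((h1.pow 2).const_mul (c / 2))).sub (h1.const_mul (f b))
    exact h2.congr_deriv (by simp only [Nat.cast_ofNat]; ring)
  have hcont : Continuous k := continuous_iff_continuousAt.2 fun t => (hd t).continuousAt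
  have key : k b ≤ k a := by
    rcases lt_trichotomy a b with h | h | h
    · obtain ⟨ξ, hξ, he⟩ := exists_hasDerivAt_eq_slope k _ h hcont.continuousOn fun t _ => hd t
      have hm := hf.monotone hξ.2.le
      simp only at hm
      have : (k b - k a) / (b - a) ≤ 0 := by rw [← he]; linarith
      rw [div_le_iff₀ (by linarith)] at this
      linarith
    · rw [h]
    · obtain ⟨ξ, hξ, he⟩ := exists_hasDerivAt_eq_slope k _ h hcont.continuousOn fun t _ => hd t
      have hm := hf.monotone hξ.1.le
      simp only at hm
      have : 0 ≤ (k a - k b) / (a - b) := by rw [← he]; linarith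
      rw [le_div_iff₀ (by linarith)] at this
      linarith
  simp only [hk, sub_self] at key
  nlinarith

theorem IsNonlinearity.F_add_nonneg (hf : IsNonlinearity d f F p c₀ c₁ c₂ c₃ c) (s : ℝ) :
    0 ≤ F s + c₃ := by
  have h1 := hf.F_lower s
  have h2 : 0 ≤ 1 / 2 * c₀ * |s| ^ (2 * p) := by
    have := hf.c₀_pos
    positivity
  linarith

/-- This is where `C₁(α)` comes from. Of the coercive term `p c₀ |s|^{2p}`, the part `p - 3/2`
absorbs `f(s) m`, which dictates `η = (p - 3/2)/α`; the remaining `3/2` dominates `F`. -/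
theorem IsNonlinearity.mul_sub_mean (hf : IsNonlinearity d f F p c₀ c₁ c₂ c₃ c) {α : ℝ}
    {m : ℝ} (hm : |m| ≤ α) (s : ℝ) :
    F s + c₃ - (c₁ + c₂ ((p - 3 / 2) / α) * α + 2 * c₃) ≤ f s * (s - m) := by
  have hp := hf.two_le_p
  have hc₀ := hf.c₀_pos
  have h1 := hf.lower s
  have h2 := hf.F_upper s
  have hX : 0 ≤ |s| ^ (2 * p) := by positivity
  set X := |s| ^ (2 * p) with hXdef
  have h3 : f s * m ≤ (p - 3 / 2) * (c₀ * X) + c₂ ((p - 3 / 2) / α) * α := by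
    rcases eq_or_lt_of_le ((abs_nonneg m).trans hm) with h0 | h0
    · have : m = 0 := abs_nonpos_iff.1 (hm.trans h0.symm.le)
      rw [this, ← h0, mul_zero, mul_zero, add_zero]
      have : 0 ≤ c₀ * X := by positivity
      nlinarith
    · have hη : 0 < (p - 3 / 2) / α := div_pos (by linarith) h0
      have h4 := hf.growth _ hη s
      rw [← hXdef] at h4
      calc f s * m ≤ |f s| * |m| := by rw [← abs_mul]; exact le_abs_self _
        _ ≤ |f s| * α := by gcongr
        _ ≤ ((p - 3 / 2) / α * c₀ * X + c₂ ((p - 3 / 2) / α)) * α := by gcongr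
        _ = _ := by field_simp
  nlinarith

end Nonlinearity

end

section

variable {d : ℕ} {D : SpatialDomain d}

/-! ### The chemical potential and the energy -/

theorem inner_eq_integral_mul (u v : D.H) : ⟪u, v⟫ = ∫ x in D.Ω, u x * v x := by
  rw [L2.inner_def]
  exact integral_congr_ae (ae_of_all _ fun x => mul_comm _ _)

/-- `W = ε A V + f(V)` in weak form, where `ζ = f(V)`. -/
structure IsPotential (ε : ℝ) (f : ℝ → ℝ) (V W : D.H1) (ζ : D.H) : Prop where
  ae_eq : ζ =ᵐ[D.vol] fun x => f (toL2 V x)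
  weak : ∀ φ : D.H1, ⟪toL2 W, toL2 φ⟫ = ε * ⟪grad V, grad φ⟫ + ⟪ζ, toL2 φ⟫

/-- The strong form is traded for a weak identity that survives weak limits. The nonlinear term lies
in `L²` at no cost, being `W - ε A V`; `IsPotential.eulerStep` is the way back. -/
theorem EulerStep.exists_potential {ε : ℝ} {f : ℝ → ℝ} {κ : ℝ} {u v : D.H}
    (h : EulerStep ε f κ u v) : ∃ (V W : D.H1) (ζ : D.H), toL2 V = v ∧ IsPotential ε f V W ζ ∧
      IsA W (-(κ⁻¹ • (v - u))) := by
  obtain ⟨V, W, z, rfl, hz, hw, hW⟩ := h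
  refine ⟨V, W, toL2 W - ε • z, rfl, ⟨?_, fun φ => ?_⟩, hW⟩
  · filter_upwards [hw, Lp.coeFn_sub (toL2 W) (ε • z), Lp.coeFn_smul ε z] with x h1 h2 h3
    rw [h2, Pi.sub_apply, h1, h3, Pi.smul_apply, smul_eq_mul, add_sub_cancel_left]
  · rw [inner_sub_left, real_inner_smul_left, hz φ]
    ring

theorem IsPotential.eulerStep {ε : ℝ} (hε : 0 < ε) {f : ℝ → ℝ} {κ : ℝ} {u : D.H} {V W : D.H1}
    {ζ : D.H} (h : IsPotential ε f V W ζ) (hW : IsA W (-(κ⁻¹ • (toL2 V - u)))) :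
    EulerStep ε f κ u (toL2 V) := by
  refine ⟨V, W, ε⁻¹ • (toL2 W - ζ), rfl, fun φ => ?_, ?_, hW⟩
  · rw [real_inner_smul_left, inner_sub_left, h.weak φ, add_sub_cancel_right,
      inv_mul_cancel_left₀ hε.ne']
  · filter_upwards [h.ae_eq, Lp.coeFn_sub (toL2 W) ζ, Lp.coeFn_smul ε⁻¹ (toL2 W - ζ)]
      with x h1 h2 h3
    rw [h3, Pi.smul_apply, h2, Pi.sub_apply, h1, smul_eq_mul, mul_inv_cancel_left₀ hε.ne',
      sub_add_cancel]

/-- The energy `ε/2 |V|₁² + ∫ (F(V) + c₃)`. -/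
def energy (ε : ℝ) (F : ℝ → ℝ) (c₃ : ℝ) (V : D.H1) : ℝ :=
  ε / 2 * ‖grad V‖ ^ 2 + ∫ x in D.Ω, (F (toL2 V x) + c₃)

section Potential

variable {f F : ℝ → ℝ} {p c₀ c₁ c₃ c : ℝ} {c₂ : ℝ → ℝ} {ε : ℝ}

/-- No Sobolev embedding is needed: coercivity bounds the power by `f(V) V`, a product of two `L²`
functions, up to constants. -/
theorem IsPotential.integrable_pow (hf : IsNonlinearity d f F p c₀ c₁ c₂ c₃ c) {V W : D.H1}
    {ζ : D.H} (h : IsPotential ε f V W ζ) :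
    Integrable (fun x => |toL2 V x| ^ (2 * p)) D.vol := by
  have hp := hf.two_le_p
  have hc₀ := hf.c₀_pos
  have h1 : Integrable (fun x => ζ x * toL2 V x) D.vol :=
    (Lp.memLp ζ).integrable_mul (Lp.memLp (toL2 V))
  have h2 : Integrable (fun x => (p * c₀)⁻¹ * (ζ x * toL2 V x + c₁)) D.vol :=
    (h1.add (integrable_const c₁)).const_mul _
  refine h2.mono' ?_ ?_
  · exact (Real.continuous_rpow_const (by linarith)).comp_aestronglyMeasurable
      (continuous_abs.comp_aestronglyMeasurable (Lp.aestronglyMeasurable (toL2 V)))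
  · filter_upwards [h.ae_eq] with x hx
    rw [Real.norm_of_nonneg (by positivity), hx, le_inv_mul_iff₀ (by positivity)]
    linarith [hf.lower (toL2 V x)]

theorem IsPotential.integrable_F (hf : IsNonlinearity d f F p c₀ c₁ c₂ c₃ c) {V W : D.H1}
    {ζ : D.H} (h : IsPotential ε f V W ζ) :
    Integrable (fun x => F (toL2 V x) + c₃) D.vol := by
  have h1 : Integrable (fun x => 3 / 2 * c₀ * |toL2 V x| ^ (2 * p) + 2 * c₃) D.vol :=
    ((h.integrable_pow hf).const_mul _).add (integrable_const _)
  refine h1.mono' ?_ (ae_of_all _ fun x => ?_)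
  · exact (hf.continuous_F.comp_aestronglyMeasurable (Lp.aestronglyMeasurable (toL2 V))).add
      aestronglyMeasurable_const
  · rw [Real.norm_of_nonneg (hf.F_add_nonneg _)]
    linarith [hf.F_upper (toL2 V x)]

theorem half_semi_sq_le_energy (hf : IsNonlinearity d f F p c₀ c₁ c₂ c₃ c) (V : D.H1) :
    ε / 2 * ‖grad V‖ ^ 2 ≤ energy ε F c₃ V :=
  le_add_of_nonneg_right (integral_nonneg fun _ => hf.F_add_nonneg _)

theorem IsPotential.inner_center_ge (hf : IsNonlinearity d f F p c₀ c₁ c₂ c₃ c) {V W : D.H1}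
    {ζ : D.H} (h : IsPotential ε f V W ζ) {α : ℝ} (hm : |mean (toL2 V)| ≤ α) :
    (∫ x in D.Ω, (F (toL2 V x) + c₃)) - C1 D p c₁ c₂ c₃ α ≤ ⟪ζ, center (toL2 V)⟫ := by
  have hC : C1 D p c₁ c₂ c₃ α = ∫ _ in D.Ω, (c₁ + c₂ ((p - 3 / 2) / α) * α + 2 * c₃) := by
    rw [C1, integral_const, smul_eq_mul, mul_comm]
    simp
  rw [hC, ← integral_sub (h.integrable_F hf) (integrable_const _), inner_eq_integral_mul]
  refine integral_mono_ae ((h.integrable_F hf).sub (integrable_const _))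
    ((Lp.memLp ζ).integrable_mul (Lp.memLp (center (toL2 V)))) ?_
  filter_upwards [h.ae_eq, Lp.coeFn_sub (toL2 V) (Lp.const 2 D.vol (mean (toL2 V))),
    Lp.coeFn_const (p := 2) (μ := D.vol) (mean (toL2 V))] with x h1 h2 h3
  rw [h1, center, h2, Pi.sub_apply, h3]
  exact hf.mul_sub_mean hm _

theorem IsPotential.inner_sub_ge (hf : IsNonlinearity d f F p c₀ c₁ c₂ c₃ c) {V W U : D.H1}
    {ζ : D.H} (h : IsPotential ε f V W ζ)
    (hU : Integrable (fun x => F (toL2 U x) + c₃) D.vol) :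
    (∫ x in D.Ω, (F (toL2 V x) + c₃)) - (∫ x in D.Ω, (F (toL2 U x) + c₃))
      - c / 2 * ‖toL2 V - toL2 U‖ ^ 2 ≤ ⟪ζ, toL2 V - toL2 U⟫ := by
  have hsq : Integrable (fun x => ((toL2 V - toL2 U : D.H) x) ^ 2) D.vol :=
    (Lp.memLp (toL2 V - toL2 U)).integrable_sq
  have hn : ‖toL2 V - toL2 U‖ ^ 2 = ∫ x in D.Ω, ((toL2 V - toL2 U : D.H) x) ^ 2 := by
    rw [norm_Lp_sq]
    simp
  rw [hn, ← integral_const_mul, ← integral_sub (h.integrable_F hf) hU, ← integral_sub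
    (f := fun x => F (toL2 V x) + c₃ - (F (toL2 U x) + c₃)) ((h.integrable_F hf).sub hU)
    (hsq.const_mul _), inner_eq_integral_mul]
  refine integral_mono_ae (((h.integrable_F hf).sub hU).sub (hsq.const_mul _))
    ((Lp.memLp ζ).integrable_mul (Lp.memLp (toL2 V - toL2 U))) ?_
  filter_upwards [h.ae_eq, Lp.coeFn_sub (toL2 V) (toL2 U)] with x h1 h2
  rw [h1, h2, Pi.sub_apply]
  linarith [hf.convexity (toL2 U x) (toL2 V x)]

theorem IsPotential.inner_sub_sub_ge (hf : IsNonlinearity d f F p c₀ c₁ c₂ c₃ c) {V W U W' : D.H1}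
    {ζ ζ' : D.H} (h : IsPotential ε f V W ζ) (h' : IsPotential ε f U W' ζ') :
    -(c * ‖toL2 V - toL2 U‖ ^ 2) ≤ ⟪ζ - ζ', toL2 V - toL2 U⟫ := by
  have hsq : Integrable (fun x => ((toL2 V - toL2 U : D.H) x) ^ 2) D.vol :=
    (Lp.memLp (toL2 V - toL2 U)).integrable_sq
  have hn : ‖toL2 V - toL2 U‖ ^ 2 = ∫ x in D.Ω, ((toL2 V - toL2 U : D.H) x) ^ 2 := by
    rw [norm_Lp_sq]
    simp
  rw [hn, ← integral_const_mul, ← integral_neg, inner_eq_integral_mul]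
  refine integral_mono_ae (hsq.const_mul _).neg
    ((Lp.memLp (ζ - ζ')).integrable_mul (Lp.memLp (toL2 V - toL2 U))) ?_
  filter_upwards [h.ae_eq, h'.ae_eq, Lp.coeFn_sub (toL2 V) (toL2 U), Lp.coeFn_sub ζ ζ']
    with x h1 h2 h3 h4
  rw [h4, h3, Pi.sub_apply, Pi.sub_apply, h1, h2]
  exact hf.sub_mul_sub _ _

/-! ### Estimates for one step of the scheme -/

theorem mean_eq_of_step {κ : ℝ} (hκ : 0 < κ) {u v : D.H} {W : D.H1}
    (hW : IsA W (-(κ⁻¹ • (v - u)))) : mean v = mean u := by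
  have h := hW.inner_one
  rw [inner_neg_left, real_inner_smul_left, neg_eq_zero, mul_eq_zero,
    or_iff_right (inv_ne_zero hκ.ne'), ← mean_eq_zero_iff, mean_sub, sub_eq_zero] at h
  exact h

theorem inner_step {κ : ℝ} (hκ : 0 < κ) {q : D.H} {W : D.H1} (hW : IsA W (-(κ⁻¹ • q)))
    (φ : D.H1) : ⟪q, toL2 φ⟫ = -(κ * ⟪grad W, grad φ⟫) := by
  rw [hW φ, inner_neg_left, real_inner_smul_left, mul_neg, mul_inv_cancel_left₀ hκ.ne', neg_neg]

/-- The step is tested with `N = A⁻¹ V̄`, which turns `A W` into `⟪W, V̄⟫ = ε |V|₁² + ⟪ζ, V̄⟫`. The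
old iterate enters through its dual norm only, so it needs no `H¹` regularity. -/
theorem IsPotential.dual_estimate (hf : IsNonlinearity d f F p c₀ c₁ c₂ c₃ c) (hε : 0 < ε)
    {κ α : ℝ} (hκ : 0 < κ) {u : D.H} {V W : D.H1} {ζ : D.H} (h : IsPotential ε f V W ζ)
    (hW : IsA W (-(κ⁻¹ • (toL2 V - u)))) (hm : |mean (toL2 V)| ≤ α) {N M : D.H1}
    (hN : IsA N (center (toL2 V))) (hM : IsA M (center u)) :
    ‖grad N‖ ^ 2 + 2 * κ * energy ε F c₃ V ≤ ‖grad M‖ ^ 2 + 2 * κ * C1 D p c₁ c₂ c₃ α := by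
  have hmean := mean_eq_of_step hκ hW
  have h1 : ⟪grad (N - M), grad N⟫ = ⟪toL2 V - u, toL2 N⟫ := by
    rw [(hN.sub hM) N, center_eq, center_eq, hmean, sub_sub_sub_cancel_right]
  rw [inner_step hκ hW, real_inner_comm (grad N) (grad W), hN W] at h1
  obtain ⟨w, hw1, hw2⟩ := exists_centerH1 V
  have h2 := h.weak w
  rw [hw1, hw2, real_inner_self_eq_norm_sq, real_inner_comm] at h2
  rw [h2, grad_sub, inner_sub_left, real_inner_self_eq_norm_sq] at h1
  have h3 := h.inner_center_ge hf hm
  have h4 : ⟪grad M, grad N⟫ ≤ ‖grad N‖ ^ 2 / 2 + ‖grad M‖ ^ 2 / 2 := by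
    have := real_inner_le_norm (grad M) (grad N)
    nlinarith [sq_nonneg (‖grad M‖ - ‖grad N‖)]
  have h5 : energy ε F c₃ V - C1 D p c₁ c₂ c₃ α ≤ ε * ‖grad V‖ ^ 2 + ⟪ζ, center (toL2 V)⟫ := by
    rw [energy]
    have : 0 ≤ ε / 2 * ‖grad V‖ ^ 2 := by positivity
    linarith
  have h6 := mul_le_mul_of_nonneg_left h5 hκ.le
  linarith

/-- The equation for `W` is tested with `V - U`. The non-convex loss `c/2 ‖V - U‖²` is interpolated
by testing the step itself: `‖V - U‖² = -κ ⟪∇W, ∇(V - U)⟫`. -/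
theorem IsPotential.energy_estimate (hf : IsNonlinearity d f F p c₀ c₁ c₂ c₃ c)
    {κ : ℝ} (hκ : 0 < κ) {U V W : D.H1} {ζ : D.H} (h : IsPotential ε f V W ζ)
    (hW : IsA W (-(κ⁻¹ • (toL2 V - toL2 U))))
    (hU : Integrable (fun x => F (toL2 U x) + c₃) D.vol) :
    energy ε F c₃ V + κ * ‖grad W‖ ^ 2 + ε / 2 * ‖grad (V - U)‖ ^ 2
      ≤ energy ε F c₃ U + c * κ / 2 * (‖grad W‖ * ‖grad (V - U)‖) := by
  have h1 := h.weak (V - U)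
  have h2 := inner_step hκ hW W
  have h3 := inner_step hκ hW (V - U)
  rw [toL2_sub, real_inner_comm, h2, real_inner_self_eq_norm_sq] at h1
  rw [toL2_sub, real_inner_self_eq_norm_sq] at h3
  have h4 := h.inner_sub_ge hf hU
  have h5 : ⟪grad V, grad (V - U)⟫
      = (‖grad V‖ ^ 2 - ‖grad U‖ ^ 2 + ‖grad (V - U)‖ ^ 2) / 2 := by
    rw [grad_sub, @norm_sub_sq_real, inner_sub_right, real_inner_self_eq_norm_sq]
    ring
  have h6 : -⟪grad W, grad (V - U)⟫ ≤ ‖grad W‖ * ‖grad (V - U)‖ :=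
    (neg_le_abs _).trans (abs_real_inner_le_norm _ _)
  have h7 : c / 2 * ‖toL2 V - toL2 U‖ ^ 2 ≤ c * κ / 2 * (‖grad W‖ * ‖grad (V - U)‖) := by
    rw [h3]
    have : 0 ≤ c * κ / 2 := by have := hf.c_pos; positivity
    nlinarith [mul_le_mul_of_nonneg_left h6 this]
  rw [h5] at h1
  rw [energy, energy]
  nlinarith

/-- With `X = |V - U|₁` and `Y = |W|₁`, the form `κ Y² + ε/2 X² - cκ/2 X Y` is non-negative exactly
when `c² κ ≤ 8ε`. -/
theorem IsPotential.energy_le (hf : IsNonlinearity d f F p c₀ c₁ c₂ c₃ c) (hε : 0 < ε)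
    {κ : ℝ} (hκ : 0 < κ) (hκ' : κ ≤ 8 * ε / c ^ 2) {U V W : D.H1} {ζ : D.H}
    (h : IsPotential ε f V W ζ) (hW : IsA W (-(κ⁻¹ • (toL2 V - toL2 U))))
    (hU : Integrable (fun x => F (toL2 U x) + c₃) D.vol) :
    energy ε F c₃ V ≤ energy ε F c₃ U := by
  have h1 := h.energy_estimate hf hκ hW hU
  have hc := hf.c_pos
  rw [le_div_iff₀ (by positivity)] at hκ'
  set X := ‖grad (V - U)‖
  set Y := ‖grad W‖
  have h2 : κ * (κ * c ^ 2) * Y ^ 2 ≤ κ * (8 * ε) * Y ^ 2 := by gcongr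
  have h3 := sq_nonneg (2 * ε * X - c * κ * Y)
  have h4 : 0 ≤ ε * (κ * Y ^ 2 + ε / 2 * X ^ 2 - c * κ / 2 * (Y * X)) := by nlinarith
  have h5 := nonneg_of_mul_nonneg_right h4 hε
  linarith

/-- Half of the dissipation is kept, which halves the admissible step size. -/
theorem IsPotential.energy_le' (hf : IsNonlinearity d f F p c₀ c₁ c₂ c₃ c) (hε : 0 < ε)
    {κ : ℝ} (hκ : 0 < κ) (hκ' : κ ≤ 4 * ε / c ^ 2) {U V W : D.H1} {ζ : D.H}
    (h : IsPotential ε f V W ζ) (hW : IsA W (-(κ⁻¹ • (toL2 V - toL2 U))))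
    (hU : Integrable (fun x => F (toL2 U x) + c₃) D.vol) :
    energy ε F c₃ V + κ / 2 * ‖grad W‖ ^ 2 ≤ energy ε F c₃ U := by
  have h1 := h.energy_estimate hf hκ hW hU
  have hc := hf.c_pos
  rw [le_div_iff₀ (by positivity)] at hκ'
  set X := ‖grad (V - U)‖
  set Y := ‖grad W‖
  have h2 : κ * (κ * c ^ 2) * Y ^ 2 ≤ κ * (4 * ε) * Y ^ 2 := by gcongr
  have h3 := sq_nonneg (2 * ε * X - c * κ * Y)
  have h4 : 0 ≤ ε * (κ / 2 * Y ^ 2 + ε / 2 * X ^ 2 - c * κ / 2 * (Y * X)) := by nlinarith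
  have h5 := nonneg_of_mul_nonneg_right h4 hε
  linarith

/-- Growth control for the potential. The difference of the equations for `W` and `W'` is tested
with `V - U`, the non-monotone part of `f` costs `cκ X Y`, and maximizing `cκ X Y - ε X²` over `X`
gives the constant. -/
theorem IsPotential.grad_sq_le (hf : IsNonlinearity d f F p c₀ c₁ c₂ c₃ c) (hε : 0 < ε)
    {κ : ℝ} (hκ : 0 < κ) {U V W W' : D.H1} {ζ ζ' : D.H}
    (h : IsPotential ε f V W ζ) (hW : IsA W (-(κ⁻¹ • (toL2 V - toL2 U))))
    (h' : IsPotential ε f U W' ζ') :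
    ‖grad W‖ ^ 2 ≤ ‖grad W'‖ ^ 2 + c ^ 2 / (2 * ε) * κ * ‖grad W‖ ^ 2 := by
  have hc := hf.c_pos
  have h1 := h.weak (V - U)
  have h2 := h'.weak (V - U)
  have h3 := inner_step hκ hW W
  have h4 := inner_step hκ hW W'
  have h5 := inner_step hκ hW (V - U)
  have h6 := h.inner_sub_sub_ge hf h'
  have h7 : ⟪grad V, grad (V - U)⟫ - ⟪grad U, grad (V - U)⟫ = ‖grad (V - U)‖ ^ 2 := by
    rw [← inner_sub_left, ← grad_sub, real_inner_self_eq_norm_sq]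
  rw [toL2_sub, real_inner_comm, h3, real_inner_self_eq_norm_sq] at h1
  rw [toL2_sub, real_inner_comm, h4] at h2
  rw [toL2_sub, real_inner_self_eq_norm_sq] at h5
  rw [inner_sub_left] at h6
  have h8 : -⟪grad W, grad (V - U)⟫ ≤ ‖grad W‖ * ‖grad (V - U)‖ :=
    (neg_le_abs _).trans (abs_real_inner_le_norm _ _)
  have h9 := real_inner_le_norm (grad W) (grad W')
  set X := ‖grad (V - U)‖
  set Y := ‖grad W‖
  set Z := ‖grad W'‖
  rw [h5] at h6
  have h10 : κ * (Y ^ 2 - Y * Z) ≤ c * κ * (Y * X) - ε * X ^ 2 := by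
    have e1 := mul_le_mul_of_nonneg_left h8 (mul_nonneg hc.le hκ.le)
    have e2 := mul_le_mul_of_nonneg_left h9 hκ.le
    nlinarith
  have h11 : c * κ * (Y * X) - ε * X ^ 2 ≤ κ * (c ^ 2 / (4 * ε) * κ * Y ^ 2) := by
    have e : κ * (c ^ 2 / (4 * ε) * κ * Y ^ 2) - (c * κ * (Y * X) - ε * X ^ 2)
        = (2 * ε * X - c * κ * Y) ^ 2 / (4 * ε) := by
      field_simp
      ring
    have : 0 ≤ (2 * ε * X - c * κ * Y) ^ 2 / (4 * ε) := by positivity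
    linarith
  have h12 := le_of_mul_le_mul_left (h10.trans h11) hκ
  have h13 : c ^ 2 / (2 * ε) * κ * Y ^ 2 = 2 * (c ^ 2 / (4 * ε) * κ * Y ^ 2) := by
    field_simp
    ring
  rw [h13]
  nlinarith [sq_nonneg (Y - Z)]

/-- The potential solves `A W = -(V - U)/κ`, so it is under control as soon as `κ` is not small. -/
theorem norm_grad_le_of_step {C : ℝ} (hC : IsPoincareConst D C) {κ : ℝ} (hκ : 0 < κ)
    {U V W : D.H1} (hW : IsA W (-(κ⁻¹ • (toL2 V - toL2 U)))) :
    ‖grad W‖ ≤ κ⁻¹ * (C ^ 2 * (‖grad V‖ + ‖grad U‖)) := by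
  have hm : mean (toL2 V - toL2 U) = 0 := by
    rw [mean_sub, mean_eq_of_step hκ hW, sub_self]
  have hm' : mean (-(κ⁻¹ • (toL2 V - toL2 U))) = 0 := by
    rw [mean_eq_zero_iff, hW.inner_one]
  have h1 := hW.norm_grad_le_mul hC hm'
  rw [norm_neg, norm_smul, Real.norm_of_nonneg (inv_nonneg.2 hκ.le), ← toL2_sub] at h1
  have h2 := hC.2 (V - U) (by rw [toL2_sub, hm])
  have h3 : ‖grad (V - U)‖ ≤ ‖grad V‖ + ‖grad U‖ := by rw [grad_sub]; exact norm_sub_le _ _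
  have h4 := hC.1
  calc ‖grad W‖ ≤ C * (κ⁻¹ * ‖toL2 (V - U)‖) := h1
    _ ≤ C * (κ⁻¹ * (C * (‖grad V‖ + ‖grad U‖))) := by gcongr; exact h2.trans (by gcongr)
    _ = _ := by ring

end Potential

end

section

variable {d : ℕ} {D : SpatialDomain d}

/-! ### Estimates along a trajectory -/

theorem TimeGrid.step_pos (J : TimeGrid) (n : ℕ) : 0 < J.step n :=
  sub_pos.2 (J.strictMono n.lt_succ_self)

theorem TimeGrid.t_nonneg (J : TimeGrid) (n : ℕ) : 0 ≤ J.t n :=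
  J.zero ▸ J.strictMono.monotone n.zero_le

theorem TimeGrid.t_succ_pos (J : TimeGrid) (n : ℕ) : 0 < J.t (n + 1) :=
  (J.t_nonneg n).trans_lt (J.strictMono n.lt_succ_self)

theorem TimeGrid.t_succ (J : TimeGrid) (n : ℕ) : J.t (n + 1) = J.t n + J.step n :=
  (add_sub_cancel _ _).symm

section Trajectory

variable {f F : ℝ → ℝ} {p c₀ c₁ c₃ c : ℝ} {c₂ : ℝ → ℝ} {ε α : ℝ}

/-- `V`, `W`, `ζ` are the `H¹` functions, the potentials and the nonlinear terms of the first `n`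
steps of the trajectory `u`. -/
def IsLift (ε : ℝ) (f : ℝ → ℝ) (J : TimeGrid) (n : ℕ) (u : ℕ → D.H) (V W : ℕ → D.H1)
    (ζ : ℕ → D.H) : Prop :=
  ∀ j < n, toL2 (V j) = u (j + 1) ∧ IsPotential ε f (V j) (W j) (ζ j) ∧
    IsA (W j) (-((J.step j)⁻¹ • (u (j + 1) - u j)))

theorem exists_isLift {J : TimeGrid} {n : ℕ} {u : ℕ → D.H}
    (hu : ∀ j < n, EulerStep ε f (J.step j) (u j) (u (j + 1))) :
    ∃ V W ζ, IsLift ε f J n u V W ζ := by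
  choose! V W ζ h using fun j hj => (hu j hj).exists_potential
  exact ⟨V, W, ζ, h⟩

theorem mean_trajectory {J : TimeGrid} {n : ℕ} {u : ℕ → D.H}
    (hu : ∀ j < n, EulerStep ε f (J.step j) (u j) (u (j + 1))) :
    ∀ j ≤ n, mean (u j) = mean (u 0) := by
  intro j
  induction j with
  | zero => exact fun _ => rfl
  | succ j ih =>
    intro hj
    obtain ⟨V, W, ζ, -, -, hW⟩ := (hu j hj).exists_potential
    rw [mean_eq_of_step (J.step_pos j) hW, ih (by omega)]

variable (hf : IsNonlinearity d f F p c₀ c₁ c₂ c₃ c) (hε : 0 < ε) {J : TimeGrid}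
  {n : ℕ} {u : ℕ → D.H} {V W : ℕ → D.H1} {ζ : ℕ → D.H}
  (hL : IsLift ε f J n u V W ζ)

include hf hε hL

theorem IsLift.energy_succ_le (hJ : ∀ n, J.step n ≤ 8 * ε / c ^ 2) {j : ℕ} (hj : j + 1 < n) :
    energy ε F c₃ (V (j + 1)) ≤ energy ε F c₃ (V j) := by
  obtain ⟨h1, h2, -⟩ := hL j (by omega)
  obtain ⟨h4, h5, h6⟩ := hL (j + 1) hj
  rw [← h1, ← h4] at h6
  exact h5.energy_le hf hε (J.step_pos _) (hJ _) h6 (h2.integrable_F hf)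

/-- Discrete form of differentiating `|·|₋₁² + 2 t E`: the new step contributes `2κ` times the new
energy, and for the time already elapsed the old energy may be replaced by the smaller new one. -/
theorem IsLift.energy_mul_le (hJ : ∀ n, J.step n ≤ 8 * ε / c ^ 2) 
    (hm : ∀ j ≤ n, |mean (u j)| ≤ α) {M : D.H1}
    (hM : IsA M (center (u 0))) {j : ℕ} (hj : j < n) {N : D.H1}
    (hN : IsA N (center (u (j + 1)))) :
    ‖grad N‖ ^ 2 + 2 * J.t (j + 1) * energy ε F c₃ (V j) ≤
      ‖grad M‖ ^ 2 + 2 * J.t (j + 1) * C1 D p c₁ c₂ c₃ α := by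
  induction j generalizing N with
  | zero =>
    obtain ⟨h1, h2, h3⟩ := hL 0 hj
    rw [← h1] at h3 hN
    -- As `t⁰ = 0`, the energy of the initial value carries no weight and may be infinite.
    rw [J.t_succ, J.zero, zero_add]
    exact h2.dual_estimate hf hε (J.step_pos 0) h3 (h1 ▸ hm _ hj) hN hM
  | succ j ih =>
    obtain ⟨N', hN'⟩ := exists_isA (mean_center (u (j + 1)))
    have h0 := ih (by omega) hN'
    obtain ⟨h1, h2, h3⟩ := hL (j + 1) hj
    rw [← h1] at h3 hN
    have h4 := h2.dual_estimate hf hε (J.step_pos _) h3 (h1 ▸ hm _ hj) hN hN'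
    have h5 := mul_le_mul_of_nonneg_left (hL.energy_succ_le hf hε hJ hj) (J.t_succ_pos j).le
    rw [J.t_succ (j + 1)]
    linarith

theorem IsLift.energy_le (hJ : ∀ n, J.step n ≤ 8 * ε / c ^ 2) 
    (hm : ∀ j ≤ n, |mean (u j)| ≤ α) {R : ℝ}
    (hR : dualNorm (center (u 0)) ≤ ENNReal.ofReal R) {j : ℕ} (hj : j < n) :
    energy ε F c₃ (V j) ≤ C1 D p c₁ c₂ c₃ α + R ^ 2 / (2 * J.t (j + 1)) := by
  obtain ⟨M, hM⟩ := exists_isA (mean_center (u 0))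
  obtain ⟨N, hN⟩ := exists_isA (mean_center (u (j + 1)))
  have h1 := hL.energy_mul_le hf hε hJ hm hM hj hN
  have h2 := hM.norm_grad_le_of_dualNorm_le hR
  have ht := J.t_succ_pos j
  have h3 : ‖grad M‖ ^ 2 ≤ R ^ 2 := by
    rcases le_total R 0 with h | h
    · rw [max_eq_right h] at h2
      have : ‖grad M‖ = 0 := le_antisymm h2 (norm_nonneg _)
      rw [this, zero_pow two_ne_zero]
      positivity
    · rw [max_eq_left h] at h2
      gcongr
  have h4 : 0 ≤ ‖grad N‖ ^ 2 := by positivity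
  rw [← sub_le_iff_le_add', le_div_iff₀ (by positivity)]
  linarith

/-- Smoothing estimate. The weight `min (t - t_N) 1` starts at zero, so no bound on the first
potential is needed. On small steps the sum on the left does not increase: the growth of the weight
and of the potential costs at most `(1 + c²/(2ε)) κ |W|₁²`, which the energy dissipation pays. -/
theorem IsLift.norm_grad_potential_sq_le {C E : ℝ} (hC : IsPoincareConst D C) {N : ℕ}
    (hE : ∀ j, N ≤ j → j < n → energy ε F c₃ (V j) ≤ E) {j : ℕ} (hNj : N ≤ j) (hj : j < n) :
    min (J.t (j + 1) - J.t (N + 1)) 1 * ‖grad (W j)‖ ^ 2 +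
        2 * (1 + c ^ 2 / (2 * ε)) * energy ε F c₃ (V j) ≤
      (c ^ 2 / (4 * ε) * (C ^ 2 * (2 * √(2 / ε * E)))) ^ 2 + 2 * (1 + c ^ 2 / (2 * ε)) * E := by
  have hc := hf.c_pos
  have hs : ∀ j, N ≤ j → j < n → ‖grad (V j)‖ ≤ √(2 / ε * E) := by
    intro j h1 h2
    refine Real.le_sqrt_of_sq_le ?_
    have h3 := half_semi_sq_le_energy (ε := ε) hf (V j)
    have h4 : ‖grad (V j)‖ ^ 2 = 2 / ε * (ε / 2 * ‖grad (V j)‖ ^ 2) := by field_simp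
    rw [h4]
    have := hE j h1 h2
    gcongr
    linarith
  induction j, hNj using Nat.le_induction with
  | base =>
    rw [sub_self, min_eq_left zero_le_one, zero_mul, zero_add]
    have := hE N le_rfl hj
    have h2 : 2 * (1 + c ^ 2 / (2 * ε)) * energy ε F c₃ (V N) ≤ 2 * (1 + c ^ 2 / (2 * ε)) * E := by
      gcongr
    exact h2.trans (le_add_of_nonneg_left (sq_nonneg _))
  | succ j hNj ih =>
    have ih := ih (by omega)
    obtain ⟨h1, h2, h3⟩ := hL j (by omega)
    obtain ⟨h4, h5, h6⟩ := hL (j + 1) hj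
    rw [← h1, ← h4] at h6
    have hκ := J.step_pos (j + 1)
    have hE' := hE (j + 1) (by omega) hj
    have ht := J.t_succ (j + 1)
    have htm : J.t (N + 1) ≤ J.t (j + 1) := J.strictMono.monotone (by omega)
    set κ := J.step (j + 1)
    rw [ht]
    by_cases hcase : κ ≤ 4 * ε / c ^ 2
    · have h7 := h5.energy_le' hf hε hκ hcase h6 (h2.integrable_F hf)
      have h8 := h5.grad_sq_le hf hε hκ h6 h2
      set θ := min (J.t (j + 1) - J.t (N + 1)) 1 with hθ
      have hθ0 : 0 ≤ θ := le_min (by linarith) zero_le_one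
      have hθ1 : θ ≤ 1 := min_le_right _ _
      have hθ' : min (J.t (j + 1) + κ - J.t (N + 1)) 1 ≤ θ + κ := by
        rcases min_choice (J.t (j + 1) - J.t (N + 1)) 1 with h | h
        · rw [hθ, h]
          exact (min_le_left _ _).trans (by linarith)
        · rw [hθ, h]
          exact (min_le_right _ _).trans (by linarith)
      set A := ‖grad (W (j + 1))‖ ^ 2
      have hA : 0 ≤ A := sq_nonneg _
      set B := c ^ 2 / (2 * ε)
      have hB : 0 ≤ B := by positivity
      have e1 := mul_le_mul_of_nonneg_right hθ' hA
      have e2 := mul_le_mul_of_nonneg_left h8 hθ0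
      have e3 := mul_le_mul_of_nonneg_left h7 (by positivity : 0 ≤ 2 * (1 + B))
      have e4 := mul_le_mul_of_nonneg_right hθ1 (by positivity : 0 ≤ B * κ * A)
      linarith
    -- On a step longer than `4ε/c²` the weighted sum need not decrease, but `κ⁻¹` is bounded and
    -- the potential is estimated directly.
    · push Not at hcase
      have h7 := norm_grad_le_of_step hC hκ h6
      have h8 := hs j hNj (by omega)
      have h9 := hs (j + 1) (by omega) hj
      have h10 : κ⁻¹ ≤ c ^ 2 / (4 * ε) := by
        rw [← inv_div]
        exact inv_anti₀ (by positivity) hcase.le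
      have h11 : ‖grad (W (j + 1))‖ ≤ c ^ 2 / (4 * ε) * (C ^ 2 * (2 * √(2 / ε * E))) := by
        refine h7.trans ?_
        gcongr
        linarith
      have h12 : min (J.t (j + 1) + κ - J.t (N + 1)) 1 * ‖grad (W (j + 1))‖ ^ 2 ≤
          (c ^ 2 / (4 * ε) * (C ^ 2 * (2 * √(2 / ε * E)))) ^ 2 := by
        calc _ ≤ 1 * ‖grad (W (j + 1))‖ ^ 2 := by gcongr; exact min_le_right _ _
          _ ≤ _ := by rw [one_mul]; gcongr
      gcongr

end Trajectory

/-! ### Absorbing sets. -/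

section Bounds

variable {f F : ℝ → ℝ} {p c₀ c₁ c₃ c : ℝ} {c₂ : ℝ → ℝ} {ε α : ℝ}

theorem rho0_pos {C γ : ℝ} (hε : 0 < ε) (hC : 0 < C) (hc : 0 < c) : 0 < rho0 C γ ε c := by
  unfold rho0
  positivity

/-- The seminorm of `H¹` is eventually bounded by `ρ̂₁`. -/
theorem exists_semi1_le (hf : IsNonlinearity d f F p c₀ c₁ c₂ c₃ c) (hε : 0 < ε)
    (hC : 0 < C1 D p c₁ c₂ c₃ α) (γ : ℝ) {J : TimeGrid} (hJ : ∀ n, J.step n ≤ 8 * ε / c ^ 2)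
    (R : ℝ) {r : ℝ} (hr : 0 < r) :
    ∃ n₁ : ℕ, 1 ≤ n₁ ∧ ∀ n ≥ n₁, ∀ u : ℕ → D.H,
      (∀ j < n, EulerStep ε f (J.step j) (u j) (u (j + 1))) →
      dualNorm (center (u 0)) ≤ ENNReal.ofReal R → |mean (u 0)| ≤ α →
      ∃ v : D.H1, toL2 v = u n ∧ v ∈ calH1 D α ∧
        semi1 v ≤ rho1 (C1 D p c₁ c₂ c₃ α) γ ε c r := by
  have hρ := rho0_pos (γ := γ) hε hC hf.c_pos
  -- From this time on, the decaying part `R²/(ε t)` is below the surplus `(2ρ̂₀)²/(rε)` in the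
  -- square of `ρ̂₁`.
  obtain ⟨N, hN⟩ := eventually_atTop.1 (J.tendsto.eventually_ge_atTop
    (R ^ 2 * r / (2 * rho0 (C1 D p c₁ c₂ c₃ α) γ ε c) ^ 2))
  refine ⟨N + 1, by omega, fun n hn u hu hR hm => ?_⟩
  obtain ⟨j, rfl⟩ : ∃ j, n = j + 1 := ⟨n - 1, by omega⟩
  obtain ⟨V, W, ζ, hL⟩ := exists_isLift hu
  have hmean := mean_trajectory hu
  have hm' : ∀ i ≤ j + 1, |mean (u i)| ≤ α := fun i hi => by rw [hmean i hi]; exact hm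
  obtain ⟨h1, -, -⟩ := hL j (by omega)
  refine ⟨V j, h1, ?_, ?_⟩
  · rw [calH1, Set.mem_ofPred_eq, h1]
    exact hm' _ le_rfl
  have h2 := hL.energy_le hf hε hJ hm' hR (Nat.lt_succ_self j)
  have h3 := half_semi_sq_le_energy (ε := ε) hf (V j)
  have h4 := hN (j + 1) (by omega)
  have ht := J.t_succ_pos j
  rw [div_le_iff₀ (by positivity)] at h4
  refine Real.le_sqrt_of_sq_le ?_
  have h5 : R ^ 2 / (ε * J.t (j + 1)) ≤
      (2 * rho0 (C1 D p c₁ c₂ c₃ α) γ ε c) ^ 2 / (r * ε) := by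
    rw [div_le_div_iff₀ (by positivity) (by positivity)]
    have := mul_le_mul_of_nonneg_right h4 hε.le
    linarith
  calc ‖grad (V j)‖ ^ 2 = 2 / ε * (ε / 2 * ‖grad (V j)‖ ^ 2) := by field_simp
    _ ≤ 2 / ε * (C1 D p c₁ c₂ c₃ α + R ^ 2 / (2 * J.t (j + 1))) := by gcongr; linarith
    _ = 2 / ε * C1 D p c₁ c₂ c₃ α + R ^ 2 / (ε * J.t (j + 1)) := by field_simp
    _ ≤ _ := by linarith

/-- The set of those elements of `ℋ¹_α` whose seminorm and whose potential are bounded by `M`. -/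
def regularSet (D : SpatialDomain d) (ε : ℝ) (f : ℝ → ℝ) (α M : ℝ) : Set D.H1 :=
  {V | V ∈ calH1 D α ∧ ‖grad V‖ ≤ M ∧ ∃ (W : D.H1) (ζ : D.H), IsPotential ε f V W ζ ∧ ‖grad W‖ ≤ M}

/-- A regular set absorbs all bounded sets, on every time grid. -/
theorem exists_isAbsorbing_regularSet (hf : IsNonlinearity d f F p c₀ c₁ c₂ c₃ c) (hε : 0 < ε) :
    ∃ M : ℝ, ∀ J : TimeGrid, (∀ n, J.step n ≤ 8 * ε / c ^ 2) →
      IsAbsorbing ε f α J (regularSet D ε f α M) := by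
  obtain ⟨C, hC⟩ := exists_poincare D
  have hC : IsPoincareConst D C := hC
  set E := C1 D p c₁ c₂ c₃ α + 1 with hE
  set M₁ := (c ^ 2 / (4 * ε) * (C ^ 2 * (2 * √(2 / ε * E)))) ^ 2 + 2 * (1 + c ^ 2 / (2 * ε)) * E
    with hM₁
  refine ⟨max (√(2 / ε * E)) (√M₁), fun J hJ B hB => ?_⟩
  obtain ⟨hBα, R, hBR⟩ := hB
  -- After `N` the term `R²/(2t)` is at most `1`, so the energy is below `E`; one more unit of time,
  -- up to `N'`, makes the weight of the smoothing estimate equal to `1`.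
  obtain ⟨N, hN⟩ := eventually_atTop.1 (J.tendsto.eventually_ge_atTop (R ^ 2 / 2))
  obtain ⟨N', hN'⟩ := eventually_atTop.1 (J.tendsto.eventually_ge_atTop (J.t (N + 1) + 1))
  refine ⟨max N N' + 1, fun n hn => ?_⟩
  rintro _ ⟨u, hu0, hu, rfl⟩
  obtain ⟨j, rfl⟩ : ∃ j, n = j + 1 := ⟨n - 1, by omega⟩
  obtain ⟨V, W, ζ, hL⟩ := exists_isLift hu
  have hmean := mean_trajectory hu
  have hm' : ∀ i ≤ j + 1, |mean (u i)| ≤ α := fun i hi => by rw [hmean i hi]; exact hBα _ hu0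
  have hE' : ∀ i, N ≤ i → i < j + 1 → energy ε F c₃ (V i) ≤ E := by
    intro i hNi hi
    refine (hL.energy_le hf hε hJ hm' (hBR _ hu0) hi).trans ?_
    have h1 := hN (i + 1) (by omega)
    have ht := J.t_succ_pos i
    rw [hE]
    gcongr
    rw [div_le_one (by positivity)]
    linarith
  obtain ⟨h1, h2, -⟩ := hL j (by omega)
  have hNj : N ≤ j := by omega
  have h3 := hL.norm_grad_potential_sq_le hf hε hC hE' hNj (by omega)
  have h4 := hN' (j + 1) (by omega)
  rw [min_eq_right (by linarith), one_mul, ← hM₁] at h3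
  have h5 := half_semi_sq_le_energy (ε := ε) hf (V j)
  have h6 : 0 ≤ ε / 2 * ‖grad (V j)‖ ^ 2 := by positivity
  have h7 := hE' j hNj (by omega)
  refine ⟨V j, ⟨?_, ?_, W j, ζ j, h2, ?_⟩, h1⟩
  · rw [calH1, Set.mem_ofPred_eq, h1]
    exact hm' _ le_rfl
  · refine (Real.le_sqrt_of_sq_le ?_).trans (le_max_left _ _)
    calc ‖grad (V j)‖ ^ 2 = 2 / ε * (ε / 2 * ‖grad (V j)‖ ^ 2) := by field_simp
      _ ≤ _ := by gcongr; linarith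
  · refine (Real.le_sqrt_of_sq_le ?_).trans (le_max_right _ _)
    have : 0 ≤ 2 * (1 + c ^ 2 / (2 * ε)) * energy ε F c₃ (V j) := by
      have := h6.trans h5
      positivity
    linarith

end Bounds

end

section

variable {d : ℕ} {D : SpatialDomain d}

/-! ### Weak limits of potentials -/

/-- If `f(vⱼ)` converges weakly in `L²` and `vⱼ` converges strongly in `L²`, then the limits are
related in the same way. -/
theorem ae_eq_of_weakly_tendsto {f : ℝ → ℝ} (hf : Continuous f) {v ζ : ℕ → D.H} {a ζ' : D.H}
    (h : ∀ j, ζ j =ᵐ[D.vol] fun x => f (v j x)) (hv : Tendsto v atTop (𝓝 a))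
    (hζ : ∀ y, Tendsto (fun j => ⟪ζ j, y⟫) atTop (𝓝 ⟪ζ', y⟫)) :
    ζ' =ᵐ[D.vol] fun x => f (a x) := by
  obtain ⟨φ, hφ, hae⟩ := (tendstoInMeasure_of_tendsto_Lp hv).exists_seq_tendsto_ae
  have hmeas : ∀ u : D.H, Measurable fun x => f (u x) := fun u =>
    hf.measurable.comp (Lp.stronglyMeasurable u).measurable
  -- On each `G m` dominated convergence identifies the weak limit. Convergent sequences are
  -- bounded, so these sets exhaust almost all of `Ω`.
  set G : ℕ → Set (Space d) := fun m => {x | ∀ j, |f (v (φ j) x)| ≤ m} with hG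
  have hGm : ∀ m, MeasurableSet (G m) := by
    intro m
    have : G m = ⋂ j, {x | |f (v (φ j) x)| ≤ m} := by ext x; simp [hG]
    rw [this]
    exact MeasurableSet.iInter fun j =>
      measurableSet_le (measurable_norm.comp (hmeas _)) measurable_const
  have hlim : ∀ᵐ x ∂D.vol, Tendsto (fun j => f (v (φ j) x)) atTop (𝓝 (f (a x))) := by
    filter_upwards [hae] with x hx using (hf.tendsto _).comp hx
  have key : ∀ m, ζ' =ᵐ[D.vol.restrict (G m)] fun x => f (a x) := by
    intro m
    have hb : ∀ᵐ x ∂D.vol.restrict (G m), ‖f (a x)‖ ≤ m := by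
      filter_upwards [ae_restrict_of_ae hlim, ae_restrict_mem (hGm m)] with x hx hxm
      exact le_of_tendsto hx.norm (Eventually.of_forall fun j => hxm j)
    refine Integrable.ae_eq_of_forall_setIntegral_eq _ _ ?_ ?_ fun E hE _ => ?_
    · exact ((Lp.memLp ζ').integrable one_le_two).restrict
    · exact Integrable.of_bound (hmeas a).aestronglyMeasurable m hb
    · rw [Measure.restrict_restrict hE]
      have hEG := hE.inter (hGm m)
      have hfin : D.vol (E ∩ G m) ≠ ⊤ := measure_ne_top _ _
      have h1 := (hζ (indicatorConstLp 2 hEG hfin (1 : ℝ))).comp hφ.tendsto_atTop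
      have h2 : ∀ u : D.H, ⟪u, indicatorConstLp 2 hEG hfin (1 : ℝ)⟫ = ∫ x in E ∩ G m, u x ∂D.vol :=
        fun u => by rw [real_inner_comm, L2.inner_indicatorConstLp_one]
      simp only [Function.comp_def, h2] at h1
      refine tendsto_nhds_unique h1 ?_
      have h3 : ∀ j, ∫ x in E ∩ G m, ζ (φ j) x ∂D.vol = ∫ x in E ∩ G m, f (v (φ j) x) ∂D.vol :=
        fun j => integral_congr_ae (ae_restrict_of_ae (h (φ j)))
      simp only [h3]
      refine tendsto_integral_of_dominated_convergence (fun _ => (m : ℝ))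
        (fun j => (hmeas _).aestronglyMeasurable) (integrable_const _) (fun j => ?_)
        (ae_restrict_of_ae hlim)
      filter_upwards [ae_restrict_mem hEG] with x hx using hx.2 j
  have hall : ∀ᵐ x ∂D.vol, ∀ m, x ∈ G m → ζ' x = f (a x) :=
    ae_all_iff.2 fun m => (ae_restrict_iff' (hGm m)).1 (key m)
  filter_upwards [hall, hlim] with x hx hl
  obtain ⟨K, hK⟩ := hl.norm.bddAbove_range
  obtain ⟨m, hm⟩ := exists_nat_ge K
  exact hx m fun j => (hK (Set.mem_range_self j)).trans hm

section Limits

variable {f F : ℝ → ℝ} {p c₀ c₁ c₃ c : ℝ} {c₂ : ℝ → ℝ} {ε α : ℝ}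

/-- The nonlinear term is bounded in `L²` by the function and the potential. -/
theorem IsPotential.norm_le (hf : IsNonlinearity d f F p c₀ c₁ c₂ c₃ c) (hε : 0 < ε) {V W : D.H1}
    {ζ : D.H} (h : IsPotential ε f V W ζ) :
    ‖ζ‖ ≤ ‖toL2 W‖ + 2 * (c * ‖toL2 V‖ + |f 0| * ‖oneL2 D‖) := by
  set e : D.H := c • toL2 V - f 0 • oneL2 D with he
  set ξ : D.H := ζ + e with hξ
  have hz : IsA V (ε⁻¹ • (toL2 W - ζ)) := fun φ => by
    rw [real_inner_smul_left, inner_sub_left, h.weak φ, add_sub_cancel_right,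
      inv_mul_cancel_left₀ hε.ne']
  have h1 := hz.inner_monotone_nonneg (g := fun s => f s + c * s - f 0) (ζ := ξ)
    (by have := hf.continuous_f; fun_prop) (fun a b hab => sub_le_sub_right (hf.monotone hab) _)
    (by simp) (by
      filter_upwards [h.ae_eq, Lp.coeFn_add ζ e, Lp.coeFn_sub (c • toL2 V) (f 0 • oneL2 D),
        Lp.coeFn_smul c (toL2 V), Lp.coeFn_smul (f 0) (oneL2 D),
        Lp.coeFn_const (p := 2) (μ := D.vol) (1 : ℝ)] with x h1 h2 h3 h4 h5 h6
      rw [hξ, h2, Pi.add_apply, h1, he, h3, Pi.sub_apply, h4, h5, Pi.smul_apply, Pi.smul_apply,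
        oneL2, h6]
      simp [add_sub_assoc])
  rw [real_inner_smul_left] at h1
  have h2 := nonneg_of_mul_nonneg_right h1 (inv_pos.2 hε)
  -- Here `ξ = f(V) + c V - f(0)` is a monotone function of `V`. Its non-negative pairing with `ε A
  -- V` becomes `‖ξ‖² ≤ ⟪W + e, ξ⟫`.
  have h3 : toL2 W - ζ = (toL2 W + e) - ξ := by rw [hξ]; abel
  rw [h3, inner_sub_left, real_inner_self_eq_norm_sq] at h2
  have h4 := real_inner_le_norm (toL2 W + e) ξ
  have h5 : ‖ξ‖ ≤ ‖toL2 W + e‖ := by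
    rcases eq_or_lt_of_le (norm_nonneg ξ) with h0 | h0
    · rw [← h0]; exact norm_nonneg _
    · nlinarith
  have h6 : ‖e‖ ≤ c * ‖toL2 V‖ + |f 0| * ‖oneL2 D‖ := by
    refine (norm_sub_le _ _).trans ?_
    rw [norm_smul, norm_smul, Real.norm_of_nonneg hf.c_pos.le, Real.norm_eq_abs]
  have h7 : ‖ζ‖ ≤ ‖ξ‖ + ‖e‖ := by
    have : ζ = ξ - e := by rw [hξ, add_sub_cancel_right]
    rw [this]
    exact norm_sub_le _ _
  have h8 := norm_add_le (toL2 W) e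
  linarith

/-- The compactness core. Weak limits are taken of functions, potentials and nonlinear terms, and
Rellich's theorem identifies the last. Subtracting the limit equation and testing with `V - a`
bounds `ε |V - a|₁²` by a constant times `‖V - a‖`, so gradients converge strongly as well. -/
theorem exists_subseq_potential (hf : IsNonlinearity d f F p c₀ c₁ c₂ c₃ c) (hε : 0 < ε)
    {V W : ℕ → D.H1} {ζ : ℕ → D.H} {K : ℝ} (hV : ∀ j, ‖V j‖ ≤ K) (hW : ∀ j, ‖W j‖ ≤ K)
    (h : ∀ j, IsPotential ε f (V j) (W j) (ζ j)) :
    ∃ (φ : ℕ → ℕ) (a w : D.H1) (ζ' : D.H), StrictMono φ ∧ Tendsto (V ∘ φ) atTop (𝓝 a) ∧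
      (∀ y, Tendsto (fun j => ⟪W (φ j), y⟫) atTop (𝓝 ⟪w, y⟫)) ∧ IsPotential ε f a w ζ' := by
  set K' := K + 2 * (c * K + |f 0| * ‖oneL2 D‖) with hK'
  have hζ : ∀ j, ‖ζ j‖ ≤ K' := fun j => by
    refine ((h j).norm_le hf hε).trans ?_
    have := hf.c_pos
    rw [hK']
    gcongr
    · exact (norm_toL2_le _).trans (hW j)
    · exact (norm_toL2_le _).trans (hV j)
  obtain ⟨a, φ₁, hφ₁, ha⟩ := exists_subseq_weakly_tendsto hV
  obtain ⟨w, φ₂, hφ₂, hw⟩ := exists_subseq_weakly_tendsto fun j => hW (φ₁ j)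
  obtain ⟨ζ', φ₃, hφ₃, hζ'⟩ := exists_subseq_weakly_tendsto fun j => hζ (φ₁ (φ₂ j))
  set φ := fun j => φ₁ (φ₂ (φ₃ j)) with hφ
  have ha' : ∀ y, Tendsto (fun j => ⟪V (φ j), y⟫) atTop (𝓝 ⟪a, y⟫) := fun y =>
    (ha y).comp ((hφ₂.comp hφ₃).tendsto_atTop)
  have hw' : ∀ y, Tendsto (fun j => ⟪W (φ j), y⟫) atTop (𝓝 ⟪w, y⟫) := fun y =>
    (hw y).comp hφ₃.tendsto_atTop
  have hstrong := tendsto_toL2_of_weakly (fun j => hV (φ j)) ha'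
  have hpot : IsPotential ε f a w ζ' := by
    refine ⟨ae_eq_of_weakly_tendsto hf.continuous_f (fun j => (h (φ j)).ae_eq) hstrong hζ',
      fun ψ => ?_⟩
    refine tendsto_nhds_unique (tendsto_toL2_inner hw' (toL2 ψ)) ?_
    simp only [fun j => (h (φ j)).weak ψ]
    exact ((tendsto_grad_inner ha' (grad ψ)).const_mul ε).add (hζ' (toL2 ψ))
  refine ⟨φ, a, w, ζ', hφ₁.comp (hφ₂.comp hφ₃), ?_, hw', hpot⟩
  have h0 : Tendsto (fun j => ‖toL2 (V (φ j)) - toL2 a‖) atTop (𝓝 0) :=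
    tendsto_iff_norm_sub_tendsto_zero.1 hstrong
  set L := (K + ‖w‖ + (K' + ‖ζ'‖)) / ε with hL
  have hbd : ∀ j, ‖V (φ j) - a‖ ^ 2 ≤
      ‖toL2 (V (φ j)) - toL2 a‖ ^ 2 + L * ‖toL2 (V (φ j)) - toL2 a‖ := by
    intro j
    have h1 := (h (φ j)).weak (V (φ j) - a)
    have h2 := hpot.weak (V (φ j) - a)
    have h3 : ε * ‖grad (V (φ j) - a)‖ ^ 2 =
        ⟪toL2 (W (φ j)) - toL2 w, toL2 (V (φ j) - a)⟫ - ⟪ζ (φ j) - ζ', toL2 (V (φ j) - a)⟫ := by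
      rw [← real_inner_self_eq_norm_sq]
      nth_rw 1 [grad_sub]
      rw [inner_sub_left, inner_sub_left, inner_sub_left, h1, h2]
      ring
    have h4 := real_inner_le_norm (toL2 (W (φ j)) - toL2 w) (toL2 (V (φ j) - a))
    have h5 := (neg_le_abs _).trans (abs_real_inner_le_norm (ζ (φ j) - ζ') (toL2 (V (φ j) - a)))
    have h6 : ‖toL2 (W (φ j)) - toL2 w‖ ≤ K + ‖w‖ := (norm_sub_le _ _).trans
      (add_le_add ((norm_toL2_le _).trans (hW _)) (norm_toL2_le _))
    have h7 : ‖ζ (φ j) - ζ'‖ ≤ K' + ‖ζ'‖ := (norm_sub_le _ _).trans (add_le_add (hζ _) le_rfl)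
    have h8 := mul_le_mul_of_nonneg_right h6 (norm_nonneg (toL2 (V (φ j) - a)))
    have h9 := mul_le_mul_of_nonneg_right h7 (norm_nonneg (toL2 (V (φ j) - a)))
    have h10 : ‖grad (V (φ j) - a)‖ ^ 2 ≤ L * ‖toL2 (V (φ j) - a)‖ := by
      rw [hL, div_mul_eq_mul_div, le_div_iff₀ hε]
      linarith
    rw [norm_sq_H1, ← toL2_sub]
    linarith
  rw [tendsto_iff_norm_sub_tendsto_zero]
  have h1 : Tendsto (fun j => ‖V (φ j) - a‖ ^ 2) atTop (𝓝 0) := by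
    refine squeeze_zero (fun j => sq_nonneg _) hbd ?_
    simpa using (h0.pow 2).add (h0.const_mul L)
  have h2 := h1.sqrt
  simpa [Real.sqrt_sq (norm_nonneg _)] using h2

/-- What is missing is the mean of `W`, which equals that of `f(V)`. Growth bounds `|f(V)|` by `2
(F(V) + c₃)` plus a constant, and the integral of `F(V) + c₃` is bounded by `⟪f(V), V̄⟫ + C₁(α) ≤
⟪W̄, V̄⟫ + C₁(α)`. -/
theorem exists_norm_potential_le (hf : IsNonlinearity d f F p c₀ c₁ c₂ c₃ c) (hε : 0 < ε)
    (D : SpatialDomain d) (α M : ℝ) :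
    ∃ K, ∀ (V W : D.H1) (ζ : D.H), V ∈ calH1 D α → ‖grad V‖ ≤ M → ‖grad W‖ ≤ M →
      IsPotential ε f V W ζ → ‖V‖ ≤ K ∧ ‖W‖ ≤ K := by
  obtain ⟨C, hC⟩ := exists_poincare D
  have hC : IsPoincareConst D C := hC
  have hC0 := hC.1
  have hvol := volume_domain_pos D
  have bound : ∀ (V : D.H1) (m : ℝ), |mean (toL2 V)| ≤ m → ‖grad V‖ ≤ M →
      ‖V‖ ≤ C * M + m * ‖oneL2 D‖ + M := by
    intro V m hm hM
    have h1 : ‖toL2 V‖ ≤ C * M + m * ‖oneL2 D‖ := by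
      have : toL2 V = center (toL2 V) + mean (toL2 V) • oneL2 D := by
        rw [center_eq, sub_add_cancel]
      rw [this]
      refine (norm_add_le _ _).trans ?_
      rw [norm_smul, Real.norm_eq_abs]
      gcongr
      exact (hC.norm_center_le V).trans (by gcongr)
    have h2 := norm_sq_H1 V
    have h3 : ‖V‖ ≤ ‖toL2 V‖ + ‖grad V‖ := by
      refine abs_le_of_sq_le_sq' ?_ (by positivity) |>.2
      nlinarith [mul_nonneg (norm_nonneg (toL2 V)) (norm_nonneg (grad V))]
    linarith
  set m := (volume.real D.Ω)⁻¹ *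
    (2 * (C * M * (C * M) + C1 D p c₁ c₂ c₃ α) + c₂ 1 * volume.real D.Ω) with hm
  refine ⟨max (C * M + α * ‖oneL2 D‖ + M) (C * M + m * ‖oneL2 D‖ + M), fun V W ζ hVα hV hW h =>
    ⟨(bound V α hVα hV).trans (le_max_left _ _), (bound W m ?_ hW).trans (le_max_right _ _)⟩⟩
  have hM : 0 ≤ M := (norm_nonneg _).trans hV
  obtain ⟨o, ho1, ho2⟩ := exists_oneH1 D
  have h1 := h.weak o
  rw [ho2, inner_zero_right, mul_zero, zero_add, ho1] at h1
  rw [mean_eq_inner, h1, abs_mul, abs_of_pos (inv_pos.2 hvol), hm]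
  gcongr
  have h2 : ⟪ζ, center (toL2 V)⟫ ≤ C * M * (C * M) := by
    obtain ⟨y, hy1, hy2⟩ := exists_centerH1 V
    have h3 := h.weak y
    rw [hy1, hy2, real_inner_self_eq_norm_sq, real_inner_comm,
      ← inner_center_of_mean_zero (mean_center (toL2 V))] at h3
    have h4 := real_inner_le_norm (center (toL2 V)) (center (toL2 W))
    have h5 : ‖center (toL2 V)‖ * ‖center (toL2 W)‖ ≤ C * M * (C * M) := by
      gcongr
      · exact (hC.norm_center_le V).trans (by gcongr)
      · exact (hC.norm_center_le W).trans (by gcongr)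
    have : 0 ≤ ε * ‖grad V‖ ^ 2 := by positivity
    linarith
  have h3 := h.inner_center_ge hf hVα
  have h4 : |⟪ζ, oneL2 D⟫| ≤ ∫ x in D.Ω, (2 * (F (toL2 V x) + c₃) + c₂ 1) := by
    rw [oneL2, inner_const, one_mul, ← Real.norm_eq_abs]
    refine norm_integral_le_of_norm_le (((h.integrable_F hf).const_mul 2).add
      (integrable_const _)) ?_
    filter_upwards [h.ae_eq] with x hx
    rw [hx, Real.norm_eq_abs]
    have e1 := hf.growth 1 one_pos (toL2 V x)
    have e2 := hf.F_lower (toL2 V x)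
    linarith
  rw [integral_add ((h.integrable_F hf).const_mul 2) (integrable_const _), integral_const_mul,
    integral_const, smul_eq_mul, measureReal_restrict_apply_univ, mul_comm (volume.real D.Ω)] at h4
  linarith

theorem norm_le_of_weakly_tendsto {X : Type*} [NormedAddCommGroup X] [InnerProductSpace ℝ X]
    {x : ℕ → X} {a : X} {M : ℝ} (hx : ∀ n, ‖x n‖ ≤ M)
    (h : Tendsto (fun n => ⟪x n, a⟫) atTop (𝓝 ⟪a, a⟫)) : ‖a‖ ≤ M := by
  have h1 : ⟪a, a⟫ ≤ M * ‖a‖ := le_of_tendsto h (Eventually.of_forall fun n =>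
    (real_inner_le_norm _ _).trans (mul_le_mul_of_nonneg_right (hx n) (norm_nonneg _)))
  rw [real_inner_self_eq_norm_sq] at h1
  rcases eq_or_lt_of_le (norm_nonneg a) with h0 | h0
  · rw [← h0]
    exact (norm_nonneg _).trans (hx 0)
  · nlinarith

theorem isClosed_calH1 (D : SpatialDomain d) (α : ℝ) : IsClosed (calH1 D α) :=
  isClosed_le (continuous_mean.comp (toL2L D).continuous).abs continuous_const

theorem isCompact_regularSet (hf : IsNonlinearity d f F p c₀ c₁ c₂ c₃ c) (hε : 0 < ε)
    (D : SpatialDomain d) (α M : ℝ) : IsCompact (regularSet D ε f α M) := by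
  refine IsSeqCompact.isCompact fun V hV => ?_
  obtain ⟨K, hK⟩ := exists_norm_potential_le hf hε D α M
  choose hα hVM W ζ hpot hWM using hV
  obtain ⟨φ, a, w, ζ', hφ, ha, hw, h⟩ := exists_subseq_potential hf hε
    (fun j => (hK _ _ _ (hα j) (hVM j) (hWM j) (hpot j)).1)
    (fun j => (hK _ _ _ (hα j) (hVM j) (hWM j) (hpot j)).2) hpot
  refine ⟨a, ⟨?_, ?_, w, ζ', h, ?_⟩, φ, hφ, ha⟩
  · exact (isClosed_calH1 D α).mem_of_tendsto ha (Eventually.of_forall fun j => hα _)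
  · exact le_of_tendsto (((gradL D).continuous.tendsto a).comp ha).norm
      (Eventually.of_forall fun j => hVM _)
  · exact norm_le_of_weakly_tendsto (fun j => hWM (φ j)) (tendsto_grad_inner hw _)

/-- The graph of the step relation is closed in the following sense. -/
theorem eulerStep_of_tendsto (hf : IsNonlinearity d f F p c₀ c₁ c₂ c₃ c) (hε : 0 < ε)
    {κ : ℝ} {u : ℕ → D.H} {V : ℕ → D.H1} {x : D.H} {y : D.H1}
    (h : ∀ j, EulerStep ε f κ (u j) (toL2 (V j))) (hu : Tendsto u atTop (𝓝 x))
    (hV : Tendsto V atTop (𝓝 y)) : EulerStep ε f κ x (toL2 y) := by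
  obtain ⟨C, hC⟩ := exists_poincare D
  have hC : IsPoincareConst D C := hC
  choose V' W ζ hVV hpot hW using fun j => (h j).exists_potential
  have hVV' : V' = V := funext fun j => toL2_injective (hVV j)
  subst hVV'
  have hVL : Tendsto (fun j => toL2 (V' j)) atTop (𝓝 (toL2 y)) :=
    ((toL2L D).continuous.tendsto y).comp hV
  have hq : Tendsto (fun j => -(κ⁻¹ • (toL2 (V' j) - u j))) atTop (𝓝 (-(κ⁻¹ • (toL2 y - x)))) :=
    ((hVL.sub hu).const_smul _).neg
  obtain ⟨K₁, hK₁⟩ := (continuous_mean.tendsto _ |>.comp hVL).norm.bddAbove_range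
  obtain ⟨K₂, hK₂⟩ := hV.norm.bddAbove_range
  obtain ⟨K₃, hK₃⟩ := hq.norm.bddAbove_range
  -- No convergence of the potentials is given. Their gradients are bounded through `A W = -κ⁻¹ (V -
  -- u)`, and their means through the nonlinearity.
  obtain ⟨K, hK⟩ := exists_norm_potential_le hf hε D K₁ (max K₂ (C * K₃))
  have hWb : ∀ j, ‖grad (W j)‖ ≤ max K₂ (C * K₃) := by
    intro j
    refine (((hW j).norm_grad_le_mul hC ?_).trans ?_).trans (le_max_right _ _)
    · rw [mean_eq_zero_iff, (hW j).inner_one]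
    · exact mul_le_mul_of_nonneg_left (hK₃ (Set.mem_range_self j)) hC.1.le
  have hb := fun j => hK (V' j) (W j) (ζ j) (hK₁ (Set.mem_range_self j))
    (((norm_grad_le _).trans (hK₂ (Set.mem_range_self j))).trans (le_max_left _ _)) (hWb j) (hpot j)
  obtain ⟨φ, a, w, ζ', hφ, ha, hw, hp⟩ := exists_subseq_potential hf hε
    (fun j => (hb j).1) (fun j => (hb j).2) hpot
  obtain rfl : a = y := tendsto_nhds_unique ha (hV.comp hφ.tendsto_atTop)
  refine hp.eulerStep hε fun ψ => ?_
  refine tendsto_nhds_unique (tendsto_grad_inner hw (grad ψ)) ?_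
  simp only [fun j => (hW (φ j)) ψ]
  exact (hq.comp hφ.tendsto_atTop).inner tendsto_const_nhds

end Limits

end

section

variable {d : ℕ} {D : SpatialDomain d}

/-! ### The global attractor -/

section Evolve

variable {ε : ℝ} {f : ℝ → ℝ} {α : ℝ} {J : TimeGrid} {B : Set D.H}

theorem evolve_zero : evolve ε f J 0 B = B := by
  ext v
  constructor
  · rintro ⟨u, hu, -, rfl⟩
    exact hu
  · exact fun hv => ⟨fun _ => v, hv, fun j hj => absurd hj j.not_lt_zero, rfl⟩

theorem mem_evolve_succ {n : ℕ} {w : D.H} :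
    w ∈ evolve ε f J (n + 1) B ↔ ∃ v ∈ evolve ε f J n B, EulerStep ε f (J.step n) v w := by
  constructor
  · rintro ⟨u, hu0, hu, rfl⟩
    exact ⟨u n, ⟨u, hu0, fun j hj => hu j (by omega), rfl⟩, hu n n.lt_succ_self⟩
  · rintro ⟨_, ⟨u, hu0, hu, rfl⟩, h⟩
    refine ⟨Function.update u (n + 1) w, ?_, fun j hj => ?_, Function.update_self ..⟩
    · rwa [Function.update_of_ne (by omega)]
    · rw [Function.update_of_ne (by omega)]
      rcases Nat.lt_succ_iff_lt_or_eq.1 hj with hj | rfl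
      · rw [Function.update_of_ne (by omega)]
        exact hu j hj
      · rwa [Function.update_self]

/-- The part in `H¹` of the trajectories that start in `B`, from the time step `N` on. -/
def evolveTail (ε : ℝ) (f : ℝ → ℝ) (J : TimeGrid) (B : Set D.H) (N : ℕ) : Set D.H1 :=
  {x | ∃ n ≥ N, toL2 x ∈ evolve ε f J n B}

theorem evolveTail_anti {N M : ℕ} (h : N ≤ M) :
    evolveTail ε f J B M ⊆ evolveTail ε f J B N :=
  fun _ ⟨n, hn, hx⟩ => ⟨n, h.trans hn, hx⟩

/-- The `ω`-limit set of `B`. -/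
def omegaLimitSet (ε : ℝ) (f : ℝ → ℝ) (J : TimeGrid) (B : Set D.H) : Set D.H1 :=
  ⋂ N, closure (evolveTail ε f J B N)

/-- The closure of the union of the `ω`-limit sets of all bounded sets. -/
def attractor (D : SpatialDomain d) (ε : ℝ) (f : ℝ → ℝ) (α : ℝ) (J : TimeGrid) : Set D.H1 :=
  closure (⋃ (B : Set D.H) (_ : IsBddIn α B), omegaLimitSet ε f J B)

theorem omegaLimitSet_subset_attractor (hB : IsBddIn α B) :
    omegaLimitSet ε f J B ⊆ attractor D ε f α J :=
  fun _ hx => subset_closure (Set.mem_iUnion₂.2 ⟨B, hB, hx⟩)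

theorem attractor_subset {K : Set D.H1} (hK : IsClosed K)
    (h : ∀ B : Set D.H, IsBddIn α B → omegaLimitSet ε f J B ⊆ K) : attractor D ε f α J ⊆ K :=
  closure_minimal (Set.iUnion₂_subset h) hK

theorem IsAbsorbing.isAttracting {K : Set D.H1} (h : IsAbsorbing ε f α J K) :
    IsAttracting ε f α J K := fun B hB δ hδ => by
  obtain ⟨N, hN⟩ := h B hB
  exact ⟨N, fun n hn => (hN n hn).trans (Set.image_mono (Metric.self_subset_thickening hδ K))⟩

theorem evolveTail_subset {K : Set D.H1} {N : ℕ}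
    (h : ∀ n ≥ N, evolve ε f J n B ⊆ toL2 '' K) : evolveTail ε f J B N ⊆ K := by
  rintro x ⟨n, hn, hx⟩
  obtain ⟨y, hy, he⟩ := h n hn hx
  exact toL2_injective he ▸ hy

/-- The tails lie in every thickening of `K`, so their closures lie in every closed thickening, and
these intersect in `K`. -/
theorem IsAttracting.omegaLimitSet_subset {K : Set D.H1} (h : IsAttracting ε f α J K)
    (hK : IsClosed K) (hB : IsBddIn α B) : omegaLimitSet ε f J B ⊆ K := by
  intro x hx
  rw [← hK.closure_eq, Metric.closure_eq_iInter_cthickening]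
  refine Set.mem_iInter₂.2 fun δ hδ => ?_
  obtain ⟨N, hN⟩ := h B hB δ hδ
  exact Metric.closure_thickening_subset_cthickening δ K
    (closure_mono (evolveTail_subset hN) (Set.mem_iInter.1 hx N))

theorem IsAttracting.attractor_subset {K : Set D.H1} (h : IsAttracting ε f α J K)
    (hK : IsClosed K) : attractor D ε f α J ⊆ K :=
  CahnHilliard.attractor_subset hK fun _ hB => h.omegaLimitSet_subset hK hB

/-- The part of `K` at distance at least `δ` from the attractor is compact and misses the `ω`-limit
set, which is a decreasing intersection of closed tails. Hence it already misses one of the tails.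
-/
theorem isAttracting_attractor {K : Set D.H1} (hK : IsCompact K) (h : IsAbsorbing ε f α J K) :
    IsAttracting ε f α J (attractor D ε f α J) := by
  intro B hB δ hδ
  obtain ⟨N₀, hN₀⟩ := h B hB
  obtain ⟨N, hN⟩ := (hK.diff (Metric.isOpen_thickening (δ := δ)
    (E := attractor D ε f α J))).elim_directed_family_closed
    (fun N => closure (evolveTail ε f J B N)) (fun N => isClosed_closure) (by
      rw [← Set.disjoint_iff_inter_eq_empty, Set.disjoint_left]
      exact fun x hx hx' => hx.2 (Metric.self_subset_thickening hδ _
        (omegaLimitSet_subset_attractor hB hx')))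
    (directed_of_isDirected_le fun N M hNM => closure_mono (evolveTail_anti hNM))
  refine ⟨max N₀ N, fun n hn v hv => ?_⟩
  obtain ⟨x, hx, rfl⟩ := hN₀ n ((le_max_left _ _).trans hn) hv
  refine ⟨x, ?_, rfl⟩
  by_contra hcon
  have : x ∈ (K \ Metric.thickening δ (attractor D ε f α J)) ∩ closure (evolveTail ε f J B N) :=
    ⟨⟨hx, hcon⟩, subset_closure ⟨n, (le_max_right _ _).trans hn, hv⟩⟩
  rw [hN] at this
  exact this

theorem dualNorm_zero : dualNorm (0 : D.H) = 0 := by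
  simp [dualNorm]

theorem isBddIn_zero (hα : 0 ≤ α) : IsBddIn α ({0} : Set D.H) := by
  have h0 : mean (0 : D.H) = 0 := by rw [mean_eq_inner, inner_zero_left, mul_zero]
  refine ⟨fun u hu => ?_, 0, fun u hu => ?_⟩
  · rw [Set.mem_singleton_iff.1 hu, h0, abs_zero]
    exact hα
  · rw [Set.mem_singleton_iff.1 hu, center_eq, h0, zero_smul, sub_zero, dualNorm_zero]
    exact zero_le

/-- Zero is stationary with constant potential `f 0`; this explicit trajectory makes the attractor
non-empty. -/
theorem eulerStep_zero (hε : 0 < ε) (κ : ℝ) : EulerStep ε f κ (0 : D.H) 0 := by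
  obtain ⟨W, hW1, hW2⟩ := exists_H1_const D (f 0)
  have h : IsPotential ε f (0 : D.H1) W (toL2 W) := by
    refine ⟨?_, fun φ => ?_⟩
    · rw [hW1]
      filter_upwards [Lp.coeFn_const (p := 2) (μ := D.vol) (f 0), Lp.coeFn_zero ℝ 2 D.vol]
        with x h1 h2
      rw [h1, toL2_zero, h2]
      simp
    · rw [grad_zero, inner_zero_left, mul_zero, zero_add]
  have h1 := h.eulerStep hε (κ := κ) (u := 0) fun φ => by
    rw [hW2, toL2_zero, sub_zero, smul_zero, neg_zero, inner_zero_left, inner_zero_left]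
  rwa [toL2_zero] at h1

theorem zero_mem_attractor (hε : 0 < ε) (hα : 0 ≤ α) : (0 : D.H1) ∈ attractor D ε f α J := by
  refine omegaLimitSet_subset_attractor (isBddIn_zero hα) (Set.mem_iInter.2 fun N =>
    subset_closure ⟨N, le_rfl, fun _ => 0, rfl, fun j _ => eulerStep_zero hε _, ?_⟩)
  exact toL2_zero.symm

/-- Bounded subsets of `ℋ¹_α` are bounded in `ℋ_α`. -/
theorem isBddIn_image {M : ℝ} {X : Set D.H1} (h : X ⊆ calH1 D α) (hM : ∀ x ∈ X, ‖grad x‖ ≤ M) :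
    IsBddIn α (toL2 '' X) := by
  obtain ⟨γ, hγ, h'⟩ := exists_isDualPoincareConst D
  refine ⟨?_, γ * M, ?_⟩
  · rintro _ ⟨x, hx, rfl⟩
    exact h hx
  · rintro _ ⟨x, hx, rfl⟩
    exact (h' x).trans (ENNReal.ofReal_le_ofReal (mul_le_mul_of_nonneg_left (hM x hx) hγ.le))

end Evolve

/-! ### Invariance and minimality of the attractor. -/

section Attractor

variable {f F : ℝ → ℝ} {p c₀ c₁ c₃ c : ℝ} {c₂ : ℝ → ℝ} {ε α κ : ℝ} {J : TimeGrid}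

/-- The result of one step from a compact set is closed. -/
theorem isClosed_step (hf : IsNonlinearity d f F p c₀ c₁ c₂ c₃ c) (hε : 0 < ε) {X : Set D.H1}
    (hX : IsCompact X) : IsClosed {y : D.H1 | ∃ x ∈ X, EulerStep ε f κ (toL2 x) (toL2 y)} := by
  refine IsSeqClosed.isClosed fun y y' hy hlim => ?_
  choose x hx hstep using hy
  obtain ⟨x', hx', φ, hφ, hlim'⟩ := hX.isSeqCompact hx
  exact ⟨x', hx', eulerStep_of_tendsto hf hε (fun j => hstep (φ j))
    (((toL2L D).continuous.tendsto x').comp hlim') (hlim.comp hφ.tendsto_atTop)⟩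

/-- Points approximating `y` have predecessors in the compact set `K`. A limit of these again lies
in the `ω`-limit set, and the closed graph makes it a predecessor of `y`. -/
theorem omegaLimitSet_subset_step (hf : IsNonlinearity d f F p c₀ c₁ c₂ c₃ c) (hε : 0 < ε)
    {K : Set D.H1} (hK : IsCompact K) (h : IsAbsorbing ε f α J K) (hJ : ∀ n, J.step n = κ)
    {B : Set D.H} (hB : IsBddIn α B) :
    omegaLimitSet ε f J B ⊆
      {y : D.H1 | ∃ x ∈ omegaLimitSet ε f J B, EulerStep ε f κ (toL2 x) (toL2 y)} := by
  intro y hy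
  obtain ⟨N₀, hN₀⟩ := h B hB
  have hex : ∀ j : ℕ, ∃ z : D.H1, dist z y < 1 / ((j : ℝ) + 1) ∧ ∃ x ∈ K,
      x ∈ evolveTail ε f J B j ∧ EulerStep ε f κ (toL2 x) (toL2 z) := by
    intro j
    -- The index is raised by one so that the predecessor still comes after both the absorption time
    -- and `j`.
    obtain ⟨z, ⟨n, hn, hz⟩, hd⟩ := Metric.mem_closure_iff.1
      (Set.mem_iInter.1 hy (max N₀ j + 1)) (1 / ((j : ℝ) + 1)) (by positivity)
    obtain ⟨m, rfl⟩ : ∃ m, n = m + 1 := ⟨n - 1, by omega⟩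
    obtain ⟨v, hv, hstep⟩ := mem_evolve_succ.1 hz
    obtain ⟨x, hx, rfl⟩ := hN₀ m (by omega) hv
    refine ⟨z, by rwa [dist_comm], x, hx, ⟨m, by omega, hv⟩, ?_⟩
    rwa [hJ] at hstep
  choose z hz x hxK hxT hstep using hex
  obtain ⟨x', -, φ, hφ, hlim⟩ := hK.isSeqCompact hxK
  have hzlim : Tendsto z atTop (𝓝 y) := tendsto_iff_dist_tendsto_zero.2
    (squeeze_zero (fun _ => dist_nonneg) (fun j => (hz j).le) tendsto_one_div_add_atTop_nhds_zero_nat)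
  refine ⟨x', Set.mem_iInter.2 fun N => ?_, ?_⟩
  · refine mem_closure_of_tendsto hlim ?_
    filter_upwards [eventually_ge_atTop N] with j hj
    exact evolveTail_anti (hj.trans (hφ.id_le j)) (hxT (φ j))
  · exact eulerStep_of_tendsto hf hε (fun j => hstep (φ j))
      (((toL2L D).continuous.tendsto x').comp hlim) (hzlim.comp hφ.tendsto_atTop)

theorem isGlobalAttractor_attractor (hf : IsNonlinearity d f F p c₀ c₁ c₂ c₃ c) (hε : 0 < ε)
    (hα : 0 ≤ α) {M : ℝ} (h : IsAbsorbing ε f α J (regularSet D ε f α M)) :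
    IsGlobalAttractor ε f α J (attractor D ε f α J) := by
  have hK := isCompact_regularSet hf hε D α M
  have hsub : attractor D ε f α J ⊆ regularSet D ε f α M :=
    h.isAttracting.attractor_subset hK.isClosed
  have hcomp : IsCompact (attractor D ε f α J) := hK.of_isClosed_subset isClosed_closure hsub
  refine ⟨⟨0, zero_mem_attractor hε hα⟩, fun x hx => (hsub hx).1, hcomp,
    isAttracting_attractor hK h, fun K hKc hKa => hKa.attractor_subset hKc, fun κ hκ => ?_⟩
  have h1 : attractor D ε f α J ⊆
      {y : D.H1 | ∃ x ∈ attractor D ε f α J, EulerStep ε f κ (toL2 x) (toL2 y)} := by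
    refine attractor_subset (isClosed_step hf hε hcomp) fun B hB y hy => ?_
    obtain ⟨x, hx, hstep⟩ := omegaLimitSet_subset_step hf hε hK h hκ hB hy
    exact ⟨x, omegaLimitSet_subset_attractor hB hx, hstep⟩
  refine Set.Subset.antisymm ?_ h1
  rintro y ⟨x, hx, hstep⟩
  -- Negative invariance makes each point of the attractor reachable from the attractor in any
  -- number of steps. A further step therefore lands in the `ω`-limit set of the attractor, which is
  -- itself a bounded set.
  have h2 : ∀ n, ∀ x ∈ attractor D ε f α J,
      toL2 x ∈ evolve ε f J n (toL2 '' attractor D ε f α J) := by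
    intro n
    induction n with
    | zero => exact fun x hx => by rw [evolve_zero]; exact ⟨x, hx, rfl⟩
    | succ n ih =>
      intro x hx
      obtain ⟨x', hx', hs⟩ := h1 hx
      exact mem_evolve_succ.2 ⟨_, ih x' hx', by rwa [hκ]⟩
  refine omegaLimitSet_subset_attractor
    (isBddIn_image (M := M) (fun x hx => (hsub hx).1) fun x hx => (hsub hx).2.1)
    (Set.mem_iInter.2 fun N => subset_closure ⟨N + 1, N.le_succ, ?_⟩)
  exact mem_evolve_succ.2 ⟨_, h2 N x hx, by rwa [hκ]⟩

theorem isAbsorbing_semi1_le (hf : IsNonlinearity d f F p c₀ c₁ c₂ c₃ c) (hε : 0 < ε)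
    (hC : 0 < C1 D p c₁ c₂ c₃ α) (γ : ℝ) (hJ : ∀ n, J.step n ≤ 8 * ε / c ^ 2) {r : ℝ}
    (hr : 0 < r) : IsAbsorbing ε f α J
      {v : D.H1 | v ∈ calH1 D α ∧ semi1 v ≤ rho1 (C1 D p c₁ c₂ c₃ α) γ ε c r} := by
  rintro B ⟨hBα, R, hBR⟩
  obtain ⟨N, -, hN⟩ := exists_semi1_le (D := D) hf hε hC γ hJ R hr
  refine ⟨N, ?_⟩
  rintro n hn _ ⟨u, hu0, hu, rfl⟩
  obtain ⟨v, hv, h⟩ := hN n hn u hu (hBR _ hu0) (hBα _ hu0)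
  exact ⟨v, h, hv⟩

theorem isClosed_semi1_le (D : SpatialDomain d) (α ρ : ℝ) :
    IsClosed {v : D.H1 | v ∈ calH1 D α ∧ semi1 v ≤ ρ} :=
  (isClosed_calH1 D α).inter (isClosed_le (gradL D).continuous.norm continuous_const)

end Attractor

end

end CahnHilliard

end

/-! ### Assembly of the theorem. -/

open CahnHilliard in
theorem mainTheorem4 {d : ℕ} (hd1 : 1 ≤ d) (hd3 : d ≤ 3) (D : SpatialDomain d)
    {f F : ℝ → ℝ} {p c₀ c₁ c₃ c : ℝ} {c₂ : ℝ → ℝ}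
    (hf : IsNonlinearity d f F p c₀ c₁ c₂ c₃ c)
    {ε : ℝ} (hε : 0 < ε) {α : ℝ} (hα : 0 ≤ α) (hC : 0 < C1 D p c₁ c₂ c₃ α) :
    (∃ γ₁ > 0, IsDualPoincareConst D γ₁) ∧
    ∀ γ₁ > 0, IsDualPoincareConst D γ₁ →
      (∀ J : TimeGrid, (∀ n, J.step n ≤ 8 * ε / c ^ 2) →
        (∀ R : ℝ, ∀ r > 0, ∃ n₁ : ℕ, 1 ≤ n₁ ∧ ∀ u : ℕ → D.H, IsSolution ε f J u →
          dualNorm (center (u 0)) ≤ ENNReal.ofReal R → |mean (u 0)| ≤ α →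
          ∀ n ≥ n₁, ∃ v : D.H1, toL2 v = u n ∧
            semi1 v ≤ rho1 (C1 D p c₁ c₂ c₃ α) γ₁ ε c r) ∧
        (∀ r > 0, IsAbsorbing ε f α J
          {v : D.H1 | v ∈ calH1 D α ∧ semi1 v ≤ rho1 (C1 D p c₁ c₂ c₃ α) γ₁ ε c r}) ∧
        ∃! 𝒜 : Set D.H1, IsGlobalAttractor ε f α J 𝒜) ∧
      ∀ r > 0, ∀ v ∈ ⋃₀ {𝒜 : Set D.H1 | ∃ J : TimeGrid,
          (∀ n, J.step n ≤ 8 * ε / c ^ 2) ∧ IsGlobalAttractor ε f α J 𝒜},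
        semi1 v ≤ rho1 (C1 D p c₁ c₂ c₃ α) γ₁ ε c r := by
  refine ⟨exists_isDualPoincareConst D, fun γ₁ _ _ => ⟨fun J hJ => ⟨fun R r hr => ?_,
    fun r hr => isAbsorbing_semi1_le hf hε hC γ₁ hJ hr, ?_⟩, ?_⟩⟩
  · obtain ⟨n₁, hn₁, h⟩ := exists_semi1_le (D := D) hf hε hC γ₁ hJ R hr
    refine ⟨n₁, hn₁, fun u hu hR hm n hn => ?_⟩
    obtain ⟨v, hv, -, hle⟩ := h n hn u (fun j _ => hu j) hR hm
    exact ⟨v, hv, hle⟩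
  · obtain ⟨M, hM⟩ := exists_isAbsorbing_regularSet (D := D) (α := α) hf hε
    have hA := isGlobalAttractor_attractor hf hε hα (hM J hJ)
    -- Each of two attractors is a closed attracting set, so minimality gives both inclusions.
    refine ⟨_, hA, fun A' hA' => ?_⟩
    exact Set.Subset.antisymm (hA'.minimal _ hA.isCompact.isClosed hA.isAttracting)
      (hA.minimal _ hA'.isCompact.isClosed hA'.isAttracting)
  · rintro r hr v ⟨A, ⟨J, hJ, hA⟩, hv⟩
    -- The ball of radius `ρ̂₁` is closed and absorbing on every admissible grid, so each attractor
    -- lies in it by minimality.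
    exact (hA.minimal _ (isClosed_semi1_le D α _)
      (isAbsorbing_semi1_le hf hε hC γ₁ hJ hr).isAttracting hv).2
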